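/- **Theorem (Comparison principle with absorption term).** Let $n\ge 1$, let $\Omega\subset\mathbb R^n$ be a bounded Lipschitz domain, $\Omega_e=\mathbb R^n\setminus\overline\Omega$, $T>0$, $\Omega_T=\Omega\times(0,T)$, $0<s<\alpha\le 1$, $m>1$ and $\Phi^m(t)=|t|^{m-1}t$. Let $K:\mathbb R^n\times\mathbb R^n\to\mathbb R$ be measurable and symmetric with $\lambda\le K\le\Lambda$ for some $0<\lambda\le\Lambda<\infty$, and let $L_K$ be the associated nonlocal operator of order $2s$, with bilinear form $$B_K(u,v)=\int_{\mathbb R^{2n}}K(x,y)\frac{(u(x)-u(y))(v(x)-v(y))}{|x-y|^{n+2s}}\,dx\,dy .$$ Let $\rho,q\in C^{1,\alpha}(\mathbb R^n)$ be nonnegative, with $\rho$ bounded below by a positive constant. Let $\widetilde H^s(\Omega)$ be the closure of $C_c^\infty(\Omega)$ in $H^s(\mathbb R^n)$; functions in $C_c([0,T]\times\Omega_e)$ are extended by zero in $x$. *Weak solutions.* For $\Phi:\mathbb R\to\mathbb R$, $F\in L^2(\Omega_T)$, $\varphi\in C_c([0,T]\times\Omega_e)$ with $\Phi(\varphi)\in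 L^2(0,T;H^s(\mathbb R^n))$ and $u_0\in L^\infty(\Omega)$, a function $u:\mathbb R^n\times(0,T)\to\mathbb R$ is a solution of $$\rho\,\partial_t u+L_K(\Phi(u))+qu=F\ \text{in }\Omega_T,\qquad u=\varphi\ \text{in }\Omega_e\times(0,T),\qquad u(0)=u_0\ \text{in }\Omega \tag{P}$$ if $\Phi(u)\in L^2(0,T;H^s(\mathbb R^n))$, $\Phi(u-\varphi)\in L^2(0,T;\widetilde H^s(\Omega))$ and $$-\int_{\Omega_T}\rho u\,\partial_t\psi\,dx\,dt+\int_0^TB_K(\Phi(u),\psi)\,dt+\int_{\Omega_T}qu\psi\,dx\,dt=\int_{\Omega_T}F\psi\,dx\,dt+\int_\Omega\rho u_0\,\psi(\cdot,0)\,dx$$ for all $\psi\in C_c^\infty([0,T)\times\Omega)$. *Regularizations.* Let $(\Phi^m_\varepsilon)$, $\varepsilon>0$ small, be odd $C^1$ functions on $\mathbb R$ with $c_\varepsilon\le(\Phi^m_\varepsilon)'\le C_\varepsilon$ for constants $0<c_\varepsilon\le C_\varepsilon<\infty$, such that $\Phi^m_\varepsilon\to\Phi^m$ uniformly on compact sets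 as $\varepsilon\to0$. Then there is a constant $C>0$, depending only on $n,\Omega,T,s,\alpha,m,K,\rho,q$, such that the following holds. For $j=1,2$ let $F_j\in L^2(\Omega_T)$, $\varphi_j\in C_c([0,T]\times\Omega_e)$ with $\Phi^m(\varphi_j)\in L^2(0,T;H^s(\mathbb R^n))$, $u_{0,j}\in L^\infty(\Omega)\cap\widetilde H^s(\Omega)$, and let $u_j$ be a solution of (P) with $\Phi=\Phi^m$ and data $F_j,\varphi_j,u_{0,j}$. Suppose that, for small $\varepsilon>0$, there are $F_j^\varepsilon\in L^2(\Omega_T)$, $\varphi_j^\varepsilon\in C_c([0,T]\times\Omega_e)$ with $\Phi_\varepsilon^m(\varphi_j^\varepsilon)\in L^2(0,T;H^s(\mathbb R^n))$, $u_{0,j}^\varepsilon\in L^\infty(\Omega)\cap\widetilde H^s(\Omega)$ and $u_{j,\varepsilon}\in H^1(0,T;L^2(\Omega))\cap L^2(0,T;H^s(\mathbb R^n))$ such that 1. $\displaystyle\liminf_{\varepsilon\to0}\int_{\Omega_T}(F_1^\varepsilon-F_2^\varepsilon)_+\,dx\,dt\le\int_{\Omega_T}(F_1-F_2)_+\,dx\,dt$;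 2. $\displaystyle\liminf_{\varepsilon\to0}\int_{\Omega_T}\int_{\Omega_e}\frac{(\Phi^m_\varepsilon(\varphi_1^\varepsilon)-\Phi^m_\varepsilon(\varphi_2^\varepsilon))_+(x,t)}{|x-y|^{n+2s}}\,dx\,dy\,dt\le\int_{\Omega_T}\int_{\Omega_e}\frac{(\Phi^m(\varphi_1)-\Phi^m(\varphi_2))_+(x,t)}{|x-y|^{n+2s}}\,dx\,dy\,dt$; 3. $u_{0,j}^\varepsilon\to u_{0,j}$ in $L^1(\Omega)$ as $\varepsilon\to0$; 4. $u_{j,\varepsilon}\rightharpoonup u_j$ weakly in $L^1(\Omega_T)$ as $\varepsilon\to0$; 5. $u_{j,\varepsilon}$ is a solution of (P) with $\Phi=\Phi^m_\varepsilon$ and data $F_j^\varepsilon,\varphi_j^\varepsilon,u_{0,j}^\varepsilon$. Then for almost every $t_0\in(0,T)$ $$\int_\Omega(u_1-u_2)_+(x,t_0)\,dx\le C\left(\int_{\Omega_T}(F_1-F_2)_+\,dx\,dt+\int_\Omega(u_{0,1}-u_{0,2})_+\,dx+\int_{\Omega_T}\int_{\Omega_e}\frac{(\Phi^m(\varphi_1)-\Phi^m(\varphi_2))_+(x,t)}{|x-y|^{n+2s}}\,dx\,dy\,dt\right).$$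 In the double integrals $x$ ranges over $\Omega_e$ and $(y,t)$ over $\Omega_T$. -/

import Mathlib

open MeasureTheory Set Filter Topology
open scoped ENNReal NNReal

noncomputable section

namespace NPME

/-- Euclidean space `ℝⁿ`. -/
abbrev E (n : ℕ) : Type := EuclideanSpace ℝ (Fin n)

variable {n : ℕ}

/-! ### Domains and cylinders -/

/-- Bounded open set with Lipschitz boundary: near each boundary point there are a unit direction
`e` and a Lipschitz function `γ` (evaluated only on the hyperplane orthogonal to `e`) such that the
set is locally the part lying strictly above the graph of `γ` in direction `e`. -/
def IsBoundedLipschitzDomain (Ω : Set (E n)) : Prop :=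
  IsOpen Ω ∧ Bornology.IsBounded Ω ∧
    ∀ x₀ ∈ frontier Ω, ∃ (e : E n) (r : ℝ) (L : ℝ≥0) (γ : E n → ℝ),
      ‖e‖ = 1 ∧ 0 < r ∧ LipschitzWith L γ ∧
        ∀ x ∈ Metric.ball x₀ r, x ∈ Ω ↔ γ (x - (inner ℝ e x) • e) < inner ℝ e x

/-- The exterior `Ω_e = ℝⁿ \ closure Ω`. -/
def exterior (Ω : Set (E n)) : Set (E n) := (closure Ω)ᶜ

/-- The space-time cylinder `A_T = A × (0,T)`; space-time points are pairs `(x, t)`. -/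
def cyl (A : Set (E n)) (T : ℝ) : Set (E n × ℝ) := A ×ˢ Ioo 0 T

/-! ### Fractional Sobolev spaces -/

/-- The squared norm of `H^s(ℝⁿ)`: squared `L²` norm plus squared Gagliardo seminorm. -/
def hsNormSq (s : ℝ) (f : E n → ℝ) : ℝ≥0∞ :=
  (∫⁻ x, ‖f x‖ₑ ^ 2) +
    ∫⁻ x, ∫⁻ y, ‖f x - f y‖ₑ ^ 2 / ENNReal.ofReal (‖x - y‖ ^ ((n : ℝ) + 2 * s))

/-- Membership in `H^s(ℝⁿ)`. -/
def MemHs (s : ℝ) (f : E n → ℝ) : Prop :=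
  AEStronglyMeasurable f volume ∧ hsNormSq s f < ∞

/-- Membership in `H̃^s(Ω)`, the closure of `C_c^∞(Ω)` in `H^s(ℝⁿ)`. -/
def MemHsTilde (Ω : Set (E n)) (s : ℝ) (f : E n → ℝ) : Prop :=
  MemHs s f ∧ ∀ δ : ℝ≥0∞, 0 < δ → ∃ ψ : E n → ℝ,
    ContDiff ℝ (⊤ : ℕ∞) ψ ∧ HasCompactSupport ψ ∧ tsupport ψ ⊆ Ω ∧ hsNormSq s (fun x => f x - ψ x) < δ

/-- Membership in `L²(0,T;H^s(ℝⁿ))`, for functions on `ℝⁿ × (0,T)`. Since `H^s(ℝⁿ)` is separable,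
joint measurability together with the finite norm is the same as Bochner square integrability. -/
def MemL2Hs (T s : ℝ) (u : E n × ℝ → ℝ) : Prop :=
  AEStronglyMeasurable u (volume.restrict (cyl univ T)) ∧
    ∫⁻ t in Ioo 0 T, hsNormSq s (fun x => u (x, t)) < ∞

/-- Membership in `L²(0,T;H̃^s(Ω))`. -/
def MemL2HsTilde (Ω : Set (E n)) (T s : ℝ) (u : E n × ℝ → ℝ) : Prop :=
  MemL2Hs T s u ∧ ∀ᵐ t ∂(volume.restrict (Ioo 0 T)), MemHsTilde Ω s (fun x => u (x, t))

/-- The classical partial derivative in time. -/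
def dt (ψ : E n × ℝ → ℝ) (p : E n × ℝ) : ℝ := deriv (fun τ => ψ (p.1, τ)) p.2

/-- Membership in `L²(Ω_T)`. -/
def MemL2Cyl (Ω : Set (E n)) (T : ℝ) (u : E n × ℝ → ℝ) : Prop :=
  MemLp u 2 (volume.restrict (cyl Ω T))

/-- Membership in `H¹(0,T;L²(Ω))`: the function and its distributional time derivative lie in
`L²(Ω_T)`. -/
def MemH1L2 (Ω : Set (E n)) (T : ℝ) (u : E n × ℝ → ℝ) : Prop :=
  MemL2Cyl Ω T u ∧ ∃ g : E n × ℝ → ℝ, MemL2Cyl Ω T g ∧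
    ∀ ψ : E n × ℝ → ℝ, ContDiff ℝ (⊤ : ℕ∞) ψ → HasCompactSupport ψ → tsupport ψ ⊆ cyl Ω T →
      ∫ p in cyl Ω T, u p * dt ψ p = -∫ p in cyl Ω T, g p * ψ p

/-! ### Coefficients, nonlocal operators and nonlinearities -/

/-- The class `C^{1,α}_+(ℝⁿ)` of nonnegative functions with finite `C^{1,α}` norm. -/
def MemC1HolderNonneg (α : ℝ≥0) (f : E n → ℝ) : Prop :=
  ContDiff ℝ 1 f ∧ (∃ M : ℝ, ∀ x, |f x| ≤ M) ∧ (∃ M : ℝ, ∀ x, ‖fderiv ℝ f x‖ ≤ M) ∧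
    (∃ M : ℝ≥0, HolderWith M α (fderiv ℝ f)) ∧ ∀ x, 0 ≤ f x

/-- Uniform ellipticity of a scalar coefficient. -/
def UniformlyElliptic (f : E n → ℝ) : Prop :=
  ∃ c C : ℝ, 0 < c ∧ ∀ x, c ≤ f x ∧ f x ≤ C

/-- The kernel `K` defines an operator `L_K` of the class `𝓛₀`. -/
def IsKernelL0 (K : E n → E n → ℝ) : Prop :=
  Measurable (Function.uncurry K) ∧ (∀ x y, K x y = K y x) ∧
    ∃ l Λ : ℝ, 0 < l ∧ l ≤ Λ ∧ ∀ x y, l ≤ K x y ∧ K x y ≤ Λ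

/-- The bilinear form `B_K` on `H^s(ℝⁿ)` associated with `L_K`. -/
def bilin (K : E n → E n → ℝ) (s : ℝ) (u v : E n → ℝ) : ℝ :=
  ∫ z : E n × E n,
    K z.1 z.2 * ((u z.1 - u z.2) * (v z.1 - v z.2)) / ‖z.1 - z.2‖ ^ ((n : ℝ) + 2 * s)

/-- The nonlinearity `Φ^m(t) = |t|^{m-1} t`. -/
def Phi (m : ℝ) (t : ℝ) : ℝ := |t| ^ (m - 1) * t

/-- A regularization `(Φ_ε)`, `ε > 0` small, of `Φ^m`: odd `C¹` functions with derivative bounded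
between two positive constants (for each `ε`), converging to `Φ^m` locally uniformly. -/
def IsRegularization (m : ℝ) (Φ : ℝ → ℝ → ℝ) : Prop :=
  (∀ᶠ ε in 𝓝[>] (0 : ℝ), ContDiff ℝ 1 (Φ ε) ∧ (∀ t, Φ ε t = -Φ ε (-t)) ∧
      ∃ c C : ℝ, 0 < c ∧ ∀ t, c ≤ deriv (Φ ε) t ∧ deriv (Φ ε) t ≤ C) ∧
    ∀ S : Set ℝ, IsCompact S → TendstoUniformlyOn Φ (Phi m) (𝓝[>] (0 : ℝ)) S

/-! ### Data and weak solutions -/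

/-- `φ ∈ C_c([0,T] × Ω_e)`, extended by zero in the space variable. -/
def MemCc (Ω : Set (E n)) (T : ℝ) (φ : E n × ℝ → ℝ) : Prop :=
  ContinuousOn φ (univ ×ˢ Icc 0 T) ∧
    ∃ S : Set (E n × ℝ), IsCompact S ∧ S ⊆ exterior Ω ×ˢ Icc 0 T ∧
      ∀ p ∈ (univ : Set (E n)) ×ˢ Icc 0 T, p ∉ S → φ p = 0

/-- `φ ∈ C_c([0,T] × Ω_e)` with `Φ(φ) ∈ L²(0,T;H^s(ℝⁿ))`. -/
def IsExteriorDatum (Ω : Set (E n)) (T s : ℝ) (Φ : ℝ → ℝ) (φ : E n × ℝ → ℝ) : Prop :=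
  MemCc Ω T φ ∧ MemL2Hs T s (fun p => Φ (φ p))

/-- `u₀ ∈ L^∞(Ω) ∩ H̃^s(Ω)`. -/
def IsInitialDatum (Ω : Set (E n)) (s : ℝ) (u₀ : E n → ℝ) : Prop :=
  MemLp u₀ ⊤ (volume.restrict Ω) ∧ MemHsTilde Ω s u₀

/-- `u : ℝⁿ × (0,T) → ℝ` is a weak solution of `ρ ∂ₜu + L_K(Φ(u)) + q u = F` in `Ω_T`,
`u = φ` in `(Ω_e)_T`, `u(0) = u₀` in `Ω`. The test functions of `C_c^∞([0,T) × Ω)` are the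
restrictions to `t ≥ 0` of smooth functions with compact support in `Ω × (-∞,T)`. -/
structure IsWeakSolution (Ω : Set (E n)) (T s : ℝ) (K : E n → E n → ℝ) (ρ q : E n → ℝ)
    (Φ : ℝ → ℝ) (F φ : E n × ℝ → ℝ) (u₀ : E n → ℝ) (u : E n × ℝ → ℝ) : Prop where
  memL2Hs : MemL2Hs T s (fun p => Φ (u p))
  memL2HsTilde : MemL2HsTilde Ω T s (fun p => Φ (u p - φ p))
  weak_eq : ∀ ψ : E n × ℝ → ℝ, ContDiff ℝ (⊤ : ℕ∞) ψ → HasCompactSupport ψ → tsupport ψ ⊆ Ω ×ˢ Iio T →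
    -(∫ p in cyl Ω T, ρ p.1 * u p * dt ψ p)
        + (∫ t in Ioo 0 T, bilin K s (fun x => Φ (u (x, t))) (fun x => ψ (x, t)))
        + (∫ p in cyl Ω T, q p.1 * u p * ψ p)
      = (∫ p in cyl Ω T, F p * ψ p) + ∫ x in Ω, ρ x * u₀ x * ψ (x, 0)

/-! ### Quantities in the comparison estimate -/

/-- `∫_{Ω_T} (F₁ - F₂)_+ dx dt`. -/
def sourceTerm (Ω : Set (E n)) (T : ℝ) (F₁ F₂ : E n × ℝ → ℝ) : ℝ≥0∞ :=
  ∫⁻ p in cyl Ω T, ENNReal.ofReal (max (F₁ p - F₂ p) 0)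

/-- `∫_Ω (v₁ - v₂)_+ dx`. -/
def spaceTerm (Ω : Set (E n)) (v₁ v₂ : E n → ℝ) : ℝ≥0∞ :=
  ∫⁻ x in Ω, ENNReal.ofReal (max (v₁ x - v₂ x) 0)

/-- `∫_{Ω_T} ∫_{Ω_e} (Φ(φ₁) - Φ(φ₂))_+(x,t) / |x-y|^{n+2s} dx dy dt`, with `x ∈ Ω_e`, `y ∈ Ω`. -/
def exteriorTerm (Ω : Set (E n)) (T s : ℝ) (Φ : ℝ → ℝ) (φ₁ φ₂ : E n × ℝ → ℝ) : ℝ≥0∞ :=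
  ∫⁻ t in Ioo 0 T, ∫⁻ y in Ω, ∫⁻ x in exterior Ω,
    ENNReal.ofReal (max (Φ (φ₁ (x, t)) - Φ (φ₂ (x, t))) 0 / ‖x - y‖ ^ ((n : ℝ) + 2 * s))

/-- Weak convergence `u_ε ⇀ u` in `L¹(μ)` as `ε → 0+`, tested against bounded functions. -/
def WeakTendstoL1 {X : Type*} [MeasurableSpace X] (μ : Measure X) (uε : ℝ → X → ℝ) (u : X → ℝ) :
    Prop :=
  (∀ᶠ ε in 𝓝[>] (0 : ℝ), Integrable (uε ε) μ) ∧ Integrable u μ ∧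
    ∀ g : X → ℝ, Measurable g → (∃ M : ℝ, ∀ x, |g x| ≤ M) →
      Tendsto (fun ε => ∫ x, uε ε x * g x ∂μ) (𝓝[>] (0 : ℝ)) (𝓝 (∫ x, u x * g x ∂μ))

end NPME

end

/-! The estimate is proved directly for `u₁`, `u₂`. Formally, subtract the equations and test with
the indicator of `{u₁ > u₂}`, which is also `sign₊(Φ(u₁) - Φ(u₂))` because `Φ` is strictly
increasing. The time derivative becomes that of `∫ ρ (u₁ - u₂)₊`. The term with `q ≥ 0` has a good
sign, and the sources contribute at most `∫ (F₁ - F₂)₊`. In the nonlocal form, pairs of points of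
`Ω` contribute a nonnegative amount by monotonicity, and pairs outside `Ω` contribute nothing. A
mixed pair loses at most `Λ (Φ(φ₁) - Φ(φ₂))₊ / |x - y|^{n+2s}`, and each such pair occurs twice in
`ℝ²ⁿ`. With `c ≤ ρ ≤ R` this gives `c ∫ (u₁ - u₂)₊(t) ≤ R ∫ (u₀₁ - u₀₂)₊ + ∫ (F₁ - F₂)₊ + 2Λ ·
(exterior term)`.

The difficulty is the time derivative: `ρ ∂ₜu` is only a functional on `H̃^s(Ω)`, and there is no
chain rule for `(u₁ - u₂)₊`. The remedy is to double the time variable. For one solution `v` and a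
frozen state `k` with `Φ(k) ∈ H̃^s`, the entropy `∫_k^v P(Φ(σ) - Φ(k)) dσ` is convex in `v` with
slope `P(Φ(v) - Φ(k))`. That slope is an admissible test function, so the tangent line inequality
over a time step `h`, followed by `h → 0`, yields `IsEnergySolution.entropy_inequality`.

In `doubling_entropy` this is applied to `v₁(t)` with `k = v₂(t')` and to `v₂(t')` with `k = v₁(t)`
and the reflected profile `-P(-·)`, both with the time weight `θ(t) η(t' - t)`. Both inequalities
involve the same test function. When `P` tends to the Heaviside function, both entropies tend to
`(v₁(t) - v₂(t'))₊` and the terms with `η'` cancel (`doubling`); `pairing_sub_le` carries out the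
sign analysis above for the remaining fluxes. Then `η` tends to a Dirac mass at zero.

As `η` lives on positive times, only the inequality for `v₁` has an initial term, and it contains
`v₂(t')` for small `t'`. It is identified through `IsEnergySolution.initial_trace`: the entropy with
`P = id`, relative to a state near `v₀`, shows that a solution attains its initial value in `L¹` in
the mean. The bound integrated against `-θ'` finally becomes pointwise in time by
`ae_le_of_smooth_average_le`.

Weak solutions enter this scheme through `IsWeakSolution.exists_isEnergySolution`. It extends them
by zero off `Ω × (0,T)`, keeps the exterior values as a separate part of the flux, and tests the
equation at almost every fixed time with all of `H̃^s(Ω)`. -/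

noncomputable section

namespace NPME

variable {n : ℕ}

/-! ### Fractional Sobolev spaces through difference quotients -/

/-- The difference quotient `(f x - f y) / |x - y|^{(n+2s)/2}` of fractional order `s`. -/
def dq (s : ℝ) (f : E n → ℝ) (z : E n × E n) : ℝ :=
  (f z.1 - f z.2) / ‖z.1 - z.2‖ ^ (((n : ℝ) + 2 * s) / 2)

/-- Smooth functions with compact support in `Ω`. -/
def IsTest (Ω : Set (E n)) (ψ : E n → ℝ) : Prop :=
  ContDiff ℝ (⊤ : ℕ∞) ψ ∧ HasCompactSupport ψ ∧ tsupport ψ ⊆ Ω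

lemma measurable_dq {s : ℝ} {f : E n → ℝ} (hf : Measurable f) : Measurable (dq s f) := by
  unfold dq
  fun_prop

lemma dq_sub (s : ℝ) (f g : E n → ℝ) :
    dq s (fun x => f x - g x) = fun z => dq s f z - dq s g z := by
  funext z
  simp only [dq]
  ring

lemma dq_congr_ae {s : ℝ} {f g : E n → ℝ} (h : f =ᵐ[volume] g) : dq s f =ᵐ[volume] dq s g := by
  have h1 : ∀ᵐ z : E n × E n, f z.1 = g z.1 := Measure.quasiMeasurePreserving_fst.ae h
  have h2 : ∀ᵐ z : E n × E n, f z.2 = g z.2 := Measure.quasiMeasurePreserving_snd.ae h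
  filter_upwards [h1, h2] with z h1 h2
  simp [dq, h1, h2]

lemma aestronglyMeasurable_dq {s : ℝ} {f : E n → ℝ} (hf : AEStronglyMeasurable f volume) :
    AEStronglyMeasurable (dq s f) volume :=
  (measurable_dq hf.stronglyMeasurable_mk.measurable).aestronglyMeasurable.congr
    (dq_congr_ae hf.ae_eq_mk.symm)

lemma enorm_dq_sq (s : ℝ) (f : E n → ℝ) (x y : E n) :
    ‖dq s f (x, y)‖ₑ ^ 2 = ‖f x - f y‖ₑ ^ 2 / ENNReal.ofReal (‖x - y‖ ^ ((n : ℝ) + 2 * s)) := by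
  rcases eq_or_ne x y with rfl | hxy
  · simp [dq]
  · have hpos : 0 < ‖x - y‖ := norm_pos_iff.2 (sub_ne_zero.2 hxy)
    have h1 : 0 < ‖x - y‖ ^ (((n : ℝ) + 2 * s) / 2) := Real.rpow_pos_of_pos hpos _
    have h2 : ‖x - y‖ ^ ((n : ℝ) + 2 * s) = (‖x - y‖ ^ (((n : ℝ) + 2 * s) / 2)) ^ 2 := by
      rw [← Real.rpow_natCast, ← Real.rpow_mul hpos.le]
      congr 1
      push_cast
      ring
    rw [h2, ← ofReal_norm, ← ofReal_norm, ← ENNReal.ofReal_pow (norm_nonneg _),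
      ← ENNReal.ofReal_pow (norm_nonneg _), ← ENNReal.ofReal_div_of_pos (by positivity)]
    simp [dq, div_pow]

lemma eLpNorm_two_sq {X : Type*} [MeasurableSpace X] (μ : Measure X) (f : X → ℝ) :
    eLpNorm f 2 μ ^ 2 = ∫⁻ x, ‖f x‖ₑ ^ 2 ∂μ := by
  have := eLpNorm_nnreal_pow_eq_lintegral (μ := μ) (f := f) (p := 2) (by norm_num)
  simpa using this

lemma lintegral_dq_sq (s : ℝ) {f : E n → ℝ} (hf : AEStronglyMeasurable f volume) :
    ∫⁻ x, ∫⁻ y, ‖f x - f y‖ₑ ^ 2 / ENNReal.ofReal (‖x - y‖ ^ ((n : ℝ) + 2 * s))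
      = ∫⁻ z, ‖dq s f z‖ₑ ^ 2 := by
  rw [Measure.volume_eq_prod, lintegral_prod]
  · simp_rw [enorm_dq_sq]
  · exact ((aestronglyMeasurable_dq (s := s) hf).enorm.pow_const 2)

/-- Embeds `H^s` in `L²(ℝⁿ) × L²(ℝ²ⁿ)` through `f ↦ (f, dq s f)`, so that statements about `H^s`
become statements about two `L²` functions. -/
lemma hsNormSq_eq (s : ℝ) {f : E n → ℝ} (hf : AEStronglyMeasurable f volume) :
    hsNormSq s f = eLpNorm f 2 volume ^ 2 + eLpNorm (dq s f) 2 volume ^ 2 := by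
  rw [eLpNorm_two_sq, eLpNorm_two_sq, ← lintegral_dq_sq s hf]
  rfl

lemma memHs_iff {s : ℝ} {f : E n → ℝ} :
    MemHs s f ↔ MemLp f 2 volume ∧ MemLp (dq s f) 2 volume := by
  constructor
  · rintro ⟨h1, h2⟩
    rw [hsNormSq_eq s h1, ENNReal.add_lt_top] at h2
    exact ⟨⟨h1, by simpa using h2.1⟩, aestronglyMeasurable_dq h1, by simpa using h2.2⟩
  · rintro ⟨h1, h2⟩
    refine ⟨h1.1, ?_⟩
    rw [hsNormSq_eq s h1.1, ENNReal.add_lt_top]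
    exact ⟨ENNReal.pow_lt_top h1.2, ENNReal.pow_lt_top h2.2⟩

lemma MemHs.sub {s : ℝ} {f g : E n → ℝ} (hf : MemHs s f) (hg : MemHs s g) :
    MemHs s (fun x => f x - g x) := by
  rw [memHs_iff] at *
  rw [dq_sub]
  exact ⟨hf.1.sub hg.1, hf.2.sub hg.2⟩

lemma MemHs.congr_ae {s : ℝ} {f g : E n → ℝ} (hf : MemHs s f) (h : f =ᵐ[volume] g) :
    MemHs s g := by
  rw [memHs_iff] at *
  exact ⟨hf.1.ae_eq h, hf.2.ae_eq (dq_congr_ae h)⟩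

lemma MemHs.comp_lipschitz {s : ℝ} {f : E n → ℝ} (hf : MemHs s f) {P : ℝ → ℝ} {L : ℝ≥0}
    (hP : LipschitzWith L P) (hP0 : P 0 = 0) : MemHs s (fun x => P (f x)) := by
  have hm : AEStronglyMeasurable (fun x => P (f x)) volume :=
    hP.continuous.comp_aestronglyMeasurable hf.1
  rw [memHs_iff] at *
  refine ⟨(hf.1.const_mul (L : ℝ)).mono hm (ae_of_all _ fun x => ?_),
    (hf.2.const_mul (L : ℝ)).mono (aestronglyMeasurable_dq hm) (ae_of_all _ fun z => ?_)⟩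
  · have := hP.dist_le_mul (f x) 0
    simpa [hP0, Real.dist_eq] using this
  · have := hP.dist_le_mul (f z.1) (f z.2)
    rw [Real.dist_eq, Real.dist_eq] at this
    simp only [dq, Real.norm_eq_abs, abs_mul, abs_div, NNReal.abs_eq]
    rw [← mul_div_assoc]
    gcongr

lemma MemHsTilde.exists_isTest {Ω : Set (E n)} {s : ℝ} {f : E n → ℝ} (hf : MemHsTilde Ω s f)
    {ε : ℝ≥0∞} (hε : 0 < ε) : ∃ ψ, IsTest Ω ψ ∧ MemHs s ψ ∧
      eLpNorm (fun x => f x - ψ x) 2 volume < ε ∧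
      eLpNorm (fun z => dq s f z - dq s ψ z) 2 volume < ε := by
  obtain ⟨ψ, h1, h2, h3, h4⟩ := hf.2 (min (ε ^ 2) 1) (by positivity)
  have hψm : AEStronglyMeasurable ψ volume := h1.continuous.aestronglyMeasurable
  have hm : AEStronglyMeasurable (fun x => f x - ψ x) volume := hf.1.1.sub hψm
  have hd : MemHs s (fun x => f x - ψ x) :=
    ⟨hm, h4.trans_le ((min_le_right _ _).trans le_top)⟩
  have hψ : MemHs s ψ := (hf.1.sub hd).congr_ae (ae_of_all _ fun x => by simp)
  rw [hsNormSq_eq s hm, dq_sub] at h4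
  have h5 := h4.trans_le (min_le_left _ _)
  exact ⟨ψ, ⟨h1, h2, h3⟩, hψ, lt_of_pow_lt_pow_left' 2 (lt_of_le_of_lt le_self_add h5),
    lt_of_pow_lt_pow_left' 2 (lt_of_le_of_lt le_add_self h5)⟩

lemma memHsTilde_of_exists_isTest {Ω : Set (E n)} {s : ℝ} {f : E n → ℝ} (hf : MemHs s f)
    (h : ∀ ε : ℝ≥0∞, 0 < ε → ∃ ψ, IsTest Ω ψ ∧
      eLpNorm (fun x => f x - ψ x) 2 volume ≤ ε ∧
      eLpNorm (fun z => dq s f z - dq s ψ z) 2 volume ≤ ε) : MemHsTilde Ω s f := by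
  refine ⟨hf, fun δ hδ => ?_⟩
  obtain ⟨e, he0, he⟩ : ∃ e : ℝ≥0∞, 0 < e ∧ e ^ 2 + e ^ 2 < δ := by
    have ht : Tendsto (fun e : ℝ≥0∞ => e ^ 2 + e ^ 2) (𝓝[>] 0) (𝓝 (0 ^ 2 + 0 ^ 2)) :=
      ((ENNReal.continuous_pow 2).add (ENNReal.continuous_pow 2)).continuousAt.tendsto.mono_left
        nhdsWithin_le_nhds
    have := (ht.eventually (gt_mem_nhds (by simpa using hδ))).and self_mem_nhdsWithin
    obtain ⟨e, h1, h2⟩ := this.exists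
    exact ⟨e, h2, h1⟩
  obtain ⟨ψ, ⟨h1, h2, h3⟩, h4, h5⟩ := h e he0
  refine ⟨ψ, h1, h2, h3, ?_⟩
  have hm : AEStronglyMeasurable (fun x => f x - ψ x) volume :=
    hf.1.sub h1.continuous.aestronglyMeasurable
  rw [hsNormSq_eq s hm, dq_sub]
  exact lt_of_le_of_lt (add_le_add (pow_le_pow_left' h4 2) (pow_le_pow_left' h5 2)) he

lemma MemHsTilde.congr_ae {Ω : Set (E n)} {s : ℝ} {f g : E n → ℝ} (hf : MemHsTilde Ω s f)
    (h : f =ᵐ[volume] g) : MemHsTilde Ω s g := by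
  refine memHsTilde_of_exists_isTest (hf.1.congr_ae h) fun ε hε => ?_
  obtain ⟨ψ, h1, -, h2, h3⟩ := hf.exists_isTest hε
  refine ⟨ψ, h1, (le_of_eq (eLpNorm_congr_ae ?_)).trans h2.le,
    (le_of_eq (eLpNorm_congr_ae ?_)).trans h3.le⟩
  · filter_upwards [h] with x hx
    rw [hx]
  · filter_upwards [dq_congr_ae (s := s) h] with x hx
    rw [hx]

lemma IsTest.sub {Ω : Set (E n)} {f g : E n → ℝ} (hf : IsTest Ω f) (hg : IsTest Ω g) :
    IsTest Ω (fun x => f x - g x) :=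
  ⟨hf.1.sub hg.1, hf.2.1.sub hg.2.1,
    (tsupport_sub f g).trans (union_subset hf.2.2 hg.2.2)⟩

lemma MemHsTilde.sub {Ω : Set (E n)} {s : ℝ} {f g : E n → ℝ} (hf : MemHsTilde Ω s f)
    (hg : MemHsTilde Ω s g) : MemHsTilde Ω s (fun x => f x - g x) := by
  refine memHsTilde_of_exists_isTest (hf.1.sub hg.1) fun ε hε => ?_
  have hε' : 0 < ε / 2 := by simpa using hε.ne'
  obtain ⟨ψ, h1, h1', h2, h3⟩ := hf.exists_isTest hε'
  obtain ⟨χ, k1, k1', k2, k3⟩ := hg.exists_isTest hε'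
  refine ⟨_, h1.sub k1, ?_, ?_⟩
  · have e : (fun x => f x - g x - (ψ x - χ x)) = (fun x => f x - ψ x) - fun x => g x - χ x := by
      funext x
      simp only [Pi.sub_apply]
      ring
    rw [e, ← ENNReal.add_halves ε]
    exact (eLpNorm_sub_le (hf.1.1.sub h1'.1) (hg.1.1.sub k1'.1) (by norm_num)).trans
      (add_le_add h2.le k2.le)
  · rw [dq_sub, dq_sub]
    have e : (fun z => dq s f z - dq s g z - (dq s ψ z - dq s χ z))
        = (fun z => dq s f z - dq s ψ z) - fun z => dq s g z - dq s χ z := by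
      funext x
      simp only [Pi.sub_apply]
      ring
    rw [e, ← ENNReal.add_halves ε]
    exact (eLpNorm_sub_le ((aestronglyMeasurable_dq hf.1.1).sub (aestronglyMeasurable_dq h1'.1))
      ((aestronglyMeasurable_dq hg.1.1).sub (aestronglyMeasurable_dq k1'.1)) (by norm_num)).trans
      (add_le_add h3.le k3.le)

/-- Cutting off to the complement of `Ω` annihilates the approximating test functions, so the `L²`
norm of `f` off `Ω` is below every `ε`. -/
lemma MemHsTilde.ae_eq_zero {Ω : Set (E n)} (hΩ : MeasurableSet Ω) {s : ℝ} {f : E n → ℝ}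
    (hf : MemHsTilde Ω s f) : ∀ᵐ x, x ∉ Ω → f x = 0 := by
  have key : eLpNorm (Ωᶜ.indicator f) 2 volume = 0 := by
    refine le_antisymm (le_of_forall_pos_le_add fun ε hε => ?_) zero_le
    obtain ⟨ψ, h1, -, h2, -⟩ := hf.exists_isTest hε
    rw [zero_add]
    refine (eLpNorm_mono fun x => ?_).trans h2.le
    by_cases hx : x ∈ Ω
    · simp [hx]
    · have : ψ x = 0 := image_eq_zero_of_notMem_tsupport fun h => hx (h1.2.2 h)
      simp [hx, this]
  rw [eLpNorm_eq_zero_iff (hf.1.1.indicator hΩ.compl) (by norm_num)] at key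
  filter_upwards [key] with x hx hxΩ
  simpa [hxΩ] using hx

/-- Dominated convergence with a moving majorant: `|h k|` is at most `|a k|` plus the positive part
of `|h k| - |a k|`. The first summand vanishes in `L²`, the second is dominated by the fixed
function `|b|`. -/
lemma tendsto_eLpNorm_zero_of_dominated {X : Type*} [MeasurableSpace X] {μ : Measure X}
    {a h : ℕ → X → ℝ} {b : X → ℝ} (ha : ∀ k, AEStronglyMeasurable (a k) μ) (hb : MemLp b 2 μ)
    (hh : ∀ k, AEStronglyMeasurable (h k) μ) (hle : ∀ k x, |h k x| ≤ |a k x| + |b x|)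
    (ha0 : Tendsto (fun k => eLpNorm (a k) 2 μ) atTop (𝓝 0))
    (hh0 : ∀ᵐ x ∂μ, Tendsto (fun k => h k x) atTop (𝓝 0)) :
    Tendsto (fun k => eLpNorm (h k) 2 μ) atTop (𝓝 0) := by
  set g : ℕ → X → ℝ := fun k x => max (|h k x| - |a k x|) 0 with hg
  have hgm : ∀ k, AEStronglyMeasurable (g k) μ := fun k =>
    (((hh k).norm.sub (ha k).norm).sup aestronglyMeasurable_const)
  have hg0 : ∀ k x, 0 ≤ g k x := fun k x => le_max_right _ _
  have h2 : Tendsto (fun k => ∫⁻ x, ‖g k x‖ₑ ^ 2 ∂μ) atTop (𝓝 (∫⁻ _, 0 ∂μ)) := by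
    refine tendsto_lintegral_of_dominated_convergence' (fun x => ‖b x‖ₑ ^ 2)
      (fun k => (hgm k).enorm.pow_const 2) (fun k => ae_of_all _ fun x => ?_) ?_ ?_
    · refine pow_le_pow_left' (enorm_le_iff_norm_le.2 ?_) 2
      rw [Real.norm_of_nonneg (hg0 k x), Real.norm_eq_abs]
      refine max_le ?_ (abs_nonneg _)
      linarith [hle k x]
    · rw [← eLpNorm_two_sq]
      exact (ENNReal.pow_lt_top hb.2).ne
    · filter_upwards [hh0] with x hx
      have h3 : Tendsto (fun k => g k x) atTop (𝓝 0) := by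
        refine squeeze_zero (fun k => hg0 k x) (fun k => ?_) (by simpa using hx.abs)
        exact max_le (by linarith [abs_nonneg (a k x)]) (abs_nonneg _)
      have h4 := (((ENNReal.continuous_pow 2).comp continuous_enorm).tendsto (0 : ℝ)).comp h3
      simpa [Function.comp_def] using h4
  have h5 : Tendsto (fun k => eLpNorm (g k) 2 μ) atTop (𝓝 0) := by
    simp_rw [← eLpNorm_two_sq, lintegral_zero] at h2
    have h6 := (ENNReal.continuous_rpow_const (y := (1 / 2 : ℝ))).continuousAt.tendsto.comp h2
    have e : ∀ x : ℝ≥0∞, (x ^ 2) ^ (1 / 2 : ℝ) = x := fun x => by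
      rw [← ENNReal.rpow_natCast, ← ENNReal.rpow_mul]
      norm_num
    simpa only [Function.comp_def, e, ENNReal.zero_rpow_of_pos (by norm_num : (0:ℝ) < 1 / 2)]
      using h6
  refine tendsto_of_tendsto_of_tendsto_of_le_of_le tendsto_const_nhds
    (by simpa using ha0.add h5) (fun _ => zero_le) fun k => ?_
  have h7 : eLpNorm (h k) 2 μ ≤ eLpNorm ((fun x => |a k x|) + g k) 2 μ := by
    refine eLpNorm_mono fun x => ?_
    rw [Real.norm_eq_abs, Real.norm_eq_abs, Pi.add_apply]
    refine le_trans ?_ (le_abs_self _)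
    linarith [le_max_left (|h k x| - |a k x|) 0]
  refine h7.trans ((eLpNorm_add_le (ha k).norm (hgm k) (by norm_num)).trans ?_)
  gcongr
  exact le_of_eq (eLpNorm_norm (a k))

lemma IsTest.comp {Ω : Set (E n)} {ψ : E n → ℝ} (hψ : IsTest Ω ψ) {P : ℝ → ℝ}
    (hP : ContDiff ℝ (⊤ : ℕ∞) P) (hP0 : P 0 = 0) : IsTest Ω (fun x => P (ψ x)) :=
  ⟨hP.comp hψ.1, hψ.2.1.comp_left hP0, (tsupport_comp_subset hP0 ψ).trans hψ.2.2⟩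

/-- The difference quotient of `P ∘ f - P ∘ ψ` is not controlled by that of `f - ψ`, so the
Lipschitz bound alone does not suffice. Along a subsequence of test functions converging almost
everywhere, the difference quotients of `P ∘ ψ` converge pointwise, and the error is dominated by `L
|dq f - dq ψ| + 2L |dq f|`. Smoothness of `P` and `P 0 = 0` keep `P ∘ ψ` a test function. -/
lemma MemHsTilde.comp_smooth {Ω : Set (E n)} {s : ℝ} {f : E n → ℝ} (hf : MemHsTilde Ω s f)
    {P : ℝ → ℝ} {L : ℝ≥0} (hP : ContDiff ℝ (⊤ : ℕ∞) P) (hPL : LipschitzWith L P) (hP0 : P 0 = 0) :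
    MemHsTilde Ω s (fun x => P (f x)) := by
  obtain ⟨e, -, he0, he⟩ := exists_seq_strictAnti_tendsto' (zero_lt_one (α := ℝ≥0∞))
  choose ψ hψ hψs hψ1 hψ2 using fun k => hf.exists_isTest (he0 k).1
  have hsub : ∀ {F : ℕ → ℝ≥0∞}, (∀ k, F k < e k) → Tendsto F atTop (𝓝 0) := fun h =>
    tendsto_of_tendsto_of_tendsto_of_le_of_le tendsto_const_nhds he (fun _ => zero_le)
      fun k => (h k).le
  have hc1 := hsub hψ1
  have hc2 := hsub hψ2
  obtain ⟨ns, hns, hae⟩ := (tendstoInMeasure_of_tendsto_eLpNorm (p := 2) (by norm_num)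
    (fun k => (hψs k).1) hf.1.1 (by
      refine hc1.congr fun k => ?_
      rw [← eLpNorm_neg]
      congr 1
      funext x
      simp)).exists_seq_tendsto_ae
  have hfP := hf.1.comp_lipschitz hPL hP0
  have hψP := fun k => (hψs k).comp_lipschitz hPL hP0
  have hlip : ∀ (g : E n → ℝ) z, |dq s (fun x => P (g x)) z| ≤ L * |dq s g z| := fun g z => by
    have := hPL.dist_le_mul (g z.1) (g z.2)
    rw [Real.dist_eq, Real.dist_eq] at this
    simp only [dq, abs_div]
    rw [← mul_div_assoc]
    gcongr
  have t1 : Tendsto (fun k => eLpNorm (fun x => P (f x) - P (ψ (ns k) x)) 2 volume) atTop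
      (𝓝 0) := by
    have hL : Tendsto (fun k => (L : ℝ≥0∞) * eLpNorm (fun x => f x - ψ (ns k) x) 2 volume) atTop
        (𝓝 0) := by
      have := ENNReal.Tendsto.const_mul (a := (L : ℝ≥0∞)) (hc1.comp hns.tendsto_atTop)
        (Or.inr ENNReal.coe_ne_top)
      simpa using this
    refine tendsto_of_tendsto_of_tendsto_of_le_of_le tendsto_const_nhds hL (fun _ => zero_le)
      fun k => ?_
    refine eLpNorm_le_nnreal_smul_eLpNorm_of_ae_le_mul (ae_of_all _ fun x => ?_) 2
    have := hPL.dist_le_mul (f x) (ψ (ns k) x)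
    rwa [dist_eq_norm, dist_eq_norm] at this
  have t2 : Tendsto (fun k => eLpNorm (fun z => dq s (fun x => P (f x)) z
      - dq s (fun x => P (ψ (ns k) x)) z) 2 volume) atTop (𝓝 0) := by
    refine tendsto_eLpNorm_zero_of_dominated
      (a := fun k z => L * (dq s f z - dq s (ψ (ns k)) z)) (b := fun z => 2 * L * dq s f z)
      (fun k => ?_) ((memHs_iff.1 hf.1).2.const_mul _) (fun k => ?_) (fun k z => ?_) ?_ ?_
    · exact ((aestronglyMeasurable_dq hf.1.1).sub
        (aestronglyMeasurable_dq (hψs _).1)).const_mul _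
    · exact (aestronglyMeasurable_dq hfP.1).sub (aestronglyMeasurable_dq (hψP _).1)
    · have h1 := hlip f z
      have h2 := hlip (ψ (ns k)) z
      have h3 := abs_sub (dq s (fun x => P (f x)) z) (dq s (fun x => P (ψ (ns k) x)) z)
      have h4 : |dq s (ψ (ns k)) z| ≤ |dq s f z - dq s (ψ (ns k)) z| + |dq s f z| := by
        have := abs_sub_abs_le_abs_sub (dq s (ψ (ns k)) z) (dq s f z)
        rw [abs_sub_comm] at this
        linarith
      have hL : (0 : ℝ) ≤ L := L.2
      have h5 := mul_le_mul_of_nonneg_left h4 hL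
      rw [abs_mul, abs_mul, abs_mul, abs_of_nonneg hL, abs_two]
      linarith
    · have := ENNReal.Tendsto.const_mul (a := (L : ℝ≥0∞)) (hc2.comp hns.tendsto_atTop)
        (Or.inr ENNReal.coe_ne_top)
      rw [mul_zero] at this
      refine this.congr fun k => ?_
      have e := eLpNorm_const_smul (μ := (volume : Measure (E n × E n))) (p := 2) (L : ℝ)
        (fun z => dq s f z - dq s (ψ (ns k)) z)
      simp only [Function.comp_def]
      rw [show (fun z => (L : ℝ) * (dq s f z - dq s (ψ (ns k)) z))
        = (L : ℝ) • fun z => dq s f z - dq s (ψ (ns k)) z from rfl, e]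
      simp
    · have h1 := Measure.quasiMeasurePreserving_fst (μ := (volume : Measure (E n)))
        (ν := (volume : Measure (E n))) |>.ae hae
      have h2 := Measure.quasiMeasurePreserving_snd (μ := (volume : Measure (E n)))
        (ν := (volume : Measure (E n))) |>.ae hae
      rw [Measure.volume_eq_prod]
      filter_upwards [h1, h2] with z h1 h2
      have hP1 := (hP.continuous.tendsto _).comp h1
      have hP2 := (hP.continuous.tendsto _).comp h2
      have := tendsto_const_nhds (x := dq s (fun x => P (f x)) z) |>.sub
        ((hP1.sub hP2).div_const (‖z.1 - z.2‖ ^ (((n : ℝ) + 2 * s) / 2)))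
      simpa [dq, Function.comp_def] using this
  refine memHsTilde_of_exists_isTest hfP fun ε hε => ?_
  obtain ⟨k, h1, h2⟩ := ((t1.eventually (gt_mem_nhds hε)).and
    (t2.eventually (gt_mem_nhds hε))).exists
  exact ⟨_, (hψ _).comp hP hP0, h1.le, h2.le⟩

/-- A countable family of test functions which is dense in `H̃^s(Ω)`. -/
lemma exists_countable_isTest_dense (Ω : Set (E n)) (s : ℝ) : ∃ D : Set (E n → ℝ), D.Countable ∧
    (∀ ζ ∈ D, IsTest Ω ζ ∧ MemHs s ζ) ∧ ∀ f, MemHsTilde Ω s f → ∀ ε : ℝ≥0∞, 0 < ε → ∃ ζ ∈ D,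
      eLpNorm (fun x => f x - ζ x) 2 volume ≤ ε ∧
      eLpNorm (fun z => dq s f z - dq s ζ z) 2 volume ≤ ε := by
  have : Fact ((2 : ℝ≥0∞) ≠ ∞) := ⟨by simp⟩
  let S := {ζ : E n → ℝ // IsTest Ω ζ ∧ MemHs s ζ}
  -- The image of the admissible test functions in the separable metric space `L² × L²` is itself
  -- separable; its countable dense subset is pulled back by choice.
  let ι : S → Lp ℝ 2 (volume : Measure (E n)) × Lp ℝ 2 (volume : Measure (E n × E n)) :=
    fun ζ => ((memHs_iff.1 ζ.2.2).1.toLp _, (memHs_iff.1 ζ.2.2).2.toLp _)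
  have i0 : MeasurableSpace.CountablyGenerated (E n × E n) := inferInstance
  have i1 : SecondCountableTopology (Lp ℝ 2 (volume : Measure (E n))) := inferInstance
  have i2 : SecondCountableTopology (Lp ℝ 2 (volume : Measure (E n × E n))) :=
    Lp.SecondCountableTopology
  have i3 : SecondCountableTopology (range ι) := inferInstance
  have i4 : TopologicalSpace.SeparableSpace (range ι) :=
    TopologicalSpace.SecondCountableTopology.to_separableSpace
  obtain ⟨t, ht, htd⟩ := TopologicalSpace.exists_countable_dense (range ι)
  choose c hc using fun y : range ι => y.2
  refine ⟨(fun y => (c y : E n → ℝ)) '' t, ht.image _, ?_, fun f hf ε hε => ?_⟩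
  · rintro _ ⟨y, -, rfl⟩
    exact (c y).2
  have hε' : 0 < ε / 2 := by simpa using hε.ne'
  obtain ⟨ψ, h1, h1', h2, h3⟩ := hf.exists_isTest hε'
  let ψ' : S := ⟨ψ, h1, h1'⟩
  obtain ⟨y, hy, hyt⟩ := EMetric.mem_closure_iff.1 (htd ⟨ι ψ', mem_range_self _⟩) _ hε'
  refine ⟨_, ⟨y, hy, rfl⟩, ?_⟩
  rw [Subtype.edist_eq, ← hc y, Prod.edist_eq, max_lt_iff] at hyt
  simp only [ι, Lp.edist_toLp_toLp] at hyt
  have hcy := (memHs_iff.1 (c y).2.2)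
  have hψ' := (memHs_iff.1 h1')
  have hf' := memHs_iff.1 hf.1
  constructor
  · have e : (fun x => f x - (c y : E n → ℝ) x) = (fun x => f x - ψ x) + (ψ - (c y : E n → ℝ)) := by
      funext x
      simp
    rw [e, ← ENNReal.add_halves ε]
    exact (eLpNorm_add_le (hf'.1.sub hψ'.1).1 (hψ'.1.sub hcy.1).1 (by norm_num)).trans
      (add_le_add h2.le hyt.1.le)
  · have e : (fun z => dq s f z - dq s (c y : E n → ℝ) z)
        = (fun z => dq s f z - dq s ψ z) + (dq s ψ - dq s (c y : E n → ℝ)) := by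
      funext x
      simp
    rw [e, ← ENNReal.add_halves ε]
    exact (eLpNorm_add_le (hf'.2.sub hψ'.2).1 (hψ'.2.sub hcy.2).1 (by norm_num)).trans
      (add_le_add h3.le hyt.2.le)

/-! ### Time translations -/

set_option linter.unusedSectionVars false

section Translation

variable {X : Type*} [NormedAddCommGroup X] [NormedSpace ℝ X] [FiniteDimensional ℝ X]
  [MeasureSpace X] [BorelSpace X] [(volume : Measure X).IsAddHaarMeasure]

lemma measurePreserving_timeShift (σ : ℝ) :
    MeasurePreserving (fun z : X × ℝ => (z.1, z.2 - σ)) volume volume := by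
  have := (MeasurePreserving.id (volume : Measure X)).prod
    (measurePreserving_sub_right (volume : Measure ℝ) σ)
  exact this

lemma tendsto_eLpNorm_timeShift {p : ℝ≥0∞} (hp1 : 1 ≤ p) (hp : p ≠ ∞) {f : X × ℝ → ℝ}
    (hf : MemLp f p volume) :
    Tendsto (fun σ : ℝ => eLpNorm (fun z => f (z.1, z.2 - σ) - f z) p volume) (𝓝 0) (𝓝 0) := by
  have : Fact (1 ≤ p) := ⟨hp1⟩
  let g : ℝ → C(X × ℝ, X × ℝ) :=
    (ContinuousMap.mk (fun a : ℝ × (X × ℝ) => (a.2.1, a.2.2 - a.1)) (by fun_prop)).curry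
  have hg : Continuous g := ContinuousMap.continuous _
  have hgm : ∀ σ, MeasurePreserving (g σ) volume volume := fun σ => measurePreserving_timeShift σ
  have key := (tendsto_const_nhds (x := hf.toLp f) (f := 𝓝 (0 : ℝ))).compMeasurePreservingLp
    (hg.tendsto 0) hgm (hgm 0) hp
  rw [tendsto_iff_edist_tendsto_0] at key
  refine key.congr fun σ => ?_
  rw [Lp.toLp_compMeasurePreserving, Lp.toLp_compMeasurePreserving, Lp.edist_toLp_toLp]
  congr 1
  funext z
  simp [g]

lemma enorm_integral_mul_le {Y : Type*} [MeasurableSpace Y] {μ : Measure Y} {f g : Y → ℝ}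
    (hf : AEStronglyMeasurable f μ) (hg : AEStronglyMeasurable g μ) :
    ‖∫ y, f y * g y ∂μ‖ₑ ≤ eLpNorm f 2 μ * eLpNorm g 2 μ := by
  refine (enorm_integral_le_lintegral_enorm _).trans ?_
  rw [← eLpNorm_one_eq_lintegral_enorm]
  have := eLpNorm_smul_le_mul_eLpNorm (p := 2) (q := 2) (r := 1) hg hf
  have e : (fun a => f a * g a) = f • g := rfl
  rw [e]
  exact this

lemma MemLp.timeShift {p : ℝ≥0∞} {f : X × ℝ → ℝ} (hf : MemLp f p volume) (σ : ℝ) :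
    MemLp (fun z : X × ℝ => f (z.1, z.2 - σ)) p volume :=
  hf.comp_measurePreserving (measurePreserving_timeShift σ)

lemma integrable_timeShift_mul {f g : X × ℝ → ℝ} (hf : MemLp f 2 volume) (hg : MemLp g 2 volume)
    (σ : ℝ) : Integrable (fun z : X × ℝ => f (z.1, z.2 - σ) * g z) :=
  (MemLp.timeShift hf σ).integrable_mul hg

lemma tendsto_integral_timeShift_mul {f g : X × ℝ → ℝ} (hf : MemLp f 2 volume)
    (hg : MemLp g 2 volume) :
    Tendsto (fun σ : ℝ => ∫ z : X × ℝ, f (z.1, z.2 - σ) * g z) (𝓝 0) (𝓝 (∫ z, f z * g z)) := by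
  rw [tendsto_iff_edist_tendsto_0]
  have h1 : Tendsto (fun σ : ℝ => eLpNorm (fun z => f (z.1, z.2 - σ) - f z) 2 volume
      * eLpNorm g 2 volume) (𝓝 0) (𝓝 0) := by
    have := ENNReal.Tendsto.mul_const (tendsto_eLpNorm_timeShift (by norm_num) (by norm_num) hf)
      (Or.inr hg.2.ne)
    simpa using this
  refine tendsto_of_tendsto_of_tendsto_of_le_of_le tendsto_const_nhds h1 (fun _ => zero_le)
    fun σ => ?_
  have hfg : Integrable fun z => f z * g z := hf.integrable_mul hg
  rw [edist_eq_enorm_sub, ← integral_sub (integrable_timeShift_mul hf hg σ) hfg]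
  simp_rw [← sub_mul]
  exact enorm_integral_mul_le ((MemLp.timeShift hf σ).sub hf).1 hg.1

/-- Cauchy–Schwarz bounds the space-time integral for each shift `σ` by a constant independent of
`σ`, and `σ` ranges over a bounded interval. This legitimates the applications of Fubini to Steklov
averages. -/
lemma integrable_steklov {f g : X × ℝ → ℝ} (hfm : Measurable f) (hgm : Measurable g)
    (hf : MemLp f 2 volume) (hg : MemLp g 2 volume) (h : ℝ) :
    Integrable (fun q : (ℝ × ℝ) × X => f (q.2, q.1.1 - q.1.2) * g (q.2, q.1.1))
      ((volume.prod (volume.restrict (Ioo 0 h))).prod volume) := by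
  let μ : Measure ((X × ℝ) × ℝ) := (volume : Measure (X × ℝ)).prod (volume.restrict (Ioo 0 h))
  have h1 : Integrable (fun q : (X × ℝ) × ℝ => f (q.1.1, q.1.2 - q.2) * g q.1) μ := by
    have hm : Measurable fun q : (X × ℝ) × ℝ => f (q.1.1, q.1.2 - q.2) * g q.1 := by fun_prop
    rw [integrable_prod_iff' hm.aestronglyMeasurable]
    refine ⟨ae_of_all _ fun σ => integrable_timeShift_mul hf hg σ, ?_⟩
    refine Integrable.of_bound (C := (eLpNorm f 2 volume * eLpNorm g 2 volume).toReal)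
      (hm.norm.stronglyMeasurable.integral_prod_left'.aestronglyMeasurable)
      (ae_of_all _ fun σ => ?_)
    have h2 := enorm_integral_mul_le (μ := (volume : Measure (X × ℝ)))
      (MemLp.timeShift hf σ).norm.1 hg.norm.1
    have h4 : eLpNorm (fun z : X × ℝ => f (z.1, z.2 - σ)) 2 volume = eLpNorm f 2 volume :=
      eLpNorm_comp_measurePreserving hf.1 (measurePreserving_timeShift σ)
    rw [eLpNorm_norm, eLpNorm_norm, h4] at h2
    have h3 := ENNReal.toReal_mono (ENNReal.mul_lt_top hf.2 hg.2).ne h2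
    rw [toReal_enorm] at h3
    simpa only [norm_mul] using h3
  have h2 : MeasurePreserving (fun q : (ℝ × ℝ) × X => ((q.2, q.1.1), q.1.2))
      ((volume.prod (volume.restrict (Ioo 0 h))).prod volume) μ := by
    have a1 := Measure.measurePreserving_swap
      (μ := (volume : Measure ℝ).prod (volume.restrict (Ioo 0 h))) (ν := (volume : Measure X))
    have a2 := (measurePreserving_prodAssoc (volume : Measure X) (volume : Measure ℝ)
      (volume.restrict (Ioo 0 h))).symm
    exact a2.comp a1
  exact h2.integrable_comp_of_integrable h1

/-- Steklov averages in time converge weakly in `L²`. -/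
lemma tendsto_steklov {f g : X × ℝ → ℝ} (hfm : Measurable f) (hgm : Measurable g)
    (hf : MemLp f 2 volume) (hg : MemLp g 2 volume) :
    Tendsto (fun h : ℝ => h⁻¹ * ∫ t, ∫ σ in Ioo 0 h, ∫ x, f (x, t - σ) * g (x, t)) (𝓝[>] 0)
      (𝓝 (∫ t, ∫ x, f (x, t) * g (x, t))) := by
  -- The time correlation of `f` and `g`, continuous at zero because translations are continuous in
  -- `L²`. By Fubini the averaged expression is the mean of `C` over `(0,h)`.
  set C : ℝ → ℝ := fun σ => ∫ z : X × ℝ, f (z.1, z.2 - σ) * g z with hC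
  have hC0 : ∫ t, ∫ x, f (x, t) * g (x, t) = C 0 := by
    have hfg : Integrable fun z => f z * g z := hf.integrable_mul hg
    simp only [hC, sub_zero]
    exact (integral_prod_symm _ hfg).symm
  have hCi : ∀ h, IntegrableOn C (Ioo 0 h) ∧
      ∫ t, ∫ σ in Ioo 0 h, ∫ x, f (x, t - σ) * g (x, t) = ∫ σ in Ioo 0 h, C σ := by
    intro h
    have h1 := integrable_steklov hfm hgm hf hg h
    have h2 := h1.integral_prod_left
    have e : ∀ σ, ∫ t, ∫ x, f (x, t - σ) * g (x, t) = C σ := fun σ =>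
      (integral_prod_symm _ (integrable_timeShift_mul hf hg σ)).symm
    constructor
    · have := h2.integral_prod_right
      exact this.congr (ae_of_all _ fun σ => e σ)
    · rw [integral_integral_swap h2]
      simp only [e]
  rw [hC0]
  simp_rw [fun h => (hCi h).2]
  have hc : Tendsto C (𝓝 0) (𝓝 (C 0)) := by
    have := tendsto_integral_timeShift_mul hf hg
    simpa [hC] using this
  rw [Metric.tendsto_nhds] at hc ⊢
  intro ε hε
  obtain ⟨δ, hδ, hball⟩ := Metric.eventually_nhds_iff.1 (hc (ε / 2) (half_pos hε))
  filter_upwards [Ioo_mem_nhdsGT hδ] with h hh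
  have hpos := hh.1
  have h1 : h⁻¹ * ∫ σ in Ioo 0 h, C σ = C 0 + h⁻¹ * ∫ σ in Ioo 0 h, (C σ - C 0) := by
    rw [integral_sub (hCi h).1 (by simp)]
    simp only [setIntegral_const, measureReal_def, Real.volume_Ioo, sub_zero, smul_eq_mul,
      ENNReal.toReal_ofReal hpos.le]
    field_simp
    ring
  have h2 : ‖∫ σ in Ioo 0 h, (C σ - C 0)‖ ≤ ε / 2 * volume.real (Ioo 0 h) := by
    refine norm_setIntegral_le_of_norm_le_const (by simp) fun σ hσ => ?_
    have := hball (y := σ) (by rw [Real.dist_eq, sub_zero, abs_of_pos hσ.1]; exact hσ.2.trans hh.2)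
    rw [Real.dist_eq] at this
    exact this.le
  rw [measureReal_def, Real.volume_Ioo, sub_zero, ENNReal.toReal_ofReal hpos.le] at h2
  rw [h1, Real.dist_eq, add_sub_cancel_left, abs_mul, abs_of_pos (inv_pos.2 hpos)]
  rw [Real.norm_eq_abs] at h2
  calc h⁻¹ * |∫ σ in Ioo 0 h, (C σ - C 0)| ≤ h⁻¹ * (ε / 2 * h) := by gcongr
    _ = ε / 2 := by field_simp
    _ < ε := half_lt_self hε

/-- Mollified time translations are continuous in `L¹`. -/
lemma exists_lintegral_mollified_le {f : X × ℝ → ℝ} (hfm : Measurable f) (hf : Integrable f)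
    {ε : ℝ≥0∞} (hε : 0 < ε) : ∃ r > 0, ∀ η : ℝ → ℝ≥0∞, Measurable η →
      (∀ σ, η σ ≠ 0 → σ ∈ Ioo 0 r) → ∫⁻ σ, η σ ≤ 1 →
      ∫⁻ t, ∫⁻ t', η (t' - t) * ∫⁻ x, ‖f (x, t) - f (x, t')‖ₑ ≤ ε := by
  have h1 := tendsto_eLpNorm_timeShift le_rfl (by norm_num) (memLp_one_iff_integrable.2 hf)
  obtain ⟨r, hr, hball⟩ := Metric.eventually_nhds_iff.1 (h1.eventually (gt_mem_nhds hε))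
  refine ⟨r, hr, fun η hη hsupp hint => ?_⟩
  have hm : Measurable fun q : (ℝ × ℝ) × X => ‖f (q.2, q.1.1) - f (q.2, q.1.2)‖ₑ := by fun_prop
  have hm2 : Measurable fun q : ℝ × ℝ => ∫⁻ x, ‖f (x, q.1) - f (x, q.2)‖ₑ :=
    hm.lintegral_prod_right'
  have hm3 : Measurable fun q : ℝ × ℝ => η (q.2 - q.1) * ∫⁻ x, ‖f (x, q.1) - f (x, q.2)‖ₑ := by
    fun_prop
  -- With `σ = t' - t` the left side is the `η`-average of the `L¹` distance between `f` and its
  -- shift by `σ`, which is below `ε` on the support of `η`.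
  calc ∫⁻ t, ∫⁻ t', η (t' - t) * ∫⁻ x, ‖f (x, t) - f (x, t')‖ₑ
      = ∫⁻ t', ∫⁻ t, η (t' - t) * ∫⁻ x, ‖f (x, t) - f (x, t')‖ₑ :=
        lintegral_lintegral_swap hm3.aemeasurable
    _ = ∫⁻ t', ∫⁻ σ, η σ * ∫⁻ x, ‖f (x, t' - σ) - f (x, t')‖ₑ := by
        refine lintegral_congr fun t' => ?_
        rw [← lintegral_sub_left_eq_self _ t']
        simp
    _ = ∫⁻ σ, ∫⁻ t', η σ * ∫⁻ x, ‖f (x, t' - σ) - f (x, t')‖ₑ := by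
        refine lintegral_lintegral_swap (Measurable.aemeasurable ?_)
        have : Measurable fun q : ℝ × ℝ => ((q.1 - q.2, q.1) : ℝ × ℝ) := by fun_prop
        exact (hη.comp measurable_snd).mul (hm2.comp this)
    _ = ∫⁻ σ, η σ * eLpNorm (fun z : X × ℝ => f (z.1, z.2 - σ) - f z) 1 volume := by
        refine lintegral_congr fun σ => ?_
        have hm4 : Measurable fun z : X × ℝ => ‖f (z.1, z.2 - σ) - f z‖ₑ := by fun_prop
        rw [lintegral_const_mul, eLpNorm_one_eq_lintegral_enorm, Measure.volume_eq_prod,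
          lintegral_prod_symm' _ hm4]
        exact hm4.lintegral_prod_left'
    _ ≤ ∫⁻ σ, η σ * ε := by
        refine lintegral_mono fun σ => ?_
        by_cases h0 : η σ = 0
        · simp [h0]
        · have hσ := hsupp σ h0
          have := hball (y := σ) (by rw [Real.dist_eq, sub_zero, abs_of_pos hσ.1]; exact hσ.2)
          gcongr
    _ ≤ ε := by
        rw [lintegral_mul_const _ hη]
        exact mul_le_of_le_one_left (zero_le) hint

end Translation

/-! ### The nonlinearity and its entropies -/

/-- Continuous increasing nonlinearities with at least linear growth and uniformly continuous
inverse. -/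
structure IsExpanding (Φ : ℝ → ℝ) : Prop where
  continuous : Continuous Φ
  strictMono : StrictMono Φ
  zero : Φ 0 = 0
  expanding : ∀ ε > 0, ∃ d > 0, ∀ a b, b + ε ≤ a → d ≤ Φ a - Φ b
  growth : ∀ t, |t| ≤ 1 + |Φ t|

lemma Phi_neg (m t : ℝ) : Phi m (-t) = -Phi m t := by simp [Phi]

lemma Phi_of_nonneg {m : ℝ} (hm : 0 < m) {t : ℝ} (ht : 0 ≤ t) : Phi m t = t ^ m := by
  rcases ht.eq_or_lt with rfl | ht
  · simp [Phi, Real.zero_rpow hm.ne']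
  · rw [Phi, abs_of_pos ht, ← Real.rpow_add_one ht.ne', sub_add_cancel]

lemma Phi_inv {m : ℝ} (hm : 0 < m) (t : ℝ) : Phi m⁻¹ (Phi m t) = t := by
  have key : ∀ t : ℝ, 0 ≤ t → Phi m⁻¹ (Phi m t) = t := fun t ht => by
    rw [Phi_of_nonneg hm ht, Phi_of_nonneg (inv_pos.2 hm) (Real.rpow_nonneg ht _),
      Real.rpow_rpow_inv ht hm.ne']
  rcases le_total 0 t with ht | ht
  · exact key t ht
  · have := key (-t) (by linarith)
    rw [Phi_neg, Phi_neg] at this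
    linarith

lemma measurable_Phi (m : ℝ) : Measurable (Phi m) := by
  unfold Phi
  exact (measurable_norm.pow_const _).mul measurable_id

lemma continuous_Phi {m : ℝ} (hm : 1 ≤ m) : Continuous (Phi m) :=
  (continuous_abs.rpow_const fun _ => Or.inr (by linarith)).mul continuous_id

/-- Superadditivity of `r ↦ r ^ m` on the half line gives `(a - b) ^ m ≤ Φ a - Φ b` for `0 ≤ b ≤ a`,
and oddness transfers this to negative arguments. If `b + ε ≤ a`, then `a ≥ ε / 2` or `-b ≥ ε / 2`,
so a gap of length `ε / 2` lies on one side of zero; hence the constant `(ε / 2) ^ m`. -/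
lemma isExpanding_Phi {m : ℝ} (hm : 1 < m) : IsExpanding (Phi m) := by
  have hm0 : 0 < m := by linarith
  have hinc : ∀ a b : ℝ, 0 ≤ b → b ≤ a → (a - b) ^ m ≤ Phi m a - Phi m b := fun a b hb hab => by
    have h := Real.add_rpow_le_rpow_add (sub_nonneg.2 hab) hb hm.le
    rw [sub_add_cancel] at h
    rw [Phi_of_nonneg hm0 hb, Phi_of_nonneg hm0 (hb.trans hab)]
    linarith
  have hmono : Monotone (Phi m) := by
    intro b a hab
    rcases le_total 0 b with hb | hb
    · have := hinc a b hb hab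
      have := Real.rpow_nonneg (sub_nonneg.2 hab) m
      linarith
    · rcases le_total 0 a with ha | ha
      · have h1 : 0 ≤ Phi m a := by rw [Phi_of_nonneg hm0 ha]; positivity
        have h2 : 0 ≤ Phi m (-b) := by
          rw [Phi_of_nonneg hm0 (by linarith)]
          exact Real.rpow_nonneg (by linarith) _
        rw [Phi_neg] at h2
        linarith
      · have := hinc (-b) (-a) (by linarith) (by linarith)
        have := Real.rpow_nonneg (show 0 ≤ -b - -a by linarith) m
        rw [Phi_neg, Phi_neg] at *
        linarith
  refine ⟨continuous_Phi hm.le, hmono.strictMono_of_injective fun a b hab => ?_, by simp [Phi],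
    fun ε hε => ⟨(ε / 2) ^ m, by positivity, fun a b hab => ?_⟩, fun t => ?_⟩
  · rw [← Phi_inv hm0 a, hab, Phi_inv hm0]
  · rcases le_total (ε / 2) a with ha | ha
    · have h1 := hinc a (a - ε / 2) (by linarith) (by linarith)
      have h2 := hmono (show b ≤ a - ε / 2 by linarith)
      rw [sub_sub_cancel] at h1
      linarith
    · have h1 := hinc (-b) (-b - ε / 2) (by linarith) (by linarith)
      have h2 := hmono (show -a ≤ -b - ε / 2 by linarith)
      rw [sub_sub_cancel] at h1
      rw [Phi_neg] at h1 h2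
      linarith
  · rcases le_total |t| 1 with h | h
    · linarith [abs_nonneg (Phi m t)]
    · have h1 : |Phi m t| = |t| ^ m := by
        rw [Phi, abs_mul, abs_of_nonneg (Real.rpow_nonneg (abs_nonneg t) _),
          ← Real.rpow_add_one (by linarith : |t| ≠ 0), sub_add_cancel]
      have h2 := Real.rpow_le_rpow_of_exponent_le h hm.le
      rw [Real.rpow_one] at h2
      linarith

/-- The entropy `∫_k^u P(Φ(σ) - Φ(k)) dσ`. -/
def entropy (Φ P : ℝ → ℝ) (u k : ℝ) : ℝ := ∫ σ in k..u, P (Φ σ - Φ k)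

section Entropy

variable {Φ P : ℝ → ℝ}

lemma continuous_entropy (hΦ : Continuous Φ) (hP : Continuous P) :
    Continuous fun q : ℝ × ℝ => entropy Φ P q.1 q.2 := by
  have hf : Continuous (Function.uncurry fun (q : ℝ × ℝ) σ => P (Φ σ - Φ q.2)) := by
    unfold Function.uncurry
    fun_prop
  have h1 := intervalIntegral.continuous_parametric_intervalIntegral_of_continuous
    (μ := volume) (a₀ := 0) hf (s := fun q : ℝ × ℝ => q.1) continuous_fst
  have h2 := intervalIntegral.continuous_parametric_intervalIntegral_of_continuous
    (μ := volume) (a₀ := 0) hf (s := fun q : ℝ × ℝ => q.2) continuous_snd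
  refine (h1.sub h2).congr fun q => ?_
  have hc : Continuous fun σ => P (Φ σ - Φ q.2) := by fun_prop
  exact intervalIntegral.integral_interval_sub_left (hc.intervalIntegrable _ _)
    (hc.intervalIntegrable _ _)

lemma entropy_self (k : ℝ) : entropy Φ P k k = 0 := by simp [entropy]

/-- The integrand is nondecreasing in `σ`, so the entropy is convex in its first argument; this is
the tangent line inequality at `a`. It takes the place of a chain rule in time. -/
lemma entropy_sub_le (hΦ : Continuous Φ) (hΦm : Monotone Φ) (hP : Continuous P)
    (hPm : Monotone P) (a b k : ℝ) :
    entropy Φ P a k - entropy Φ P b k ≤ (a - b) * P (Φ a - Φ k) := by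
  have hc : Continuous fun σ => P (Φ σ - Φ k) := by fun_prop
  have hm : Monotone fun σ => P (Φ σ - Φ k) := fun x y hxy => hPm (by linarith [hΦm hxy])
  have e : entropy Φ P a k - entropy Φ P b k = ∫ σ in b..a, P (Φ σ - Φ k) :=
    intervalIntegral.integral_interval_sub_left (hc.intervalIntegrable _ _)
      (hc.intervalIntegrable _ _)
  rw [e]
  rcases le_total b a with hab | hab
  · have := intervalIntegral.integral_mono_on hab (hc.intervalIntegrable (μ := volume) b a)
      (continuous_const.intervalIntegrable b a) (fun x hx => hm hx.2)
    simpa using this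
  · have := intervalIntegral.integral_mono_on hab (continuous_const.intervalIntegrable a b)
      (hc.intervalIntegrable (μ := volume) a b) (fun x hx => hm hx.1)
    rw [intervalIntegral.integral_symm]
    simp only [intervalIntegral.integral_const, smul_eq_mul] at this
    linarith

lemma entropy_nonneg (hΦ : Continuous Φ) (hΦm : Monotone Φ) (hP : Continuous P)
    (hPm : Monotone P) (hP0 : P 0 = 0) (u k : ℝ) : 0 ≤ entropy Φ P u k := by
  have := entropy_sub_le hΦ hΦm hP hPm k u k
  rw [entropy_self, sub_self, hP0] at this
  linarith

lemma entropy_le (hΦ : Continuous Φ) (hΦm : Monotone Φ) {L : ℝ≥0} (hP : LipschitzWith L P)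
    (hPm : Monotone P) (hP0 : P 0 = 0) (u k : ℝ) :
    entropy Φ P u k ≤ L * (|u - k| * |Φ u - Φ k|) := by
  have h1 := entropy_sub_le hΦ hΦm hP.continuous hPm u k k
  rw [entropy_self, sub_zero] at h1
  have h2 := hP.dist_le_mul (Φ u - Φ k) 0
  rw [Real.dist_eq, Real.dist_eq, hP0, sub_zero, sub_zero] at h2
  calc entropy Φ P u k ≤ |(u - k) * P (Φ u - Φ k)| := h1.trans (le_abs_self _)
    _ = |u - k| * |P (Φ u - Φ k)| := abs_mul _ _
    _ ≤ |u - k| * (L * |Φ u - Φ k|) := by gcongr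
    _ = _ := by ring

/-- The tangent line inequality with base point `b`, after discarding the nonnegative entropy of
`b`. Choosing `b = k ± ε` gives the lower bounds that follow. -/
lemma le_entropy (hΦ : Continuous Φ) (hΦm : Monotone Φ) (hP : Continuous P)
    (hPm : Monotone P) (hP0 : P 0 = 0) (u b k : ℝ) :
    (u - b) * P (Φ b - Φ k) ≤ entropy Φ P u k := by
  have h1 := entropy_sub_le hΦ hΦm hP hPm b u k
  have h2 := entropy_nonneg hΦ hΦm hP hPm hP0 b k
  linarith

/-- With `P` close to the Heaviside function, the entropy is close to the positive part. -/
lemma entropy_heaviside (hΦ : IsExpanding Φ) (hP : Continuous P) (hPm : Monotone P)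
    (hP0 : ∀ t ≤ 0, P t = 0) (hP1 : ∀ t, P t ≤ 1) {ε δ : ℝ} (hε : 0 < ε)
    (hδ : ∀ a b, b + ε ≤ a → δ ≤ Φ a - Φ b) (hPδ : ∀ t, δ ≤ t → P t = 1) (u k : ℝ) :
    max (u - k) 0 - ε ≤ entropy Φ P u k ∧ entropy Φ P u k ≤ max (u - k) 0 := by
  have hm := hΦ.strictMono.monotone
  have h0 := entropy_nonneg hΦ.continuous hm hP hPm (hP0 0 le_rfl) u k
  constructor
  · rcases le_total (u - k) ε with h | h
    · have : max (u - k) 0 ≤ ε := max_le h hε.le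
      linarith
    · have h1 := le_entropy hΦ.continuous hm hP hPm (hP0 0 le_rfl) u (k + ε) k
      rw [hPδ _ (hδ _ _ le_rfl)] at h1
      rw [max_eq_left (by linarith)]
      linarith
  · have h1 := entropy_sub_le hΦ.continuous hm hP hPm u k k
    rw [entropy_self, sub_zero] at h1
    rcases le_total u k with h | h
    · rw [hP0 _ (by linarith [hm h]), mul_zero] at h1
      exact h1.trans (le_max_right _ _)
    · refine h1.trans (le_trans ?_ (le_max_left _ _))
      exact mul_le_of_le_one_right (by linarith) (hP1 _)

/-- The counterpart of `entropy_heaviside` for the second solution, where `u` and `k` exchange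
roles: the reflected profile makes both entropies approximate the same positive part. -/
lemma entropy_reflect (hΦ : IsExpanding Φ) (hP : Continuous P) (hPm : Monotone P)
    (hP0 : ∀ t ≤ 0, P t = 0) (hP1 : ∀ t, P t ≤ 1) {ε δ : ℝ} (hε : 0 < ε)
    (hδ : ∀ a b, b + ε ≤ a → δ ≤ Φ a - Φ b) (hPδ : ∀ t, δ ≤ t → P t = 1) (u k : ℝ) :
    max (k - u) 0 - ε ≤ entropy Φ (fun t => -P (-t)) u k ∧
      entropy Φ (fun t => -P (-t)) u k ≤ max (k - u) 0 := by
  have hm := hΦ.strictMono.monotone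
  have hP' : Continuous fun t => -P (-t) := by fun_prop
  have hPm' : Monotone fun t => -P (-t) := fun x y hxy => neg_le_neg (hPm (neg_le_neg hxy))
  have hz : (fun t => -P (-t)) 0 = 0 := by simp [hP0 0 le_rfl]
  have h0 := entropy_nonneg hΦ.continuous hm hP' hPm' hz u k
  constructor
  · rcases le_total (k - u) ε with h | h
    · have : max (k - u) 0 ≤ ε := max_le h hε.le
      linarith
    · have h1 := le_entropy hΦ.continuous hm hP' hPm' hz u (k - ε) k
      rw [neg_sub, hPδ _ (hδ _ _ (by linarith))] at h1
      rw [max_eq_left (by linarith)]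
      linarith
  · have h1 := entropy_sub_le hΦ.continuous hm hP' hPm' u k k
    rw [entropy_self, sub_zero, neg_sub] at h1
    rcases le_total k u with h | h
    · rw [hP0 _ (by linarith [hm h]), neg_zero, mul_zero] at h1
      exact h1.trans (le_max_right _ _)
    · refine h1.trans (le_trans ?_ (le_max_left _ _))
      have := mul_le_of_le_one_right (sub_nonneg.2 h) (hP1 (Φ k - Φ u))
      linarith

/-- For `P = id` the integrand has modulus at least `d` at distance `ε` or more from `k`, so the
part of `|u - k|` exceeding `ε` is paid for by the entropy. This turns entropy bounds into `L¹`
bounds. -/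
lemma abs_sub_le_entropy (hΦ : IsExpanding Φ) {ε d : ℝ} (hd0 : 0 < d)
    (hd : ∀ a b, b + ε ≤ a → d ≤ Φ a - Φ b) (u k : ℝ) :
    |u - k| ≤ ε + d⁻¹ * entropy Φ id u k := by
  have hm := hΦ.strictMono.monotone
  have h0 := entropy_nonneg hΦ.continuous hm continuous_id monotone_id rfl u k
  have h1 : ∀ r, r * d ≤ entropy Φ id u k → r ≤ d⁻¹ * entropy Φ id u k := fun r hr => by
    rw [inv_mul_eq_div, le_div_iff₀ hd0]
    exact hr
  rcases le_total |u - k| ε with h | h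
  · have := mul_nonneg (inv_nonneg.2 hd0.le) h0
    linarith
  · have := h1 (|u - k| - ε) ?_
    · linarith
    rcases le_total k u with hku | hku
    · rw [abs_of_nonneg (sub_nonneg.2 hku)] at h ⊢
      refine le_trans ?_ (le_entropy hΦ.continuous hm continuous_id monotone_id rfl u (k + ε) k)
      rw [id, sub_add_eq_sub_sub]
      exact mul_le_mul_of_nonneg_left (hd _ _ le_rfl) (by linarith)
    · rw [abs_of_nonpos (sub_nonpos.2 hku)] at h ⊢
      refine le_trans ?_ (le_entropy hΦ.continuous hm continuous_id monotone_id rfl u (k - ε) k)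
      have := mul_le_mul_of_nonneg_left (hd k (k - ε) (by linarith))
        (show 0 ≤ -(u - k) - ε by linarith)
      rw [id]
      linarith

end Entropy

/-! ### Smooth primitives -/

/-- Converts a weight `g` on `(0,T)` into a time test function with `-θ' = g` and `θ 0 = ∫ g`. The
primitive `∫_t^T g` vanishes near `T` but not for negative `t`; multiplying by a smooth step which
equals one on `t ≥ -1` makes the support compact without changing `θ` on `t ≥ 0`. -/
lemma exists_smooth_primitive {g : ℝ → ℝ} (hg : ContDiff ℝ (⊤ : ℕ∞) g) (hgc : HasCompactSupport g)
    {T : ℝ} (hT : 0 < T) (hgs : tsupport g ⊆ Ioo 0 T) : ∃ θ : ℝ → ℝ, ContDiff ℝ (⊤ : ℕ∞) θ ∧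
      HasCompactSupport θ ∧ tsupport θ ⊆ Iio T ∧ (∀ t ≥ 0, deriv θ t = -g t) ∧
      (∀ t ≥ 0, θ t = ∫ τ in t..T, g τ) ∧ ((∀ t, 0 ≤ g t) → ∀ t, 0 ≤ θ t) := by
  obtain ⟨b, hb0, hbT, hb⟩ : ∃ b, 0 ≤ b ∧ b < T ∧ ∀ t, b < t → g t = 0 := by
    rcases (tsupport g).eq_empty_or_nonempty with h | h
    · refine ⟨0, le_rfl, hT, fun t _ => ?_⟩
      rw [tsupport_eq_empty_iff] at h
      simp [h]
    · obtain ⟨b, hb, hmax⟩ := IsCompact.exists_isGreatest (s := tsupport g) hgc h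
      refine ⟨b, (hgs hb).1.le, (hgs hb).2, fun t ht => ?_⟩
      by_contra h0
      exact absurd (hmax (subset_tsupport g h0)) (not_le.2 ht)
  set G : ℝ → ℝ := fun t => ∫ τ in t..T, g τ with hG
  have hGd : ∀ t, HasDerivAt G (-g t) t := fun t =>
    intervalIntegral.integral_hasDerivAt_left (hg.continuous.intervalIntegrable _ _)
      hg.continuous.stronglyMeasurable.stronglyMeasurableAtFilter hg.continuous.continuousAt
  have hGs : ContDiff ℝ (⊤ : ℕ∞) G := by
    rw [contDiff_infty_iff_deriv]
    refine ⟨fun t => (hGd t).differentiableAt, ?_⟩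
    rw [show deriv G = fun t => -g t from funext fun t => (hGd t).deriv]
    exact hg.neg
  have hGb : ∀ t, b ≤ t → G t = 0 := fun t ht => by
    have : ∀ τ ∈ uIoc t T, g τ = 0 := fun τ hτ => hb τ (by
      rcases le_total t T with h | h
      · rw [uIoc_of_le h] at hτ
        linarith [hτ.1]
      · rw [uIoc_of_ge h] at hτ
        linarith [hτ.1])
    rw [hG]
    simp only
    exact intervalIntegral.integral_zero_ae (ae_of_all _ this)
  set χ : ℝ → ℝ := fun t => Real.smoothTransition (t + 2) with hχ
  have hχ1 : ∀ t, -1 ≤ t → χ t = 1 := fun t ht =>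
    Real.smoothTransition.one_of_one_le (by linarith)
  have hsupp : tsupport (fun t => χ t * G t) ⊆ Icc (-2) b := by
    refine closure_minimal (fun t ht => ?_) isClosed_Icc
    rw [Function.mem_support] at ht
    constructor
    · by_contra h
      exact ht (by simp [hχ, Real.smoothTransition.zero_of_nonpos (by linarith : t + 2 ≤ 0)])
    · by_contra h
      exact ht (by simp [hGb t (by linarith)])
  refine ⟨fun t => χ t * G t, ContDiff.mul (Real.smoothTransition.contDiff.comp
    (contDiff_id.add contDiff_const)) hGs, HasCompactSupport.of_support_subset_isCompact
      isCompact_Icc ((subset_tsupport _).trans hsupp),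
    hsupp.trans fun t ht => lt_of_le_of_lt ht.2 hbT, fun t ht => ?_, fun t ht => ?_,
    fun h t => ?_⟩
  · have e : (fun t => χ t * G t) =ᶠ[𝓝 t] G := by
      filter_upwards [lt_mem_nhds (show (-1 : ℝ) < t by linarith)] with τ hτ
      rw [hχ1 τ hτ.le, one_mul]
    rw [e.deriv_eq, (hGd t).deriv]
  · simp only
    rw [hχ1 t (by linarith), one_mul]
  · refine mul_nonneg (Real.smoothTransition.nonneg _) ?_
    rcases le_total t b with htb | htb
    · exact intervalIntegral.integral_nonneg (by linarith) fun τ _ => h τ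
    · rw [hGb t htb]

/-! ### Square integrable functions on space-time -/

section SpaceTime

variable {X : Type*} [MeasureSpace X] [SigmaFinite (volume : Measure X)]

lemma prod_restrict_eq (S : Set ℝ) : (volume : Measure X).prod (volume.restrict S)
    = (volume : Measure (X × ℝ)).restrict (univ ×ˢ S) := by
  rw [Measure.volume_eq_prod, ← Measure.prod_restrict, Measure.restrict_univ]

lemma MemLp.slab {p : ℝ≥0∞} {f : X × ℝ → ℝ} (hf : MemLp f p volume) (S : Set ℝ) :
    MemLp f p ((volume : Measure X).prod (volume.restrict S)) := by
  rw [prod_restrict_eq]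
  exact hf.restrict _

lemma MemLp.slice {f : X × ℝ → ℝ} (hf : MemLp f 2 volume) (hfm : Measurable f) :
    ∀ᵐ t, MemLp (fun x => f (x, t)) 2 volume := by
  have h1 : Integrable (fun q => f q ^ 2) ((volume : Measure X).prod (volume : Measure ℝ)) :=
    hf.integrable_sq
  filter_upwards [h1.prod_left_ae] with t ht
  have hm : AEStronglyMeasurable (fun x => f (x, t)) volume :=
    (hfm.comp measurable_prodMk_right).aestronglyMeasurable
  exact (memLp_two_iff_integrable_sq hm).2 ht

lemma integrable_slab_mul {f : X × ℝ → ℝ} {g : X → ℝ} (hf : MemLp f 2 volume)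
    (hg : MemLp g 2 volume) (a b : ℝ) :
    Integrable (fun q : X × ℝ => f q * g q.1)
      ((volume : Measure X).prod (volume.restrict (Ioo a b))) :=
  (MemLp.slab hf _).integrable_mul (hg.comp_fst _)

lemma integrable_pairing_aux {f : X × ℝ → ℝ} {g : X → ℝ} (hf : MemLp f 2 volume)
    (hg : MemLp g 2 volume) {T : ℝ} (hfT : ∀ x t, t ∉ Ioo 0 T → f (x, t) = 0) :
    Integrable fun τ => ∫ x, f (x, τ) * g x := by
  have h1 := (integrable_slab_mul hf hg 0 T).integral_prod_right
  rw [← IntegrableOn, ← integrable_indicator_iff measurableSet_Ioo] at h1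
  refine h1.congr (ae_of_all _ fun t => ?_)
  by_cases ht : t ∈ Ioo 0 T
  · simp only [indicator_of_mem ht]
  · simp only [indicator_of_notMem ht]
    simp [hfT _ t ht]

end SpaceTime

/-! ### Evolution equations tested against `H̃^s` -/

/-- The pairing of the functional with densities `aB`, `aO` at time `τ` with `ζ`. -/
def pairing (s : ℝ) (aB : (E n × E n) × ℝ → ℝ) (aO : E n × ℝ → ℝ) (τ : ℝ) (ζ : E n → ℝ) : ℝ :=
  (∫ z, aB (z, τ) * dq s ζ z) + ∫ x, aO (x, τ) * ζ x

/-- Energy solutions of `ρ ∂ₜ v + A = 0`, `v(0) = v₀`, where `A` is the functional with densities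
`aB` and `aO`; all functions are extended by zero outside of `Ω × (0,T)` and `Ω`. -/
structure IsEnergySolution (Ω : Set (E n)) (T s : ℝ) (ρ : E n → ℝ) (Φ : ℝ → ℝ)
    (v : E n × ℝ → ℝ) (v₀ : E n → ℝ) (aB : (E n × E n) × ℝ → ℝ) (aO : E n × ℝ → ℝ) : Prop where
  measurable : Measurable v
  measurable₀ : Measurable v₀
  measurable_aB : Measurable aB
  measurable_aO : Measurable aO
  memLp : MemLp v 2 volume
  memLp_Phi : MemLp (fun p => Φ (v p)) 2 volume
  memLp_dq : MemLp (fun q : (E n × E n) × ℝ => dq s (fun x => Φ (v (x, q.2))) q.1) 2 volume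
  memLp₀ : MemLp v₀ 2 volume
  memLp_Phi₀ : MemLp (fun x => Φ (v₀ x)) 2 volume
  memLp_aB : MemLp aB 2 volume
  memLp_aO : MemLp aO 2 volume
  eq_zero : ∀ x t, (x ∉ Ω ∨ t ∉ Ioo 0 T) → v (x, t) = 0
  eq_zero₀ : ∀ x ∉ Ω, v₀ x = 0
  aB_eq_zero : ∀ z t, t ∉ Ioo 0 T → aB (z, t) = 0
  aO_eq_zero : ∀ x t, t ∉ Ioo 0 T → aO (x, t) = 0
  memHsTilde : ∀ᵐ t, t ∈ Ioo 0 T → MemHsTilde Ω s (fun x => Φ (v (x, t)))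
  eq : ∀ᵐ t, t ∈ Ioo 0 T → ∀ ζ, MemHsTilde Ω s ζ →
    ∫ x, ρ x * (v (x, t) - v₀ x) * ζ x = -∫ τ in 0..t, pairing s aB aO τ ζ

/-! ### Entropy inequality of one solution relative to a frozen state. -/

section EntropyInequality

variable {Ω : Set (E n)} {T s : ℝ} {ρ : E n → ℝ} {Φ : ℝ → ℝ} {v : E n × ℝ → ℝ} {v₀ : E n → ℝ}
  {aB : (E n × E n) × ℝ → ℝ} {aO : E n × ℝ → ℝ}

lemma IsEnergySolution.integrable_pairing (h : IsEnergySolution Ω T s ρ Φ v v₀ aB aO)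
    {ζ : E n → ℝ} (hζ : MemHs s ζ) : Integrable fun τ => pairing s aB aO τ ζ :=
  (integrable_pairing_aux h.memLp_aB (memHs_iff.1 hζ).2 h.aB_eq_zero).add
    (integrable_pairing_aux h.memLp_aO (memHs_iff.1 hζ).1 h.aO_eq_zero)

lemma IsEnergySolution.pairing_eq_zero (h : IsEnergySolution Ω T s ρ Φ v v₀ aB aO) {τ : ℝ}
    (hτ : τ ∉ Ioo 0 T) (ζ : E n → ℝ) : pairing s aB aO τ ζ = 0 := by
  simp [pairing, h.aB_eq_zero _ _ hτ, h.aO_eq_zero _ _ hτ]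

lemma integrable_entropy {Y : Type*} [MeasurableSpace Y] {μ : Measure Y} {P : ℝ → ℝ} {L : ℝ≥0}
    (hΦ : IsExpanding Φ) (hPL : LipschitzWith L P) (hPm : Monotone P) (hP0 : P 0 = 0)
    {f k : Y → ℝ} (hfm : Measurable f) (hkm : Measurable k) (hf : MemLp f 2 μ) (hk : MemLp k 2 μ)
    (hΦf : MemLp (fun y => Φ (f y)) 2 μ) (hΦk : MemLp (fun y => Φ (k y)) 2 μ) :
    Integrable (fun y => entropy Φ P (f y) (k y)) μ := by
  have h1 : Integrable (fun y => (f y - k y) * (Φ (f y) - Φ (k y))) μ :=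
    (hf.sub hk).integrable_mul (hΦf.sub hΦk)
  refine (h1.norm.const_mul (L : ℝ)).mono'
    ((continuous_entropy hΦ.continuous hPL.continuous).measurable.comp
      (hfm.prodMk hkm)).aestronglyMeasurable (ae_of_all _ fun y => ?_)
  have hm := hΦ.strictMono.monotone
  rw [Real.norm_of_nonneg
    (entropy_nonneg hΦ.continuous hm hPL.continuous hPm hP0 _ _), norm_mul]
  exact entropy_le hΦ.continuous hm hPL hPm hP0 _ _

lemma Integrable.density_mul {Y : Type*} [MeasurableSpace Y] {μ : Measure Y} {r f : Y → ℝ} {R : ℝ}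
    (hrm : Measurable r) (hr : ∀ y, 0 ≤ r y ∧ r y ≤ R) (hf : Integrable f μ) :
    Integrable (fun y => r y * f y) μ :=
  hf.bdd_mul hrm.aestronglyMeasurable (c := R)
    (ae_of_all _ fun y => by rw [Real.norm_of_nonneg (hr y).1]; exact (hr y).2)

/-- The pointwise in time form of the entropy inequality with time step `h`. -/
lemma IsEnergySolution.entropy_step (hv : IsEnergySolution Ω T s ρ Φ v v₀ aB aO)
    (hΦ : IsExpanding Φ) (hρm : Measurable ρ) {R : ℝ} (hρ : ∀ x, 0 ≤ ρ x ∧ ρ x ≤ R)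
    {P : ℝ → ℝ} {L : ℝ≥0} (hP : ContDiff ℝ (⊤ : ℕ∞) P) (hPL : LipschitzWith L P)
    (hPm : Monotone P) (hP0 : P 0 = 0) {k : E n → ℝ} (hkm : Measurable k) (hk : MemLp k 2 volume)
    (hΦk : MemLp (fun x => Φ (k x)) 2 volume) (hkt : MemHsTilde Ω s (fun x => Φ (k x)))
    {h : ℝ} (hh : 0 < h) : ∀ᵐ t, t ∈ Ioo 0 T →
      (∫ x, ρ x * (entropy Φ P (v (x, t)) (k x) - entropy Φ P (v₀ x) (k x)))
        - (Ioo 0 T).indicator (fun t =>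
            ∫ x, ρ x * (entropy Φ P (v (x, t)) (k x) - entropy Φ P (v₀ x) (k x))) (t - h)
        ≤ -∫ σ in Ioo 0 h, pairing s aB aO (t - σ) (fun x => P (Φ (v (x, t)) - Φ (k x))) := by
  have hgood : ∀ᵐ t, t ∈ Ioo 0 T → MemLp (fun x => v (x, t)) 2 volume ∧
      MemLp (fun x => Φ (v (x, t))) 2 volume ∧ ∀ ζ, MemHsTilde Ω s ζ →
        ∫ x, ρ x * (v (x, t) - v₀ x) * ζ x = -∫ τ in 0..t, pairing s aB aO τ ζ := by
    filter_upwards [MemLp.slice hv.memLp hv.measurable, MemLp.slice hv.memLp_Phi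
      (hΦ.continuous.measurable.comp hv.measurable), hv.eq] with t h1 h2 h3 ht
    exact ⟨h1, h2, h3 ht⟩
  have hgoodh := (measurePreserving_sub_right volume h).quasiMeasurePreserving.ae hgood
  filter_upwards [hgood, hgoodh, hv.memHsTilde] with t ht hth htilde htT
  obtain ⟨a1, a2, a3⟩ := ht htT
  set ζ : E n → ℝ := fun x => P (Φ (v (x, t)) - Φ (k x)) with hζ
  have hζt : MemHsTilde Ω s ζ := ((htilde htT).sub hkt).comp_smooth hP hPL hP0
  have hζ2 : MemLp ζ 2 volume := (memHs_iff.1 hζt.1).1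
  have hFi := hv.integrable_pairing hζt.1
  -- `w` is the solution at time `t - h`, replaced by `v₀` when `t ≤ h`. The integrated equation
  -- holds for `w` in both cases because the pairing vanishes at negative times.
  obtain ⟨w, hwm, hw2, hΦw2, hw, hind⟩ : ∃ w : E n → ℝ, Measurable w ∧ MemLp w 2 volume ∧
      MemLp (fun x => Φ (w x)) 2 volume ∧
      (∫ x, ρ x * (w x - v₀ x) * ζ x = -∫ τ in 0..(t - h), pairing s aB aO τ ζ) ∧
      (Ioo 0 T).indicator (fun t =>
        ∫ x, ρ x * (entropy Φ P (v (x, t)) (k x) - entropy Φ P (v₀ x) (k x))) (t - h)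
        = ∫ x, ρ x * (entropy Φ P (w x) (k x) - entropy Φ P (v₀ x) (k x)) := by
    by_cases hT : t - h ∈ Ioo 0 T
    · obtain ⟨b1, b2, b3⟩ := hth hT
      exact ⟨_, hv.measurable.comp measurable_prodMk_right, b1, b2, b3 ζ hζt,
        by rw [indicator_of_mem hT]; rfl⟩
    · refine ⟨v₀, hv.measurable₀, hv.memLp₀, hv.memLp_Phi₀, ?_, by
        rw [indicator_of_notMem hT]; simp⟩
      have hneg : t - h ≤ 0 := by
        by_contra hc
        exact hT ⟨not_le.1 hc, by linarith [htT.2]⟩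
      rw [intervalIntegral.integral_zero_ae]
      · simp
      · refine ae_of_all _ fun τ hτ => hv.pairing_eq_zero (fun hτ' => ?_) ζ
        rw [uIoc_of_ge hneg] at hτ
        linarith [hτ.2, hτ'.1]
  have hvm : Measurable fun x => v (x, t) := hv.measurable.comp measurable_prodMk_right
  have e1 := integrable_entropy (μ := volume) hΦ hPL hPm hP0 hvm hkm a1 hk a2 hΦk
  have e2 := integrable_entropy (μ := volume) hΦ hPL hPm hP0 hwm hkm hw2 hk hΦw2 hΦk
  have e0 := integrable_entropy (μ := volume) hΦ hPL hPm hP0 hv.measurable₀ hkm hv.memLp₀ hk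
    hv.memLp_Phi₀ hΦk
  have m1 : Integrable (fun x => ρ x * ((v (x, t) - v₀ x) * ζ x)) :=
    Integrable.density_mul hρm hρ ((a1.sub hv.memLp₀).integrable_mul hζ2)
  have m2 : Integrable (fun x => ρ x * ((w x - v₀ x) * ζ x)) :=
    Integrable.density_mul hρm hρ ((hw2.sub hv.memLp₀).integrable_mul hζ2)
  have hint : ∫ σ in Ioo 0 h, pairing s aB aO (t - σ) ζ
      = (∫ τ in 0..t, pairing s aB aO τ ζ) - ∫ τ in 0..(t - h), pairing s aB aO τ ζ := by
    rw [intervalIntegral.integral_interval_sub_left hFi.intervalIntegrable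
      hFi.intervalIntegrable, ← integral_Ioc_eq_integral_Ioo,
      ← intervalIntegral.integral_of_le hh.le,
      intervalIntegral.integral_comp_sub_left (fun τ => pairing s aB aO τ ζ), sub_zero]
  have i1 : Integrable (fun x => ρ x * (entropy Φ P (v (x, t)) (k x) - entropy Φ P (v₀ x) (k x))) :=
    Integrable.density_mul hρm hρ (e1.sub e0)
  have i2 : Integrable (fun x => ρ x * (entropy Φ P (w x) (k x) - entropy Φ P (v₀ x) (k x))) :=
    Integrable.density_mul hρm hρ (e2.sub e0)
  rw [hind, hint, ← integral_sub i1 i2]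
  have hrhs : -((∫ τ in 0..t, pairing s aB aO τ ζ) - ∫ τ in 0..(t - h), pairing s aB aO τ ζ)
      = ∫ x, (ρ x * ((v (x, t) - v₀ x) * ζ x) - ρ x * ((w x - v₀ x) * ζ x)) := by
    have h1 := a3 ζ hζt
    simp_rw [mul_assoc] at h1 hw
    rw [integral_sub m1 m2, h1, hw]
    ring
  rw [hrhs]
  -- Pointwise this is convexity: `ζ x` is the slope of the entropy at the later value `v (x, t)`.
  refine integral_mono (i1.sub i2) (m1.sub m2) fun x => ?_
  have key := entropy_sub_le hΦ.continuous hΦ.strictMono.monotone hPL.continuous hPm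
    (v (x, t)) (w x) (k x)
  have := mul_le_mul_of_nonneg_left key (hρ x).1
  simp only [hζ]
  linarith

end EntropyInequality

instance isAddHaarMeasure_prod : (volume : Measure (E n × E n)).IsAddHaarMeasure :=
  Measure.prod.instIsAddHaarMeasure (volume : Measure (E n)) (volume : Measure (E n))

section EntropyInequality

variable {Ω : Set (E n)} {T s : ℝ} {ρ : E n → ℝ} {Φ : ℝ → ℝ} {v : E n × ℝ → ℝ} {v₀ : E n → ℝ}
  {aB : (E n × E n) × ℝ → ℝ} {aO : E n × ℝ → ℝ}

lemma abs_dq_comp_le {P : ℝ → ℝ} {L : ℝ≥0} (hPL : LipschitzWith L P) (s : ℝ) (f g : E n → ℝ)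
    (z : E n × E n) :
    |dq s (fun x => P (f x - g x)) z| ≤ L * (|dq s f z| + |dq s g z|) := by
  have h1 := hPL.dist_le_mul (f z.1 - g z.1) (f z.2 - g z.2)
  rw [Real.dist_eq, Real.dist_eq] at h1
  have h2 : |f z.1 - g z.1 - (f z.2 - g z.2)| ≤ |f z.1 - f z.2| + |g z.1 - g z.2| := by
    rw [show f z.1 - g z.1 - (f z.2 - g z.2) = (f z.1 - f z.2) - (g z.1 - g z.2) by ring]
    exact abs_sub _ _
  simp only [dq, abs_div]
  rw [← add_div, ← mul_div_assoc]
  have hL : (0 : ℝ) ≤ L := L.2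
  gcongr
  exact h1.trans (mul_le_mul_of_nonneg_left h2 hL)

lemma abs_comp_le {P : ℝ → ℝ} {L : ℝ≥0} (hPL : LipschitzWith L P) (hP0 : P 0 = 0) (a b : ℝ) :
    |P (a - b)| ≤ L * (|a| + |b|) := by
  have h1 := hPL.dist_le_mul (a - b) 0
  rw [Real.dist_eq, Real.dist_eq, hP0, sub_zero, sub_zero] at h1
  exact h1.trans (mul_le_mul_of_nonneg_left (abs_sub _ _) L.2)

lemma integrable_prod_entropy (hv : IsEnergySolution Ω T s ρ Φ v v₀ aB aO)
    (hΦ : IsExpanding Φ) (hρm : Measurable ρ) {R : ℝ} (hρ : ∀ x, 0 ≤ ρ x ∧ ρ x ≤ R)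
    {P : ℝ → ℝ} {L : ℝ≥0} (hPL : LipschitzWith L P)
    (hPm : Monotone P) (hP0 : P 0 = 0) {k : E n → ℝ} (hkm : Measurable k) (hk : MemLp k 2 volume)
    (hΦk : MemLp (fun x => Φ (k x)) 2 volume) :
    Integrable (fun q : E n × ℝ =>
      ρ q.1 * (entropy Φ P (v q) (k q.1) - entropy Φ P (v₀ q.1) (k q.1)))
      ((volume : Measure (E n)).prod (volume.restrict (Ioo 0 T))) := by
  have e1 := integrable_entropy (μ := (volume : Measure (E n)).prod (volume.restrict (Ioo 0 T)))
    hΦ hPL hPm hP0 hv.measurable (hkm.comp measurable_fst) (MemLp.slab hv.memLp _)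
    (hk.comp_fst _) (MemLp.slab hv.memLp_Phi _) (hΦk.comp_fst _)
  have e0 := (integrable_entropy (μ := volume) hΦ hPL hPm hP0 hv.measurable₀ hkm hv.memLp₀ hk
    hv.memLp_Phi₀ hΦk).comp_fst (volume.restrict (Ioo 0 T))
  exact Integrable.density_mul (hρm.comp measurable_fst) (fun q => hρ q.1) (e1.sub e0)

/-- The entropy inequality for energy solutions. -/
lemma IsEnergySolution.entropy_inequality (hv : IsEnergySolution Ω T s ρ Φ v v₀ aB aO)
    (hΦ : IsExpanding Φ) (hρm : Measurable ρ) {R : ℝ} (hρ : ∀ x, 0 ≤ ρ x ∧ ρ x ≤ R)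
    {P : ℝ → ℝ} {L : ℝ≥0} (hP : ContDiff ℝ (⊤ : ℕ∞) P) (hPL : LipschitzWith L P)
    (hPm : Monotone P) (hP0 : P 0 = 0) {k : E n → ℝ} (hkm : Measurable k) (hk : MemLp k 2 volume)
    (hΦk : MemLp (fun x => Φ (k x)) 2 volume) (hkt : MemHsTilde Ω s (fun x => Φ (k x)))
    {θ : ℝ → ℝ} (hθ : ContDiff ℝ (⊤ : ℕ∞) θ) (hθc : HasCompactSupport θ)
    (hθs : tsupport θ ⊆ Iio T) (hθ0 : ∀ t, 0 ≤ θ t) :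
    ∫ t in Ioo 0 T, -deriv θ t *
        ∫ x, ρ x * (entropy Φ P (v (x, t)) (k x) - entropy Φ P (v₀ x) (k x))
      ≤ -∫ t in Ioo 0 T, θ t * pairing s aB aO t (fun x => P (Φ (v (x, t)) - Φ (k x))) := by
  -- Subtracting the entropy of `v₀` makes the extension by zero to negative times agree with
  -- prolonging `v` by `v₀`.
  set j : ℝ → ℝ := (Ioo 0 T).indicator fun t =>
    ∫ x, ρ x * (entropy Φ P (v (x, t)) (k x) - entropy Φ P (v₀ x) (k x)) with hj
  have hji : Integrable j := by
    rw [hj, integrable_indicator_iff measurableSet_Ioo]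
    exact (integrable_prod_entropy hv hΦ hρm hρ hPL hPm hP0 hkm hk hΦk).integral_prod_right
  set gB : (E n × E n) × ℝ → ℝ := (univ ×ˢ Ioo 0 T).indicator fun q =>
    θ q.2 * dq s (fun x => P (Φ (v (x, q.2)) - Φ (k x))) q.1 with hgB
  set gO : E n × ℝ → ℝ := (univ ×ˢ Ioo 0 T).indicator fun q =>
    θ q.2 * P (Φ (v q) - Φ (k q.1)) with hgO
  have hΦm := hΦ.continuous.measurable
  have hPme := hPL.continuous.measurable
  have hvm := hv.measurable
  have hθm := hθ.continuous.measurable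
  have hgBm0 : Measurable fun q : (E n × E n) × ℝ =>
      θ q.2 * dq s (fun x => P (Φ (v (x, q.2)) - Φ (k x))) q.1 := by
    unfold dq
    fun_prop
  have hgOm0 : Measurable fun q : E n × ℝ => θ q.2 * P (Φ (v q) - Φ (k q.1)) := by fun_prop
  have hgBm : Measurable gB := hgBm0.indicator (MeasurableSet.univ.prod measurableSet_Ioo)
  have hgOm : Measurable gO := hgOm0.indicator (MeasurableSet.univ.prod measurableSet_Ioo)
  obtain ⟨Cθ, hCθ⟩ := hθc.exists_bound_of_continuous hθ.continuous
  obtain ⟨Lθ, hLθ⟩ := ContDiff.lipschitzWith_of_hasCompactSupport hθc hθ (by simp)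
  have hCθ0 : 0 ≤ Cθ := (norm_nonneg _).trans (hCθ 0)
  have hL0 : (0 : ℝ) ≤ L := L.2
  have hgB2 : MemLp gB 2 volume := by
    rw [hgB, memLp_indicator_iff_restrict (MeasurableSet.univ.prod measurableSet_Ioo),
      ← prod_restrict_eq]
    have h1 := (MemLp.slab hv.memLp_dq (Ioo 0 T)).norm
    have h2 := ((memHs_iff.1 hkt.1).2.comp_fst (volume.restrict (Ioo 0 T))).norm
    refine ((h1.add h2).const_mul (Cθ * L)).mono' hgBm0.aestronglyMeasurable
      (ae_of_all _ fun q => ?_)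
    rw [norm_mul, mul_assoc]
    exact mul_le_mul (hCθ _) (abs_dq_comp_le hPL s _ _ _) (norm_nonneg _) hCθ0
  have hgO2 : MemLp gO 2 volume := by
    rw [hgO, memLp_indicator_iff_restrict (MeasurableSet.univ.prod measurableSet_Ioo),
      ← prod_restrict_eq]
    have h1 := (MemLp.slab hv.memLp_Phi (Ioo 0 T)).norm
    have h2 := (hΦk.comp_fst (volume.restrict (Ioo 0 T))).norm
    refine ((h1.add h2).const_mul (Cθ * L)).mono' hgOm0.aestronglyMeasurable
      (ae_of_all _ fun q => ?_)
    rw [norm_mul, mul_assoc]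
    exact mul_le_mul (hCθ _) (abs_comp_le hPL hP0 _ _) (norm_nonneg _) hCθ0
  have hθT : ∀ t, T ≤ t → θ t = 0 := fun t ht =>
    image_eq_zero_of_notMem_tsupport fun h => not_lt.2 ht (hθs h)
  -- The step inequality is multiplied by `θ t / h` and integrated in time. A discrete integration
  -- by parts moves the difference quotient from `j` onto `θ`, and the flux terms become Steklov
  -- averages.
  have stepineq : ∀ h > 0, ∫ t, (h⁻¹ * (θ t - θ (t + h))) * j t
      ≤ -(h⁻¹ * (∫ t, ∫ σ in Ioo 0 h, ∫ z, aB (z, t - σ) * gB (z, t))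
        + h⁻¹ * ∫ t, ∫ σ in Ioo 0 h, ∫ x, aO (x, t - σ) * gO (x, t)) := by
    intro h hh
    have sB := (integrable_steklov hv.measurable_aB hgBm hv.memLp_aB hgB2 h).integral_prod_left
    have sO := (integrable_steklov hv.measurable_aO hgOm hv.memLp_aO hgO2 h).integral_prod_left
    have hae : ∀ᵐ t, θ t * (j t - j (t - h)) ≤
        -((∫ σ in Ioo 0 h, ∫ z, aB (z, t - σ) * gB (z, t))
          + ∫ σ in Ioo 0 h, ∫ x, aO (x, t - σ) * gO (x, t)) := by
      filter_upwards [hv.entropy_step hΦ hρm hρ hP hPL hPm hP0 hkm hk hΦk hkt hh,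
        sB.prod_right_ae, sO.prod_right_ae] with t h1 h2 h3
      by_cases ht : t ∈ Ioo 0 T
      · have h4 := mul_le_mul_of_nonneg_left (h1 ht) (hθ0 t)
        have h5 : j t = ∫ x, ρ x * (entropy Φ P (v (x, t)) (k x) - entropy Φ P (v₀ x) (k x)) := by
          rw [hj, indicator_of_mem ht]
        rw [h5]
        refine h4.trans (le_of_eq ?_)
        rw [← integral_add h2 h3, mul_neg, ← integral_const_mul]
        congr 1
        refine integral_congr_ae (ae_of_all _ fun σ => ?_)
        simp only [pairing, hgB, hgO, indicator_of_mem (mk_mem_prod (mem_univ _) ht)]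
        rw [mul_add, ← integral_const_mul, ← integral_const_mul]
        congr 1 <;>
        · congr 1
          funext z
          ring
      · have e1 : ∀ z, gB (z, t) = 0 := fun z => indicator_of_notMem (fun h => ht h.2) _
        have e2 : ∀ x, gO (x, t) = 0 := fun x => indicator_of_notMem (fun h => ht h.2) _
        simp only [e1, e2, mul_zero, integral_zero, add_zero, neg_zero]
        -- For `t ≥ T` the weight `θ` vanishes, although `j (t - h)` need not; for `t ≤ 0` both
        -- values of `j` vanish.
        rcases le_or_gt T t with hTt | hTt
        · rw [hθT t hTt, zero_mul]
        · have ht0 : t ≤ 0 := by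
            by_contra hc
            exact ht ⟨not_le.1 hc, hTt⟩
          have e3 : j t = 0 := indicator_of_notMem ht _
          have e4 : j (t - h) = 0 := indicator_of_notMem (fun h' => by linarith [h'.1]) _
          rw [e3, e4, sub_zero, mul_zero]
    have hi1 : Integrable fun t => θ t * j t :=
      hji.bdd_mul hθ.continuous.aestronglyMeasurable (ae_of_all _ hCθ)
    have hi2 : Integrable fun t => θ t * j (t - h) :=
      (hji.comp_sub_right h).bdd_mul hθ.continuous.aestronglyMeasurable (ae_of_all _ hCθ)
    have hi3 : Integrable fun t => θ (t + h) * j t :=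
      hji.bdd_mul (c := Cθ) (by
        have := hθ.continuous
        exact (by fun_prop : Continuous fun t => θ (t + h)).aestronglyMeasurable)
        (ae_of_all _ fun t => hCθ _)
    have hi4 : Integrable fun t => θ t * (j t - j (t - h)) :=
      (hi1.sub hi2).congr (ae_of_all _ fun t => (mul_sub _ _ _).symm)
    have hle := integral_mono_ae hi4
      (sB.integral_prod_left.add sO.integral_prod_left).neg hae
    have e5 : ∫ t, θ t * (j t - j (t - h)) = ∫ t, (θ t - θ (t + h)) * j t := by
      simp_rw [mul_sub, sub_mul]
      rw [integral_sub hi1 hi2, integral_sub hi1 hi3,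
        ← integral_sub_right_eq_self (fun t => θ (t + h) * j t) h]
      simp
    simp_rw [mul_assoc]
    rw [integral_const_mul, ← mul_add, ← mul_neg, ← e5]
    refine mul_le_mul_of_nonneg_left (hle.trans (le_of_eq ?_)) (inv_nonneg.2 hh.le)
    rw [← integral_add sB.integral_prod_left sO.integral_prod_left, ← integral_neg]
    rfl
  have hlim1 : Tendsto (fun h : ℝ => ∫ t, (h⁻¹ * (θ t - θ (t + h))) * j t) (𝓝[>] 0)
      (𝓝 (∫ t, -deriv θ t * j t)) := by
    refine tendsto_integral_filter_of_dominated_convergence (fun t => Lθ * |j t|) ?_ ?_ ?_ ?_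
    · refine Eventually.of_forall fun h => AEStronglyMeasurable.mul ?_ hji.1
      have := hθ.continuous
      exact (by fun_prop : Continuous fun t => h⁻¹ * (θ t - θ (t + h))).aestronglyMeasurable
    · filter_upwards [self_mem_nhdsWithin] with h hh
      refine ae_of_all _ fun t => ?_
      have hh' : (0 : ℝ) < h := hh
      have h1 := hLθ.dist_le_mul t (t + h)
      rw [Real.dist_eq, Real.dist_eq, sub_add_cancel_left, abs_neg, abs_of_pos hh'] at h1
      rw [norm_mul, norm_mul, norm_inv, Real.norm_of_nonneg hh'.le, Real.norm_eq_abs,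
        Real.norm_eq_abs]
      gcongr
      rw [inv_mul_le_iff₀ hh', mul_comm]
      exact h1
    · exact hji.abs.const_mul _
    · refine ae_of_all _ fun t => Tendsto.mul_const _ ?_
      have hd : HasDerivAt θ (deriv θ t) t := ((hθ.differentiable (by simp)) t).hasDerivAt
      have h1 := (hasDerivAt_iff_tendsto_slope_zero.1 hd).mono_left
        (nhdsWithin_mono (0 : ℝ) (fun x (hx : 0 < x) => hx.ne'))
      refine h1.neg.congr fun h => ?_
      simp only [smul_eq_mul]
      ring
  -- In the limit the flux and the test function are taken at the same time.
  have hlim2 := ((tendsto_steklov hv.measurable_aB hgBm hv.memLp_aB hgB2).add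
    (tendsto_steklov hv.measurable_aO hgOm hv.memLp_aO hgO2)).neg
  have hfin := le_of_tendsto_of_tendsto hlim1 hlim2
    (eventually_nhdsWithin_of_forall fun h hh => stepineq h hh)
  have e6 : ∫ t, -deriv θ t * j t = ∫ t in Ioo 0 T, -deriv θ t *
      ∫ x, ρ x * (entropy Φ P (v (x, t)) (k x) - entropy Φ P (v₀ x) (k x)) := by
    rw [← integral_indicator measurableSet_Ioo]
    congr 1
    funext t
    by_cases ht : t ∈ Ioo 0 T
    · simp [hj, ht]
    · simp [hj, ht]
  have iB : Integrable fun t => ∫ z, aB (z, t) * gB (z, t) :=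
    (hv.memLp_aB.integrable_mul hgB2 : Integrable fun q => aB q * gB q).integral_prod_right
  have iO : Integrable fun t => ∫ x, aO (x, t) * gO (x, t) :=
    (hv.memLp_aO.integrable_mul hgO2 : Integrable fun q => aO q * gO q).integral_prod_right
  have e7 : (∫ t, ∫ z, aB (z, t) * gB (z, t)) + ∫ t, ∫ x, aO (x, t) * gO (x, t)
      = ∫ t in Ioo 0 T, θ t * pairing s aB aO t (fun x => P (Φ (v (x, t)) - Φ (k x))) := by
    rw [← integral_add iB iO, ← integral_indicator measurableSet_Ioo]
    congr 1
    funext t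
    by_cases ht : t ∈ Ioo 0 T
    · simp only [pairing, hgB, hgO, indicator_of_mem (mk_mem_prod (mem_univ _) ht),
        indicator_of_mem ht]
      rw [mul_add, ← integral_const_mul, ← integral_const_mul]
      congr 1 <;>
      · congr 1
        funext z
        ring
    · have e1 : ∀ z, gB (z, t) = 0 := fun z => indicator_of_notMem (fun h => ht h.2) _
      have e2 : ∀ x, gO (x, t) = 0 := fun x => indicator_of_notMem (fun h => ht h.2) _
      simp [e1, e2, ht]
  rwa [e6, e7] at hfin

end EntropyInequality

/-! ### Functions of two time variables -/

set_option linter.unusedSectionVars false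

section TwoTimes

variable {X : Type*} [MeasureSpace X] [SigmaFinite (volume : Measure X)]
  {ν : Measure ℝ} [IsFiniteMeasure ν]

lemma measurePreserving_prod_swap :
    MeasurePreserving (fun q : X × (ℝ × ℝ) => (q.1, q.2.swap))
      ((volume : Measure X).prod (ν.prod ν)) ((volume : Measure X).prod (ν.prod ν)) :=
  (MeasurePreserving.id (volume : Measure X)).prod (Measure.measurePreserving_swap (μ := ν) (ν := ν))

lemma MemLp.time_fst {p : ℝ≥0∞} {f : X × ℝ → ℝ} (hf : MemLp f p ((volume : Measure X).prod ν)) :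
    MemLp (fun q : X × (ℝ × ℝ) => f (q.1, q.2.1)) p ((volume : Measure X).prod (ν.prod ν)) :=
  (hf.comp_fst ν).comp_measurePreserving (measurePreserving_prodAssoc (volume : Measure X) ν ν).symm

lemma MemLp.time_snd {p : ℝ≥0∞} {f : X × ℝ → ℝ} (hf : MemLp f p ((volume : Measure X).prod ν)) :
    MemLp (fun q : X × (ℝ × ℝ) => f (q.1, q.2.2)) p ((volume : Measure X).prod (ν.prod ν)) :=
  (MemLp.time_fst hf).comp_measurePreserving measurePreserving_prod_swap

lemma Integrable.time_fst {f : X × ℝ → ℝ} (hf : Integrable f ((volume : Measure X).prod ν)) :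
    Integrable (fun q : X × (ℝ × ℝ) => f (q.1, q.2.1)) ((volume : Measure X).prod (ν.prod ν)) :=
  memLp_one_iff_integrable.1 (MemLp.time_fst (memLp_one_iff_integrable.2 hf))

lemma Integrable.time_snd {f : X × ℝ → ℝ} (hf : Integrable f ((volume : Measure X).prod ν)) :
    Integrable (fun q : X × (ℝ × ℝ) => f (q.1, q.2.2)) ((volume : Measure X).prod (ν.prod ν)) :=
  memLp_one_iff_integrable.1 (MemLp.time_snd (memLp_one_iff_integrable.2 hf))

end TwoTimes

/-- The integral of the positive part of `f(·,t) - g(·,t')`. -/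
def posDiff {X : Type*} [MeasureSpace X] (f g : X × ℝ → ℝ) (t t' : ℝ) : ℝ :=
  ∫ x, max (f (x, t) - g (x, t')) 0

/-! ### Positive parts of differences at two times. -/

section PosDiff

variable {X : Type*} [NormedAddCommGroup X] [NormedSpace ℝ X] [FiniteDimensional ℝ X]
  [MeasureSpace X] [BorelSpace X] [(volume : Measure X).IsAddHaarMeasure]

lemma posDiff_nonneg (f g : X × ℝ → ℝ) (t t' : ℝ) : 0 ≤ posDiff f g t t' :=
  integral_nonneg fun _ => le_max_right _ _

lemma Integrable.slab {f : X × ℝ → ℝ} (hf : Integrable f) (S : Set ℝ) :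
    Integrable f ((volume : Measure X).prod (volume.restrict S)) :=
  memLp_one_iff_integrable.1 (MemLp.slab (memLp_one_iff_integrable.2 hf) S)

lemma integrable_posDiff {f g : X × ℝ → ℝ} (hf : Integrable f) (hg : Integrable g) (T : ℝ) :
    Integrable (fun q : ℝ × ℝ => posDiff f g q.1 q.2)
      ((volume.restrict (Ioo 0 T)).prod (volume.restrict (Ioo 0 T))) :=
  (((Integrable.time_fst (Integrable.slab hf (Ioo 0 T))).sub
    (Integrable.time_snd (Integrable.slab hg (Ioo 0 T)))).pos_part).integral_prod_right

lemma integrable_posDiff_diag {f g : X × ℝ → ℝ} (hf : Integrable f) (hg : Integrable g) :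
    Integrable (fun t : ℝ => posDiff f g t t) :=
  (hf.sub hg).pos_part.integral_prod_right

/-- Mollification in the second time variable converges to the diagonal. -/
lemma exists_mollified_posDiff {f g : X × ℝ → ℝ} (hgm : Measurable g) (hf : Integrable f)
    (hg : Integrable g) {w : ℝ → ℝ} (hw : Continuous w) {C : ℝ} (hwC : ∀ t, |w t| ≤ C)
    {T₁ T : ℝ} (hT : T₁ < T) (hwT : ∀ t, T₁ ≤ t → w t = 0) {ε : ℝ} (hε : 0 < ε) :
    ∃ r > 0, ∀ η : ℝ → ℝ, Continuous η → (∀ σ, 0 ≤ η σ) → (∀ σ, η σ ≠ 0 → σ ∈ Ioo 0 r) →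
      ∫ σ, η σ = 1 →
      |(∫ t in Ioo 0 T, ∫ t' in Ioo 0 T, w t * η (t' - t) * posDiff f g t t')
        - ∫ t in Ioo 0 T, w t * posDiff f g t t| ≤ ε := by
  have hC0 : 0 ≤ C := (abs_nonneg _).trans (hwC 0)
  obtain ⟨r, hr, key⟩ := exists_lintegral_mollified_le hgm hg
    (ε := ENNReal.ofReal (ε / (C + 1))) (by simp only [ENNReal.ofReal_pos]; positivity)
  -- The bound `T - T₁` keeps the whole mass of `η (· - t)` inside `(0,T)` for `t < T₁`; for `t ≥
  -- T₁` the weight `w` vanishes.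
  refine ⟨min r (T - T₁), lt_min hr (by linarith), fun η hη hη0 hηs hη1 => ?_⟩
  have hηcs : HasCompactSupport η := HasCompactSupport.of_support_subset_isCompact
    (isCompact_Icc (a := 0) (b := r)) fun σ hσ =>
      ⟨(hηs σ hσ).1.le, ((hηs σ hσ).2.trans_le (min_le_left _ _)).le⟩
  have hηi : Integrable η := hη.integrable_of_hasCompactSupport hηcs
  obtain ⟨Cη, hCη⟩ := hηcs.exists_bound_of_continuous hη
  have hone : ∀ t ∈ Ioo 0 T, t < T₁ → ∫ t' in Ioo 0 T, η (t' - t) = 1 := fun t ht ht1 => by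
    rw [setIntegral_eq_integral_of_forall_compl_eq_zero, integral_sub_right_eq_self, hη1]
    intro t' ht'
    by_contra h
    have := hηs _ h
    exact ht' ⟨by linarith [this.1, ht.1], by linarith [this.2, min_le_right r (T - T₁)]⟩
  have hDi : Integrable (fun q : ℝ × ℝ => w q.1 * η (q.2 - q.1) * posDiff f g q.1 q.2)
      ((volume.restrict (Ioo 0 T)).prod (volume.restrict (Ioo 0 T))) := by
    refine (integrable_posDiff hf hg T).bdd_mul (c := C * Cη)
      (by fun_prop : Continuous fun q : ℝ × ℝ => w q.1 * η (q.2 - q.1)).aestronglyMeasurable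
      (ae_of_all _ fun q => ?_)
    rw [norm_mul]
    exact mul_le_mul (hwC _) (hCη _) (norm_nonneg _) hC0
  have hi2 : Integrable (fun t => w t * posDiff f g t t) (volume.restrict (Ioo 0 T)) :=
    ((integrable_posDiff_diag hf hg).integrableOn).bdd_mul hw.aestronglyMeasurable
      (ae_of_all _ hwC)
  rw [← integral_sub hDi.integral_prod_left hi2]
  have hslice : ∀ᵐ t, Integrable fun x => g (x, t) := hg.prod_left_ae
  have hslicef : ∀ᵐ t, Integrable fun x => f (x, t) := hf.prod_left_ae
  have hdiff : ∀ᵐ t ∂volume.restrict (Ioo 0 T), ‖(∫ t' in Ioo 0 T, w t * η (t' - t)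
      * posDiff f g t t') - w t * posDiff f g t t‖ₑ
      ≤ ENNReal.ofReal C * ∫⁻ t', ENNReal.ofReal (η (t' - t)) * ∫⁻ x, ‖g (x, t) - g (x, t')‖ₑ := by
    filter_upwards [ae_restrict_mem measurableSet_Ioo, ae_restrict_of_ae hslice,
      ae_restrict_of_ae hslicef, hDi.prod_right_ae] with t ht hgt hft hDt
    by_cases ht1 : T₁ ≤ t
    · simp [hwT t ht1]
    have ht1' := not_le.1 ht1
    have e1 : w t * posDiff f g t t
        = ∫ t' in Ioo 0 T, w t * η (t' - t) * posDiff f g t t := by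
      rw [integral_mul_const, integral_const_mul, hone t ht ht1', mul_one]
    have hηt : Integrable (fun t' => w t * η (t' - t) * posDiff f g t t)
        (volume.restrict (Ioo 0 T)) :=
      (((hηi.comp_sub_right t).integrableOn).const_mul _).mul_const _
    rw [e1, ← integral_sub hDt hηt]
    refine (enorm_integral_le_lintegral_enorm _).trans ?_
    rw [← lintegral_const_mul' _ _ ENNReal.ofReal_ne_top]
    refine (lintegral_mono_ae ?_).trans (setLIntegral_le_lintegral _ _)
    filter_upwards [ae_restrict_of_ae hslice] with t' hgt'
    rw [← mul_sub, enorm_mul, enorm_mul, mul_assoc]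
    have e2 : ‖w t‖ₑ ≤ ENNReal.ofReal C := by
      rw [← ofReal_norm]
      exact ENNReal.ofReal_le_ofReal (hwC t)
    have e3 : ‖η (t' - t)‖ₑ = ENNReal.ofReal (η (t' - t)) := by
      rw [← ofReal_norm, Real.norm_of_nonneg (hη0 _)]
    have e4 : ‖posDiff f g t t' - posDiff f g t t‖ₑ ≤ ∫⁻ x, ‖g (x, t) - g (x, t')‖ₑ := by
      have i1 : Integrable fun x => max (f (x, t) - g (x, t')) 0 := (hft.sub hgt').pos_part
      have i2 : Integrable fun x => max (f (x, t) - g (x, t)) 0 := (hft.sub hgt).pos_part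
      rw [posDiff, posDiff, ← integral_sub i1 i2]
      refine (enorm_integral_le_lintegral_enorm _).trans (lintegral_mono fun x => ?_)
      rw [enorm_le_iff_norm_le, Real.norm_eq_abs, Real.norm_eq_abs]
      refine (abs_max_sub_max_le_abs _ _ _).trans (le_of_eq ?_)
      congr 1
      ring
    rw [e3]
    gcongr
  rw [← Real.norm_eq_abs]
  have hfinal : ‖∫ t in Ioo 0 T, ((∫ t' in Ioo 0 T, w t * η (t' - t) * posDiff f g t t')
      - w t * posDiff f g t t)‖ₑ ≤ ENNReal.ofReal ε := by
    refine (enorm_integral_le_lintegral_enorm _).trans ((lintegral_mono_ae hdiff).trans ?_)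
    rw [lintegral_const_mul' _ _ ENNReal.ofReal_ne_top]
    have h1 := key (fun σ => ENNReal.ofReal (η σ)) (by fun_prop) (fun σ hσ => by
      have h2 := hηs σ (fun h => hσ (by simp [h]))
      exact ⟨h2.1, h2.2.trans_le (min_le_left _ _)⟩) (by
      rw [← ofReal_integral_eq_lintegral_ofReal hηi (ae_of_all _ hη0), hη1, ENNReal.ofReal_one])
    calc _ ≤ ENNReal.ofReal C * ENNReal.ofReal (ε / (C + 1)) := by
          gcongr
          exact (setLIntegral_le_lintegral _ _).trans h1
      _ = ENNReal.ofReal (C * (ε / (C + 1))) := (ENNReal.ofReal_mul hC0).symm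
      _ ≤ ENNReal.ofReal ε := by
          refine ENNReal.ofReal_le_ofReal ?_
          rw [mul_div_assoc', div_le_iff₀ (by linarith)]
          nlinarith
  rw [← ofReal_norm] at hfinal
  exact (ENNReal.ofReal_le_ofReal_iff hε.le).1 hfinal

end PosDiff

/-! ### Doubling of the time variable -/

lemma exists_lipschitzWith_smoothTransition : ∃ L, LipschitzWith L Real.smoothTransition := by
  have hs : ContDiff ℝ 1 Real.smoothTransition := Real.smoothTransition.contDiff (n := 1)
  have hd : ∀ t, t ∉ Icc (0 : ℝ) 1 → deriv Real.smoothTransition t = 0 := fun t ht => by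
    have hc : ∃ c, Real.smoothTransition =ᶠ[𝓝 t] fun _ => c := by
      rcases lt_or_ge t 0 with h | h
      · exact ⟨0, by filter_upwards [gt_mem_nhds h] with x hx using
          Real.smoothTransition.zero_of_nonpos (le_of_lt hx)⟩
      · have h1 : 1 < t := by
          by_contra hc
          exact ht ⟨h, not_lt.1 hc⟩
        exact ⟨1, by filter_upwards [lt_mem_nhds h1] with x hx using
          Real.smoothTransition.one_of_one_le (le_of_lt hx)⟩
    obtain ⟨c, hc⟩ := hc
    rw [hc.deriv_eq, deriv_const]
  obtain ⟨C, hC⟩ := (isCompact_Icc (a := (0 : ℝ)) (b := 1)).exists_bound_of_continuousOn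
    (hs.continuous_deriv le_rfl).continuousOn
  refine ⟨C.toNNReal, lipschitzWith_of_nnnorm_deriv_le (hs.differentiable (by simp)) fun t => ?_⟩
  rw [← NNReal.coe_le_coe, coe_nnnorm]
  refine le_trans ?_ (Real.le_coe_toNNReal C)
  by_cases ht : t ∈ Icc (0 : ℝ) 1
  · exact hC t ht
  · rw [hd t ht, norm_zero]
    exact (norm_nonneg _).trans (hC 0 (by simp))

lemma pairing_neg (s : ℝ) (aB : (E n × E n) × ℝ → ℝ) (aO : E n × ℝ → ℝ) (τ : ℝ) (ζ : E n → ℝ) :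
    pairing s aB aO τ (fun x => -ζ x) = -pairing s aB aO τ ζ := by
  have h : ∀ z, dq s (fun x => -ζ x) z = -dq s ζ z := fun z => by
    simp only [dq]
    ring
  simp only [pairing, h, mul_neg, integral_neg]
  ring

lemma integrable_of_memLp_of_support {Y : Type*} [MeasurableSpace Y] {μ : Measure Y} {f : Y → ℝ}
    (hf : MemLp f 2 μ) {S : Set Y} (hS : μ S ≠ ∞) (hfS : ∀ y ∉ S, f y = 0) : Integrable f μ := by
  have : IsFiniteMeasure (μ.restrict S) := ⟨by simpa using hS.lt_top⟩
  rw [← integrableOn_iff_integrable_of_support_subset (s := S) fun y hy => by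
    by_contra h
    exact hy (hfS y h)]
  exact (hf.restrict S).integrable (by norm_num)

lemma abs_integral_sub_le {Y : Type*} [MeasurableSpace Y] {μ : Measure Y} {f g : Y → ℝ}
    (hf : Integrable f μ) (hg : Integrable g μ) {S : Set Y} (hS : μ S ≠ ∞)
    {c : ℝ} (hc : ∀ y ∈ S, |f y - g y| ≤ c) (h0 : ∀ y ∉ S, f y = g y) :
    |∫ y, f y ∂μ - ∫ y, g y ∂μ| ≤ c * μ.real S := by
  rw [← integral_sub hf hg, ← setIntegral_eq_integral_of_forall_compl_eq_zero (s := S)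
    fun y hy => by rw [h0 y hy, sub_self], ← Real.norm_eq_abs]
  exact norm_setIntegral_le_of_norm_le_const hS.lt_top hc

section Doubling

variable {Ω : Set (E n)} {T s : ℝ} {ρ : E n → ℝ} {Φ : ℝ → ℝ} {v : E n × ℝ → ℝ} {v₀ : E n → ℝ}
  {aB : (E n × E n) × ℝ → ℝ} {aO : E n × ℝ → ℝ}

lemma IsEnergySolution.integrable (hv : IsEnergySolution Ω T s ρ Φ v v₀ aB aO)
    (hΩ : volume Ω ≠ ∞) : Integrable v := by
  refine integrable_of_memLp_of_support hv.memLp (S := Ω ×ˢ Ioo 0 T) ?_ fun q hq => ?_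
  · rw [Measure.volume_eq_prod, Measure.prod_prod]
    exact ENNReal.mul_ne_top hΩ (by simp)
  · refine hv.eq_zero q.1 q.2 ?_
    by_contra! h
    exact hq ⟨h.1, h.2⟩

lemma IsEnergySolution.integrable₀ (hv : IsEnergySolution Ω T s ρ Φ v v₀ aB aO)
    (hΩ : volume Ω ≠ ∞) : Integrable v₀ :=
  integrable_of_memLp_of_support hv.memLp₀ hΩ hv.eq_zero₀

/-- The entropy inequality with the initial value. -/
lemma IsEnergySolution.entropy_inequality_initial (hT : 0 < T)
    (hv : IsEnergySolution Ω T s ρ Φ v v₀ aB aO)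
    (hΦ : IsExpanding Φ) (hρm : Measurable ρ) {R : ℝ} (hρ : ∀ x, 0 ≤ ρ x ∧ ρ x ≤ R)
    {P : ℝ → ℝ} {L : ℝ≥0} (hP : ContDiff ℝ (⊤ : ℕ∞) P) (hPL : LipschitzWith L P)
    (hPm : Monotone P) (hP0 : P 0 = 0) {k : E n → ℝ} (hkm : Measurable k) (hk : MemLp k 2 volume)
    (hΦk : MemLp (fun x => Φ (k x)) 2 volume) (hkt : MemHsTilde Ω s (fun x => Φ (k x)))
    {θ : ℝ → ℝ} (hθ : ContDiff ℝ (⊤ : ℕ∞) θ) (hθc : HasCompactSupport θ)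
    (hθs : tsupport θ ⊆ Iio T) (hθ0 : ∀ t, 0 ≤ θ t) :
    ∫ t in Ioo 0 T, -deriv θ t * ∫ x, ρ x * entropy Φ P (v (x, t)) (k x)
      ≤ θ 0 * (∫ x, ρ x * entropy Φ P (v₀ x) (k x))
        - ∫ t in Ioo 0 T, θ t * pairing s aB aO t (fun x => P (Φ (v (x, t)) - Φ (k x))) := by
  have h1 := hv.entropy_inequality hΦ hρm hρ hP hPL hPm hP0 hkm hk hΦk hkt hθ hθc hθs hθ0
  have hθd : Continuous (deriv θ) := hθ.continuous_deriv (by simp)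
  obtain ⟨C, hC⟩ := hθc.deriv.exists_bound_of_continuous hθd
  have e1 : Integrable (fun q : E n × ℝ => ρ q.1 * entropy Φ P (v q) (k q.1))
      ((volume : Measure (E n)).prod (volume.restrict (Ioo 0 T))) :=
    Integrable.density_mul (hρm.comp measurable_fst) (fun q => hρ q.1)
      (integrable_entropy hΦ hPL hPm hP0 hv.measurable (hkm.comp measurable_fst)
        (MemLp.slab hv.memLp _) (hk.comp_fst _) (MemLp.slab hv.memLp_Phi _) (hΦk.comp_fst _))
  have e0 : Integrable (fun x => ρ x * entropy Φ P (v₀ x) (k x)) :=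
    Integrable.density_mul hρm hρ (integrable_entropy (μ := volume) hΦ hPL hPm hP0 hv.measurable₀
      hkm hv.memLp₀ hk hv.memLp_Phi₀ hΦk)
  have hcongr : ∫ t in Ioo 0 T, -deriv θ t *
        ∫ x, ρ x * (entropy Φ P (v (x, t)) (k x) - entropy Φ P (v₀ x) (k x))
      = ∫ t in Ioo 0 T, (-deriv θ t * (∫ x, ρ x * entropy Φ P (v (x, t)) (k x))
        - -deriv θ t * ∫ x, ρ x * entropy Φ P (v₀ x) (k x)) := by
    refine integral_congr_ae ?_
    filter_upwards [e1.prod_left_ae] with t ht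
    rw [← mul_sub, ← integral_sub ht e0]
    simp_rw [mul_sub]
  have i1 : Integrable (fun t => -deriv θ t * (∫ x, ρ x * entropy Φ P (v (x, t)) (k x)))
      (volume.restrict (Ioo 0 T)) :=
    e1.integral_prod_right.bdd_mul hθd.neg.aestronglyMeasurable (c := C)
      (ae_of_all _ fun t => by rw [norm_neg]; exact hC t)
  have i2 : Integrable (fun t => -deriv θ t) (volume.restrict (Ioo 0 T)) :=
    (hθd.neg.integrableOn_Icc (a := 0) (b := T)).mono_set Ioo_subset_Icc_self
  have i3 : ∫ t in Ioo 0 T, -deriv θ t = θ 0 := by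
    rw [← integral_Ioc_eq_integral_Ioo, ← intervalIntegral.integral_of_le hT.le,
      intervalIntegral.integral_neg, intervalIntegral.integral_deriv_eq_sub
        (fun t _ => (hθ.differentiable (by simp)) t) (hθd.intervalIntegrable _ _)]
    have : θ T = 0 := image_eq_zero_of_notMem_tsupport fun h => lt_irrefl T (hθs h)
    rw [this]
    ring
  rw [hcongr, integral_sub i1 (i2.mul_const _), integral_mul_const, i3] at h1
  linarith

end Doubling

section Doubling

variable {Ω : Set (E n)} {T s : ℝ} {ρ : E n → ℝ} {Φ : ℝ → ℝ} {v v₁ v₂ : E n × ℝ → ℝ}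
  {v₀ v₁₀ v₂₀ : E n → ℝ} {aB aB₁ aB₂ : (E n × E n) × ℝ → ℝ} {aO aO₁ aO₂ : E n × ℝ → ℝ}

lemma IsEnergySolution.ae_slice (hv : IsEnergySolution Ω T s ρ Φ v v₀ aB aO)
    (hΦ : Continuous Φ) : ∀ᵐ t ∂volume.restrict (Ioo 0 T),
      MemLp (fun x => v (x, t)) 2 volume ∧ MemLp (fun x => Φ (v (x, t))) 2 volume ∧
      MemHsTilde Ω s (fun x => Φ (v (x, t))) := by
  filter_upwards [ae_restrict_of_ae (MemLp.slice hv.memLp hv.measurable),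
    ae_restrict_of_ae (MemLp.slice hv.memLp_Phi (hΦ.measurable.comp hv.measurable)),
    ae_restrict_of_ae hv.memHsTilde, ae_restrict_mem measurableSet_Ioo] with t h1 h2 h3 h4
  exact ⟨h1, h2, h3 h4⟩

lemma integrable_flux_two_times (hv : IsEnergySolution Ω T s ρ Φ v v₀ aB aO)
    (h₁ : IsEnergySolution Ω T s ρ Φ v₁ v₁₀ aB₁ aO₁)
    (h₂ : IsEnergySolution Ω T s ρ Φ v₂ v₂₀ aB₂ aO₂) (hΦ : Continuous Φ)
    {P : ℝ → ℝ} {L : ℝ≥0} (hPL : LipschitzWith L P) (hP0 : P 0 = 0) {τ : ℝ × ℝ → ℝ}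
    (hτ : τ = Prod.fst ∨ τ = Prod.snd) :
    Integrable (fun q : (E n × E n) × (ℝ × ℝ) => aB (q.1, τ q.2)
        * dq s (fun x => P (Φ (v₁ (x, q.2.1)) - Φ (v₂ (x, q.2.2)))) q.1)
        ((volume : Measure (E n × E n)).prod
          ((volume.restrict (Ioo 0 T)).prod (volume.restrict (Ioo 0 T)))) ∧
      Integrable (fun q : E n × (ℝ × ℝ) => aO (q.1, τ q.2)
        * P (Φ (v₁ (q.1, q.2.1)) - Φ (v₂ (q.1, q.2.2))))
        ((volume : Measure (E n)).prod
          ((volume.restrict (Ioo 0 T)).prod (volume.restrict (Ioo 0 T)))) := by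
  have hΦm := hΦ.measurable
  have hPm := hPL.continuous.measurable
  have hm1 := h₁.measurable
  have hm2 := h₂.measurable
  have hL0 : (0 : ℝ) ≤ L := L.2
  have hB : MemLp (fun q : (E n × E n) × (ℝ × ℝ) => aB (q.1, τ q.2)) 2
      ((volume : Measure (E n × E n)).prod
        ((volume.restrict (Ioo 0 T)).prod (volume.restrict (Ioo 0 T)))) := by
    rcases hτ with rfl | rfl
    · exact MemLp.time_fst (MemLp.slab hv.memLp_aB _)
    · exact MemLp.time_snd (MemLp.slab hv.memLp_aB _)
  have hO : MemLp (fun q : E n × (ℝ × ℝ) => aO (q.1, τ q.2)) 2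
      ((volume : Measure (E n)).prod
        ((volume.restrict (Ioo 0 T)).prod (volume.restrict (Ioo 0 T)))) := by
    rcases hτ with rfl | rfl
    · exact MemLp.time_fst (MemLp.slab hv.memLp_aO _)
    · exact MemLp.time_snd (MemLp.slab hv.memLp_aO _)
  have gB : MemLp (fun q : (E n × E n) × (ℝ × ℝ) =>
      dq s (fun x => P (Φ (v₁ (x, q.2.1)) - Φ (v₂ (x, q.2.2)))) q.1) 2
      ((volume : Measure (E n × E n)).prod
        ((volume.restrict (Ioo 0 T)).prod (volume.restrict (Ioo 0 T)))) := by
    have a1 := MemLp.time_fst (MemLp.slab h₁.memLp_dq (Ioo 0 T))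
    have a2 := MemLp.time_snd (MemLp.slab h₂.memLp_dq (Ioo 0 T))
    refine ((a1.norm.add a2.norm).const_mul (L : ℝ)).mono' (Measurable.aestronglyMeasurable ?_)
      (ae_of_all _ fun q => abs_dq_comp_le hPL s _ _ _)
    unfold dq
    fun_prop
  have gO : MemLp (fun q : E n × (ℝ × ℝ) => P (Φ (v₁ (q.1, q.2.1)) - Φ (v₂ (q.1, q.2.2)))) 2
      ((volume : Measure (E n)).prod
        ((volume.restrict (Ioo 0 T)).prod (volume.restrict (Ioo 0 T)))) := by
    have a1 := MemLp.time_fst (MemLp.slab h₁.memLp_Phi (Ioo 0 T))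
    have a2 := MemLp.time_snd (MemLp.slab h₂.memLp_Phi (Ioo 0 T))
    refine ((a1.norm.add a2.norm).const_mul (L : ℝ)).mono' (Measurable.aestronglyMeasurable ?_)
      (ae_of_all _ fun q => abs_comp_le hPL hP0 _ _)
    fun_prop
  exact ⟨hB.integrable_mul gB, hO.integrable_mul gO⟩

lemma integrable_pairing_two_times (hv : IsEnergySolution Ω T s ρ Φ v v₀ aB aO)
    (h₁ : IsEnergySolution Ω T s ρ Φ v₁ v₁₀ aB₁ aO₁)
    (h₂ : IsEnergySolution Ω T s ρ Φ v₂ v₂₀ aB₂ aO₂) (hΦ : Continuous Φ)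
    {P : ℝ → ℝ} {L : ℝ≥0} (hPL : LipschitzWith L P) (hP0 : P 0 = 0) {τ : ℝ × ℝ → ℝ}
    (hτ : τ = Prod.fst ∨ τ = Prod.snd) :
    Integrable (fun q : ℝ × ℝ => pairing s aB aO (τ q)
      (fun x => P (Φ (v₁ (x, q.1)) - Φ (v₂ (x, q.2)))))
      ((volume.restrict (Ioo 0 T)).prod (volume.restrict (Ioo 0 T))) :=
  have h := integrable_flux_two_times hv h₁ h₂ hΦ hPL hP0 hτ
  h.1.integral_prod_right.add h.2.integral_prod_right

lemma integrable_entropy_two_times (hv : IsEnergySolution Ω T s ρ Φ v v₀ aB aO)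
    (h₂ : IsEnergySolution Ω T s ρ Φ v₂ v₂₀ aB₂ aO₂) (hΦ : IsExpanding Φ) (hρm : Measurable ρ)
    {R : ℝ} (hρ : ∀ x, 0 ≤ ρ x ∧ ρ x ≤ R) {P : ℝ → ℝ} {L : ℝ≥0} (hPL : LipschitzWith L P)
    (hPm : Monotone P) (hP0 : P 0 = 0) :
    Integrable (fun q : E n × (ℝ × ℝ) => ρ q.1 * entropy Φ P (v (q.1, q.2.1)) (v₂ (q.1, q.2.2)))
      ((volume : Measure (E n)).prod
        ((volume.restrict (Ioo 0 T)).prod (volume.restrict (Ioo 0 T)))) := by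
  have hm1 := hv.measurable
  have hm2 := h₂.measurable
  exact Integrable.density_mul (hρm.comp measurable_fst) (fun q => hρ q.1)
    (integrable_entropy hΦ hPL hPm hP0
      (f := fun q : E n × (ℝ × ℝ) => v (q.1, q.2.1)) (k := fun q => v₂ (q.1, q.2.2))
      (by fun_prop) (by fun_prop)
      (MemLp.time_fst (MemLp.slab hv.memLp (Ioo 0 T)))
      (MemLp.time_snd (MemLp.slab h₂.memLp (Ioo 0 T)))
      (MemLp.time_fst (MemLp.slab hv.memLp_Phi (Ioo 0 T)))
      (MemLp.time_snd (MemLp.slab h₂.memLp_Phi (Ioo 0 T))))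

/-- Doubling of the time variable with a fixed approximation of the Heaviside function. -/
lemma doubling_entropy (hT : 0 < T)
    (h₁ : IsEnergySolution Ω T s ρ Φ v₁ v₁₀ aB₁ aO₁)
    (h₂ : IsEnergySolution Ω T s ρ Φ v₂ v₂₀ aB₂ aO₂) (hΦ : IsExpanding Φ) (hρm : Measurable ρ)
    {R : ℝ} (hρ : ∀ x, 0 ≤ ρ x ∧ ρ x ≤ R)
    {P : ℝ → ℝ} {L : ℝ≥0} (hP : ContDiff ℝ (⊤ : ℕ∞) P) (hPL : LipschitzWith L P)
    (hPm : Monotone P) (hP0 : P 0 = 0)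
    {Q : ℝ → ℝ → ℝ} (hQi : Integrable (fun q : ℝ × ℝ => Q q.1 q.2)
      ((volume.restrict (Ioo 0 T)).prod (volume.restrict (Ioo 0 T))))
    (hQ : ∀ᵐ q : ℝ × ℝ ∂((volume.restrict (Ioo 0 T)).prod (volume.restrict (Ioo 0 T))),
      pairing s aB₂ aO₂ q.2 (fun x => P (Φ (v₁ (x, q.1)) - Φ (v₂ (x, q.2))))
        - pairing s aB₁ aO₁ q.1 (fun x => P (Φ (v₁ (x, q.1)) - Φ (v₂ (x, q.2)))) ≤ Q q.1 q.2)
    {θ η : ℝ → ℝ} (hθ : ContDiff ℝ (⊤ : ℕ∞) θ) (hθc : HasCompactSupport θ) (hθ0 : ∀ t, 0 ≤ θ t)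
    (hη : ContDiff ℝ (⊤ : ℕ∞) η) (hηc : HasCompactSupport η) (hη0 : ∀ t, 0 ≤ η t)
    {T₁ r : ℝ} (hTr : T₁ + r < T) (hθs : ∀ t, T₁ < t → θ t = 0)
    (hηs : ∀ t, t ∉ Ioo 0 r → η t = 0) :
    ∫ q : ℝ × ℝ, (-(deriv θ q.1 * η (q.2 - q.1) - θ q.1 * deriv η (q.2 - q.1))
          * (∫ x, ρ x * entropy Φ P (v₁ (x, q.1)) (v₂ (x, q.2)))
        - θ q.1 * deriv η (q.2 - q.1)
          * (∫ x, ρ x * entropy Φ (fun t => -P (-t)) (v₂ (x, q.2)) (v₁ (x, q.1))))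
        ∂((volume.restrict (Ioo 0 T)).prod (volume.restrict (Ioo 0 T)))
      ≤ (∫ t' in Ioo 0 T, θ 0 * η t' * ∫ x, ρ x * entropy Φ P (v₁₀ x) (v₂ (x, t')))
        + ∫ q : ℝ × ℝ, θ q.1 * η (q.2 - q.1) * Q q.1 q.2
          ∂((volume.restrict (Ioo 0 T)).prod (volume.restrict (Ioo 0 T))) := by
  set ν : Measure ℝ := volume.restrict (Ioo 0 T) with hν
  have hθd : Continuous (deriv θ) := hθ.continuous_deriv (by simp)
  have hηd : Continuous (deriv η) := hη.continuous_deriv (by simp)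
  have hθC := hθ.continuous
  have hηC := hη.continuous
  obtain ⟨Cθ, hCθ⟩ := hθc.exists_bound_of_continuous hθC
  obtain ⟨Cη, hCη⟩ := hηc.exists_bound_of_continuous hηC
  obtain ⟨Dθ, hDθ⟩ := hθc.deriv.exists_bound_of_continuous hθd
  obtain ⟨Dη, hDη⟩ := hηc.deriv.exists_bound_of_continuous hηd
  have hCθ0 := (norm_nonneg _).trans (hCθ 0)
  have hDθ0 := (norm_nonneg _).trans (hDθ 0)
  -- Since `P' (Φ v₂ - Φ v₁) = -P (Φ v₁ - Φ v₂)`, the inequality for `v₂` is tested with the same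
  -- function as that for `v₁`, up to sign.
  set P' : ℝ → ℝ := fun t => -P (-t) with hP'
  have hP'd : ContDiff ℝ (⊤ : ℕ∞) P' := (hP.comp contDiff_neg).neg
  have hP'L : LipschitzWith L P' := by
    refine LipschitzWith.of_dist_le_mul fun x y => ?_
    have := hPL.dist_le_mul (-x) (-y)
    simpa [hP', dist_neg_neg] using this
  have hP'm : Monotone P' := fun x y hxy => neg_le_neg (hPm (neg_le_neg hxy))
  have hP'0 : P' 0 = 0 := by simp [hP', hP0]
  set N₁ : ℝ × ℝ → ℝ := fun q =>
    pairing s aB₁ aO₁ q.1 (fun x => P (Φ (v₁ (x, q.1)) - Φ (v₂ (x, q.2)))) with hN₁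
  set N₂ : ℝ × ℝ → ℝ := fun q =>
    pairing s aB₂ aO₂ q.2 (fun x => P (Φ (v₁ (x, q.1)) - Φ (v₂ (x, q.2)))) with hN₂
  set J₁ : ℝ × ℝ → ℝ := fun q => ∫ x, ρ x * entropy Φ P (v₁ (x, q.1)) (v₂ (x, q.2)) with hJ₁
  set J₂ : ℝ × ℝ → ℝ := fun q => ∫ x, ρ x * entropy Φ P' (v₂ (x, q.2)) (v₁ (x, q.1)) with hJ₂
  have iN₁ : Integrable N₁ (ν.prod ν) := integrable_pairing_two_times h₁ h₁ h₂ hΦ.continuous hPL hP0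
    (Or.inl rfl)
  have iN₂ : Integrable N₂ (ν.prod ν) := integrable_pairing_two_times h₂ h₁ h₂ hΦ.continuous hPL hP0
    (Or.inr rfl)
  have iJ₁ : Integrable J₁ (ν.prod ν) :=
    (integrable_entropy_two_times h₁ h₂ hΦ hρm hρ hPL hPm hP0).integral_prod_right
  have iJ₂ : Integrable J₂ (ν.prod ν) :=
    ((integrable_entropy_two_times h₂ h₁ hΦ hρm hρ hP'L hP'm hP'0).integral_prod_right).swap
  have hw : ∀ {f g : ℝ → ℝ} {C D : ℝ}, Continuous f → Continuous g → (∀ t, ‖f t‖ ≤ C) →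
      (∀ t, ‖g t‖ ≤ D) → ∀ {F : ℝ × ℝ → ℝ}, Integrable F (ν.prod ν) →
      Integrable (fun q => f q.1 * g (q.2 - q.1) * F q) (ν.prod ν) := by
    intro f g C D hf hg hC hD F hF
    refine hF.bdd_mul (c := C * D)
      (by fun_prop : Continuous fun q : ℝ × ℝ => f q.1 * g (q.2 - q.1)).aestronglyMeasurable
      (ae_of_all _ fun q => ?_)
    rw [norm_mul]
    exact mul_le_mul (hC _) (hD _) (norm_nonneg _) ((norm_nonneg _).trans (hC 0))
  have w1 := hw hθd hηC hDθ hCη iJ₁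
  have w2 := hw hθC hηd hCθ hDη iJ₁
  have w3 := hw hθC hηd hCθ hDη iJ₂
  have w4 := hw hθC hηC hCθ hCη iN₁
  have w5 := hw hθC hηC hCθ hCη iN₂
  have w6 := hw hθC hηC hCθ hCη hQi
  -- Here `t'` is frozen, `k = v₂ (·, t')`, and the weight `t ↦ θ t * η (t' - t)` is supported in `t
  -- ≤ t' < T`.
  have ineq₁ : ∀ᵐ t' ∂ν, ∫ t, (-(deriv θ t * η (t' - t) - θ t * deriv η (t' - t)) * J₁ (t, t')
      + θ t * η (t' - t) * N₁ (t, t')) ∂ν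
      ≤ θ 0 * η t' * ∫ x, ρ x * entropy Φ P (v₁₀ x) (v₂ (x, t')) := by
    filter_upwards [h₂.ae_slice hΦ.continuous, w4.prod_left_ae, w1.prod_left_ae,
      w2.prod_left_ae, ae_restrict_mem measurableSet_Ioo] with t' ht' b4 b1 b2 htT
    have hξ : ContDiff ℝ (⊤ : ℕ∞) (fun t => θ t * η (t' - t)) :=
      hθ.mul (hη.comp (contDiff_const.sub contDiff_id))
    have hdξ : ∀ t, deriv (fun t => θ t * η (t' - t)) t
        = deriv θ t * η (t' - t) - θ t * deriv η (t' - t) := fun t => by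
      have d1 : HasDerivAt θ (deriv θ t) t := ((hθ.differentiable (by simp)) t).hasDerivAt
      have d2 : HasDerivAt η (deriv η (t' - t)) (t' - t) :=
        ((hη.differentiable (by simp)) _).hasDerivAt
      have d3 := d1.mul (d2.comp_const_sub t' t)
      rw [HasDerivAt.deriv (f := fun t => θ t * η (t' - t)) d3]
      ring
    have hs : tsupport (fun t => θ t * η (t' - t)) ⊆ Iio T := by
      have : tsupport (fun t => θ t * η (t' - t)) ⊆ Iic t' := by
        refine closure_minimal (fun t ht => ?_) isClosed_Iic
        by_contra hc
        refine ht ?_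
        simp only
        rw [hηs (t' - t) (fun h => hc (by rw [mem_Iic]; linarith [h.1])), mul_zero]
      exact this.trans fun t ht => lt_of_le_of_lt ht htT.2
    have key := h₁.entropy_inequality_initial hT hΦ hρm hρ hP hPL hPm hP0
      (h₂.measurable.comp (measurable_prodMk_right (y := t'))) ht'.1 ht'.2.1 ht'.2.2 hξ
      (hθc.mul_right) hs (fun t => mul_nonneg (hθ0 t) (hη0 _))
    simp only [hdξ, sub_zero, Function.comp_apply] at key
    have b3 : Integrable (fun t => -(deriv θ t * η (t' - t) - θ t * deriv η (t' - t))
        * J₁ (t, t')) ν := (b2.sub b1).congr (ae_of_all _ fun t => by simp only [Pi.sub_apply]; ring)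
    rw [integral_add b3 b4]
    linarith
  -- Here `t` is frozen, `k = v₁ (·, t)`, and the weight in `t'` is supported in `[t, T₁ + r]`,
  -- hence before `T`.
  have ineq₂ : ∀ᵐ t ∂ν, ∫ t', (-(θ t * deriv η (t' - t)) * J₂ (t, t')
      - θ t * η (t' - t) * N₂ (t, t')) ∂ν ≤ 0 := by
    filter_upwards [h₁.ae_slice hΦ.continuous, w5.prod_right_ae, w3.prod_right_ae,
      ae_restrict_mem measurableSet_Ioo] with t ht b5 b3 htT
    have hξ : ContDiff ℝ (⊤ : ℕ∞) (fun t' => θ t * η (t' - t)) :=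
      contDiff_const.mul (hη.comp (contDiff_id.sub contDiff_const))
    have hdξ : ∀ t', deriv (fun t' => θ t * η (t' - t)) t' = θ t * deriv η (t' - t) := fun t' => by
      have d2 : HasDerivAt η (deriv η (t' - t)) (t' - t) :=
        ((hη.differentiable (by simp)) _).hasDerivAt
      exact ((d2.comp_sub_const t' t).const_mul (θ t)).deriv
    have hsI : tsupport (fun t' => θ t * η (t' - t)) ⊆ Icc t (T₁ + r) := by
      refine closure_minimal (fun t' ht' => ?_) isClosed_Icc
      by_contra hc
      refine ht' ?_
      simp only
      by_cases h1 : T₁ < t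
      · rw [hθs t h1, zero_mul]
      · rw [hηs (t' - t) (fun h => hc ⟨by linarith [h.1], by linarith [h.2]⟩), mul_zero]
    have hcs : HasCompactSupport (fun t' => θ t * η (t' - t)) :=
      HasCompactSupport.of_support_subset_isCompact isCompact_Icc ((subset_tsupport _).trans hsI)
    have key := h₂.entropy_inequality_initial hT hΦ hρm hρ hP'd hP'L hP'm hP'0
      (h₁.measurable.comp (measurable_prodMk_right (y := t))) ht.1 ht.2.1 ht.2.2 hξ
      hcs (hsI.trans fun t' ht' => lt_of_le_of_lt ht'.2 hTr)
      (fun t => mul_nonneg (hθ0 _) (hη0 _))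
    -- The mollifier lives on `t' > t > 0`, so the weight vanishes at `t' = 0` and no initial term
    -- for `v₂` appears.
    have hη00 : η (-t) = 0 := hηs _ fun h => by linarith [h.1, htT.1]
    have hpair : ∀ t', pairing s aB₂ aO₂ t' (fun x => P' (Φ (v₂ (x, t')) - Φ (v₁ (x, t))))
        = -N₂ (t, t') := fun t' => by
      rw [hN₂]
      simp only
      rw [← pairing_neg]
      simp only [hP', neg_sub]
    simp only [hdξ, hη00, mul_zero, zero_mul, Function.comp_apply, hpair, mul_neg,
      integral_neg, zero_sub, neg_neg] at key
    have b3' : Integrable (fun t' => -(θ t * deriv η (t' - t)) * J₂ (t, t')) ν :=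
      b3.neg.congr (ae_of_all _ fun t => by simp only [Pi.neg_apply]; ring)
    rw [integral_sub b3' b5]
    linarith
  have f1 : Integrable (fun q : ℝ × ℝ => -(deriv θ q.1 * η (q.2 - q.1)
      - θ q.1 * deriv η (q.2 - q.1)) * J₁ q) (ν.prod ν) :=
    (w2.sub w1).congr (ae_of_all _ fun t => by simp only [Pi.sub_apply]; ring)
  have f2 : Integrable (fun q : ℝ × ℝ => -(θ q.1 * deriv η (q.2 - q.1)) * J₂ q) (ν.prod ν) :=
    w3.neg.congr (ae_of_all _ fun t => by simp only [Pi.neg_apply]; ring)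
  have iJ₀ : Integrable (fun t' => θ 0 * η t' * ∫ x, ρ x * entropy Φ P (v₁₀ x) (v₂ (x, t'))) ν := by
    have hm1 := h₁.measurable₀
    have hm2 := h₂.measurable
    have a1 : Integrable (fun q : E n × ℝ => ρ q.1 * entropy Φ P (v₁₀ q.1) (v₂ q))
        ((volume : Measure (E n)).prod ν) :=
      Integrable.density_mul (hρm.comp measurable_fst) (fun q => hρ q.1)
        (integrable_entropy hΦ hPL hPm hP0 (f := fun q : E n × ℝ => v₁₀ q.1)
          (by fun_prop) hm2 (h₁.memLp₀.comp_fst _) (MemLp.slab h₂.memLp _)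
          (h₁.memLp_Phi₀.comp_fst _) (MemLp.slab h₂.memLp_Phi _))
    refine a1.integral_prod_right.bdd_mul (c := Cθ * Cη)
      (by fun_prop : Continuous fun t' => θ 0 * η t').aestronglyMeasurable
      (ae_of_all _ fun t => ?_)
    rw [norm_mul]
    exact mul_le_mul (hCθ _) (hCη _) (norm_nonneg _) hCθ0
  have s1 : ∫ q, (-(deriv θ q.1 * η (q.2 - q.1) - θ q.1 * deriv η (q.2 - q.1)) * J₁ q
      + θ q.1 * η (q.2 - q.1) * N₁ q) ∂(ν.prod ν)
      ≤ ∫ t', θ 0 * η t' * (∫ x, ρ x * entropy Φ P (v₁₀ x) (v₂ (x, t'))) ∂ν := by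
    have f3 : Integrable (fun q : ℝ × ℝ => -(deriv θ q.1 * η (q.2 - q.1)
      - θ q.1 * deriv η (q.2 - q.1)) * J₁ q + θ q.1 * η (q.2 - q.1) * N₁ q) (ν.prod ν) := f1.add w4
    rw [integral_prod_symm _ f3]
    exact integral_mono_ae f3.integral_prod_right iJ₀ ineq₁
  have s2 : ∫ q, (-(θ q.1 * deriv η (q.2 - q.1)) * J₂ q - θ q.1 * η (q.2 - q.1) * N₂ q)
      ∂(ν.prod ν) ≤ 0 := by
    have f4 : Integrable (fun q : ℝ × ℝ => -(θ q.1 * deriv η (q.2 - q.1)) * J₂ q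
      - θ q.1 * η (q.2 - q.1) * N₂ q) (ν.prod ν) := f2.sub w5
    rw [integral_prod _ f4]
    exact integral_nonpos_of_ae ineq₂
  have s3 : ∫ q, (θ q.1 * η (q.2 - q.1) * N₂ q - θ q.1 * η (q.2 - q.1) * N₁ q) ∂(ν.prod ν)
      ≤ ∫ q, θ q.1 * η (q.2 - q.1) * Q q.1 q.2 ∂(ν.prod ν) := by
    refine integral_mono_ae (w5.sub w4) w6 ?_
    filter_upwards [hQ] with q hq
    rw [← mul_sub]
    exact mul_le_mul_of_nonneg_left hq (mul_nonneg (hθ0 _) (hη0 _))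
  rw [integral_add f1 w4] at s1
  rw [integral_sub f2 w5] at s2
  rw [integral_sub w5 w4] at s3
  have e : ∫ q : ℝ × ℝ, (-(deriv θ q.1 * η (q.2 - q.1) - θ q.1 * deriv η (q.2 - q.1)) * J₁ q
      - θ q.1 * deriv η (q.2 - q.1) * J₂ q) ∂(ν.prod ν)
      = (∫ q, -(deriv θ q.1 * η (q.2 - q.1) - θ q.1 * deriv η (q.2 - q.1)) * J₁ q ∂(ν.prod ν))
        + ∫ q, -(θ q.1 * deriv η (q.2 - q.1)) * J₂ q ∂(ν.prod ν) := by
    rw [← integral_add f1 f2]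
    congr 1
    funext q
    ring
  rw [e]
  linarith

end Doubling

section Doubling

variable {Ω : Set (E n)} {T s : ℝ} {ρ : E n → ℝ} {Φ : ℝ → ℝ} {v v₁ v₂ : E n × ℝ → ℝ}
  {v₀ v₁₀ v₂₀ : E n → ℝ} {aB aB₁ aB₂ : (E n × E n) × ℝ → ℝ} {aO aO₁ aO₂ : E n × ℝ → ℝ}

/-- Smooth approximations of the Heaviside function. -/
structure IsHeavisideApprox (P : ℝ → ℝ) : Prop where
  contDiff : ContDiff ℝ (⊤ : ℕ∞) P
  lipschitz : ∃ L, LipschitzWith L P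
  monotone : Monotone P
  eq_zero : ∀ t ≤ 0, P t = 0
  le_one : ∀ t, P t ≤ 1

lemma IsHeavisideApprox.nonneg {P : ℝ → ℝ} (hP : IsHeavisideApprox P) (t : ℝ) : 0 ≤ P t := by
  rcases le_total t 0 with h | h
  · exact (hP.eq_zero t h).ge
  · exact (hP.eq_zero 0 le_rfl).ge.trans (hP.monotone h)

lemma exists_isHeavisideApprox {δ : ℝ} (hδ : 0 < δ) :
    ∃ P, IsHeavisideApprox P ∧ ∀ t, δ ≤ t → P t = 1 := by
  obtain ⟨L, hL⟩ := exists_lipschitzWith_smoothTransition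
  refine ⟨fun t => Real.smoothTransition (δ⁻¹ * t),
    ⟨Real.smoothTransition.contDiff.comp (contDiff_const.mul contDiff_id), ⟨_, hL.comp
      (LipschitzWith.of_dist_le_mul (K := ‖δ⁻¹‖₊) fun x y => ?_)⟩,
      fun x y hxy => Real.smoothTransition.monotone
        (mul_le_mul_of_nonneg_left hxy (inv_nonneg.2 hδ.le)),
      fun t ht => Real.smoothTransition.zero_of_nonpos
        (mul_nonpos_of_nonneg_of_nonpos (inv_nonneg.2 hδ.le) ht),
      fun t => Real.smoothTransition.le_one _⟩,
    fun t ht => Real.smoothTransition.one_of_one_le ?_⟩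
  · rw [dist_eq_norm, dist_eq_norm, ← mul_sub, norm_mul, coe_nnnorm]
  · rw [inv_mul_eq_div, le_div_iff₀ hδ]
    linarith

/-- Doubling of the time variable. -/
lemma doubling (hT : 0 < T) (hΩ : volume Ω ≠ ∞)
    (h₁ : IsEnergySolution Ω T s ρ Φ v₁ v₁₀ aB₁ aO₁)
    (h₂ : IsEnergySolution Ω T s ρ Φ v₂ v₂₀ aB₂ aO₂) (hΦ : IsExpanding Φ) (hρm : Measurable ρ)
    {R : ℝ} (hρ : ∀ x, 0 ≤ ρ x ∧ ρ x ≤ R)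
    {Q : ℝ → ℝ → ℝ} (hQi : Integrable (fun q : ℝ × ℝ => Q q.1 q.2)
      ((volume.restrict (Ioo 0 T)).prod (volume.restrict (Ioo 0 T))))
    (hQ : ∀ P, IsHeavisideApprox P →
      ∀ᵐ q : ℝ × ℝ ∂((volume.restrict (Ioo 0 T)).prod (volume.restrict (Ioo 0 T))),
      pairing s aB₂ aO₂ q.2 (fun x => P (Φ (v₁ (x, q.1)) - Φ (v₂ (x, q.2))))
        - pairing s aB₁ aO₁ q.1 (fun x => P (Φ (v₁ (x, q.1)) - Φ (v₂ (x, q.2)))) ≤ Q q.1 q.2)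
    {θ η : ℝ → ℝ} (hθ : ContDiff ℝ (⊤ : ℕ∞) θ) (hθc : HasCompactSupport θ) (hθ0 : ∀ t, 0 ≤ θ t)
    (hη : ContDiff ℝ (⊤ : ℕ∞) η) (hηc : HasCompactSupport η) (hη0 : ∀ t, 0 ≤ η t)
    {T₁ r : ℝ} (hTr : T₁ + r < T) (hθs : ∀ t, T₁ < t → θ t = 0)
    (hηs : ∀ t, t ∉ Ioo 0 r → η t = 0) :
    ∫ q : ℝ × ℝ, -deriv θ q.1 * η (q.2 - q.1)
          * posDiff (fun p => ρ p.1 * v₁ p) (fun p => ρ p.1 * v₂ p) q.1 q.2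
        ∂((volume.restrict (Ioo 0 T)).prod (volume.restrict (Ioo 0 T)))
      ≤ (∫ t' in Ioo 0 T, θ 0 * η t' * ∫ x, ρ x * max (v₁₀ x - v₂ (x, t')) 0)
        + ∫ q : ℝ × ℝ, θ q.1 * η (q.2 - q.1) * Q q.1 q.2
          ∂((volume.restrict (Ioo 0 T)).prod (volume.restrict (Ioo 0 T))) := by
  set ν : Measure ℝ := volume.restrict (Ioo 0 T) with hν
  have hR0 : 0 ≤ R := (hρ 0).1.trans (hρ 0).2
  have hθd : Continuous (deriv θ) := hθ.continuous_deriv (by simp)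
  have hηd : Continuous (deriv η) := hη.continuous_deriv (by simp)
  have hθC := hθ.continuous
  have hηC := hη.continuous
  obtain ⟨Cθ, hCθ⟩ := hθc.exists_bound_of_continuous hθC
  obtain ⟨Cη, hCη⟩ := hηc.exists_bound_of_continuous hηC
  obtain ⟨Dθ, hDθ⟩ := hθc.deriv.exists_bound_of_continuous hθd
  obtain ⟨Dη, hDη⟩ := hηc.deriv.exists_bound_of_continuous hηd
  have hCθ0 := (norm_nonneg _).trans (hCθ 0)
  have hCη0 := (norm_nonneg _).trans (hCη 0)
  have hDθ0 := (norm_nonneg _).trans (hDθ 0)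
  have hDη0 := (norm_nonneg _).trans (hDη 0)
  have hw : ∀ {f g : ℝ → ℝ} {C D : ℝ}, Continuous f → Continuous g → (∀ t, ‖f t‖ ≤ C) →
      (∀ t, ‖g t‖ ≤ D) → ∀ {F : ℝ × ℝ → ℝ}, Integrable F (ν.prod ν) →
      Integrable (fun q => f q.1 * g (q.2 - q.1) * F q) (ν.prod ν) := by
    intro f g C D hf hg hC hD F hF
    refine hF.bdd_mul (c := C * D)
      (by fun_prop : Continuous fun q : ℝ × ℝ => f q.1 * g (q.2 - q.1)).aestronglyMeasurable
      (ae_of_all _ fun q => ?_)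
    rw [norm_mul]
    exact mul_le_mul (hC _) (hD _) (norm_nonneg _) ((norm_nonneg _).trans (hC 0))
  have i₁ : Integrable (fun p : E n × ℝ => ρ p.1 * v₁ p) :=
    Integrable.density_mul (hρm.comp measurable_fst) (fun q => hρ q.1) (h₁.integrable hΩ)
  have i₂ : Integrable (fun p : E n × ℝ => ρ p.1 * v₂ p) :=
    Integrable.density_mul (hρm.comp measurable_fst) (fun q => hρ q.1) (h₂.integrable hΩ)
  have hpos : ∀ x a b, max (ρ x * a - ρ x * b) 0 = ρ x * max (a - b) 0 := fun x a b => by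
    rw [← mul_sub, mul_max_of_nonneg _ _ (hρ x).1, mul_zero]
  have iJ := integrable_posDiff i₁ i₂ T
  set J : ℝ × ℝ → ℝ := fun q =>
    posDiff (fun p => ρ p.1 * v₁ p) (fun p => ρ p.1 * v₂ p) q.1 q.2 with hJ
  have iJs : ∀ᵐ q : ℝ × ℝ ∂(ν.prod ν),
      Integrable fun x => max (ρ x * v₁ (x, q.1) - ρ x * v₂ (x, q.2)) 0 :=
    (((Integrable.time_fst (Integrable.slab i₁ (Ioo 0 T))).sub
      (Integrable.time_snd (Integrable.slab i₂ (Ioo 0 T)))).pos_part).prod_left_ae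
  -- Error per unit of `ε` when both entropies are replaced by the positive part: one term carries
  -- `θ' η`, and two carry `θ η'`, one for each entropy.
  set K : ℝ := (Dθ * Cη + 2 * (Cθ * Dη)) * (R * volume.real Ω) with hK
  have hK0 : 0 ≤ K := by positivity
  set A : ℝ := ∫ q : ℝ × ℝ, -deriv θ q.1 * η (q.2 - q.1) * J q ∂(ν.prod ν) with hA
  have hνν : (ν.prod ν).real univ = T * T := by
    rw [measureReal_def, ← univ_prod_univ, Measure.prod_prod, hν]
    simp [ENNReal.toReal_mul, hT.le]
  refine le_of_forall_pos_le_add fun e he => ?_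
  -- The errors integrate to at most `K * ε * T²`; the summand `1` avoids division by zero.
  set ε : ℝ := e / (K * (T * T) + 1) with hε
  have hε0 : 0 < ε := by positivity
  obtain ⟨d, hd0, hd⟩ := hΦ.expanding ε hε0
  obtain ⟨P, hP, hPd⟩ := exists_isHeavisideApprox hd0
  obtain ⟨L, hPL⟩ := hP.lipschitz
  have hz := hP.eq_zero 0 le_rfl
  set P' : ℝ → ℝ := fun t => -P (-t) with hP'
  have hP'L : LipschitzWith L P' := by
    refine LipschitzWith.of_dist_le_mul fun x y => ?_
    have := hPL.dist_le_mul (-x) (-y)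
    simpa [hP', dist_neg_neg] using this
  have hP'm : Monotone P' := fun x y hxy => neg_le_neg (hP.monotone (neg_le_neg hxy))
  have hP'0 : P' 0 = 0 := by simp [hP', hz]
  have key := doubling_entropy hT h₁ h₂ hΦ hρm hρ hP.contDiff hPL hP.monotone hz hQi (hQ P hP)
    hθ hθc hθ0 hη hηc hη0 hTr hθs hηs
  have E₁ := integrable_entropy_two_times h₁ h₂ hΦ hρm hρ hPL hP.monotone hz
  have E₂ := integrable_entropy_two_times h₂ h₁ hΦ hρm hρ hP'L hP'm hP'0
  have E₂s : ∀ᵐ q : ℝ × ℝ ∂(ν.prod ν),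
      Integrable fun x => ρ x * entropy Φ P' (v₂ (x, q.2)) (v₁ (x, q.1)) :=
    (Measure.measurePreserving_swap (μ := ν) (ν := ν)).quasiMeasurePreserving.ae E₂.prod_left_ae
  set J₁ : ℝ × ℝ → ℝ := fun q => ∫ x, ρ x * entropy Φ P (v₁ (x, q.1)) (v₂ (x, q.2)) with hJ₁
  set J₂ : ℝ × ℝ → ℝ := fun q => ∫ x, ρ x * entropy Φ P' (v₂ (x, q.2)) (v₁ (x, q.1)) with hJ₂
  have iJ₁ : Integrable J₁ (ν.prod ν) := E₁.integral_prod_right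
  have iJ₂ : Integrable J₂ (ν.prod ν) := E₂.integral_prod_right.swap
  -- Both entropies are within `ε` of the same positive part, uniformly on `Ω`, and agree with it
  -- off `Ω`, where both solutions vanish.
  have hclose : ∀ᵐ q ∂(ν.prod ν), |J₁ q - J q| ≤ R * ε * volume.real Ω ∧
      |J₂ q - J q| ≤ R * ε * volume.real Ω := by
    filter_upwards [iJs, E₁.prod_left_ae, E₂s] with q a1 a2 a3
    have hscale : ∀ x a, |a| ≤ ε → |ρ x * a| ≤ R * ε := fun x a ha => by
      rw [abs_mul, abs_of_nonneg (hρ x).1]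
      exact mul_le_mul (hρ x).2 ha (abs_nonneg _) hR0
    constructor
    · refine abs_integral_sub_le a2 a1 hΩ (fun x _ => ?_) (fun x hx => ?_)
      · simp only [hpos]
        rw [← mul_sub]
        obtain ⟨u1, u2⟩ := entropy_heaviside hΦ hPL.continuous hP.monotone hP.eq_zero hP.le_one hε0 hd hPd
          (v₁ (x, q.1)) (v₂ (x, q.2))
        exact hscale x _ (abs_le.2 ⟨by linarith, by linarith⟩)
      · simp [h₁.eq_zero x q.1 (Or.inl hx), h₂.eq_zero x q.2 (Or.inl hx), entropy_self]
    · refine abs_integral_sub_le a3 a1 hΩ (fun x _ => ?_) (fun x hx => ?_)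
      · simp only [hpos]
        rw [← mul_sub]
        obtain ⟨u1, u2⟩ := entropy_reflect hΦ hPL.continuous hP.monotone hP.eq_zero hP.le_one hε0 hd hPd
          (v₂ (x, q.2)) (v₁ (x, q.1))
        exact hscale x _ (abs_le.2 ⟨by linarith, by linarith⟩)
      · simp [h₁.eq_zero x q.1 (Or.inl hx), h₂.eq_zero x q.2 (Or.inl hx), entropy_self]
  have w0 := hw (f := fun t => -deriv θ t) hθd.neg hηC (fun t => by rw [norm_neg]; exact hDθ t) hCη iJ
  have w1 := hw hθd hηC hDθ hCη iJ₁
  have w2 := hw hθC hηd hCθ hDη iJ₁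
  have w3 := hw hθC hηd hCθ hDη iJ₂
  have f1 : Integrable (fun q : ℝ × ℝ => -(deriv θ q.1 * η (q.2 - q.1)
      - θ q.1 * deriv η (q.2 - q.1)) * J₁ q - θ q.1 * deriv η (q.2 - q.1) * J₂ q) (ν.prod ν) :=
    ((w2.sub w1).sub w3).congr (ae_of_all _ fun t => by simp only [Pi.sub_apply]; ring)
  -- If `J₁` and `J₂` were both equal to `J`, the terms with `η'` would cancel exactly; `hclose`
  -- bounds the defect.
  have hlow : A ≤ (∫ q : ℝ × ℝ, (-(deriv θ q.1 * η (q.2 - q.1)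
      - θ q.1 * deriv η (q.2 - q.1)) * J₁ q - θ q.1 * deriv η (q.2 - q.1) * J₂ q) ∂(ν.prod ν))
      + K * ε * (T * T) := by
    have hc : ∫ _q : ℝ × ℝ, K * ε ∂(ν.prod ν) = K * ε * (T * T) := by
      rw [integral_const, hνν, smul_eq_mul, mul_comm]
    rw [← hc, ← integral_add f1 (integrable_const _)]
    refine integral_mono_ae w0 (f1.add (integrable_const _)) ?_
    filter_upwards [hclose] with q hq
    have b1 : |deriv θ q.1 * η (q.2 - q.1)| ≤ Dθ * Cη := by
      rw [abs_mul]
      exact mul_le_mul (hDθ _) (hCη _) (abs_nonneg _) hDθ0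
    have b2 : |θ q.1 * deriv η (q.2 - q.1)| ≤ Cθ * Dη := by
      rw [abs_mul]
      exact mul_le_mul (hCθ _) (hDη _) (abs_nonneg _) hCθ0
    set a := deriv θ q.1 * η (q.2 - q.1) with ha
    set b := θ q.1 * deriv η (q.2 - q.1) with hb
    have hr0 : 0 ≤ R * ε * volume.real Ω := by positivity
    have c1 := (le_abs_self _).trans ((abs_mul a (J₁ q - J q)).le.trans
      (mul_le_mul b1 hq.1 (abs_nonneg _) (by positivity)))
    have c2 := (le_abs_self _).trans ((abs_mul (-b) (J₁ q - J q)).le.trans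
      (mul_le_mul ((abs_neg b).le.trans b2) hq.1 (abs_nonneg _) (by positivity)))
    have c3 := (le_abs_self _).trans ((abs_mul b (J₂ q - J q)).le.trans
      (mul_le_mul b2 hq.2 (abs_nonneg _) (by positivity)))
    have e1 : -deriv θ q.1 * η (q.2 - q.1) * J q = -(a * J q) := by rw [ha]; ring
    have e2 : K * ε = (Dθ * Cη) * (R * ε * volume.real Ω) + (Cθ * Dη) * (R * ε * volume.real Ω)
        + (Cθ * Dη) * (R * ε * volume.real Ω) := by rw [hK]; ring
    rw [e1, e2]
    linarith
  have hinit : ∫ t' in Ioo 0 T, θ 0 * η t' * (∫ x, ρ x * entropy Φ P (v₁₀ x) (v₂ (x, t')))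
      ≤ ∫ t' in Ioo 0 T, θ 0 * η t' * ∫ x, ρ x * max (v₁₀ x - v₂ (x, t')) 0 := by
    have hm1 := h₁.measurable₀
    have hm2 := h₂.measurable
    have a1 : Integrable (fun q : E n × ℝ => ρ q.1 * entropy Φ P (v₁₀ q.1) (v₂ q))
        ((volume : Measure (E n)).prod ν) :=
      Integrable.density_mul (hρm.comp measurable_fst) (fun q => hρ q.1)
        (integrable_entropy hΦ hPL hP.monotone hz (f := fun q : E n × ℝ => v₁₀ q.1)
          (by fun_prop) hm2 (h₁.memLp₀.comp_fst _) (MemLp.slab h₂.memLp _)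
          (h₁.memLp_Phi₀.comp_fst _) (MemLp.slab h₂.memLp_Phi _))
    have a2 : Integrable (fun q : E n × ℝ => ρ q.1 * max (v₁₀ q.1 - v₂ q) 0)
        ((volume : Measure (E n)).prod ν) :=
      Integrable.density_mul (hρm.comp measurable_fst) (fun q => hρ q.1)
        (((h₁.integrable₀ hΩ).comp_fst ν).sub (Integrable.slab (h₂.integrable hΩ) _)).pos_part
    have hb : ∀ t, ‖θ 0 * η t‖ ≤ Cθ * Cη := fun t => by
      rw [norm_mul]
      exact mul_le_mul (hCθ _) (hCη _) (norm_nonneg _) hCθ0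
    have hcm : AEStronglyMeasurable (fun t => θ 0 * η t) ν :=
      (by fun_prop : Continuous fun t' => θ 0 * η t').aestronglyMeasurable
    refine integral_mono_ae (a1.integral_prod_right.bdd_mul hcm (ae_of_all _ hb))
      (a2.integral_prod_right.bdd_mul hcm (ae_of_all _ hb)) ?_
    filter_upwards [a1.prod_left_ae, a2.prod_left_ae] with t' b1 b2
    refine mul_le_mul_of_nonneg_left (integral_mono b1 b2 fun x => ?_)
      (mul_nonneg (hθ0 _) (hη0 _))
    exact mul_le_mul_of_nonneg_left (entropy_heaviside hΦ hPL.continuous hP.monotone hP.eq_zero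
      hP.le_one hε0 hd hPd _ _).2 (hρ x).1
  have hsmall : K * ε * (T * T) ≤ e := by
    rw [hε, mul_div_assoc', div_mul_eq_mul_div, div_le_iff₀ (by positivity)]
    nlinarith
  linarith

end Doubling

/-- A Weierstrass polynomial minus its value at zero, which costs the second `ε / 2`, multiplied by
a bump equal to one on `[-M, M]` to make it bounded and globally Lipschitz. -/
lemma exists_smooth_approx {f : ℝ → ℝ} (hf : Continuous f) (hf0 : f 0 = 0) {M ε : ℝ} (hM : 0 ≤ M)
    (hε : 0 < ε) : ∃ Q : ℝ → ℝ, ContDiff ℝ (⊤ : ℕ∞) Q ∧ (∃ L, LipschitzWith L Q) ∧ Q 0 = 0 ∧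
      (∃ C, ∀ t, |Q t| ≤ C) ∧ ∀ t, |t| ≤ M → |Q t - f t| ≤ ε := by
  obtain ⟨p, hp⟩ := exists_polynomial_near_of_continuousOn (-M) M f hf.continuousOn (ε / 2)
    (half_pos hε)
  let χ : ContDiffBump (0 : ℝ) := ⟨M + 1, M + 2, by linarith, by linarith⟩
  have hQ : ContDiff ℝ (⊤ : ℕ∞) fun t => χ t * (p.eval t - p.eval 0) :=
    χ.contDiff.mul ((by simpa using p.contDiff_aeval (𝕜 := ℝ) (⊤ : ℕ∞) :
      ContDiff ℝ (⊤ : ℕ∞) fun t => p.eval t).sub contDiff_const)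
  have hQc : HasCompactSupport fun t => χ t * (p.eval t - p.eval 0) :=
    χ.hasCompactSupport.mul_right
  refine ⟨_, hQ, hQ.lipschitzWith_of_hasCompactSupport (𝕂 := ℝ) hQc (by simp), by simp,
    hQc.exists_bound_of_continuous hQ.continuous, fun t ht => ?_⟩
  have h1 : χ t = 1 := χ.one_of_mem_closedBall (by
    rw [mem_closedBall_zero_iff, Real.norm_eq_abs]
    exact ht.trans (by simp [χ]))
  have h2 := abs_lt.1 (hp t (abs_le.1 ht))
  have h3 := abs_lt.1 (hp 0 ⟨by linarith, hM⟩)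
  simp only [h1, one_mul]
  rw [hf0] at h3
  exact abs_le.2 ⟨by linarith, by linarith⟩

/-! ### Attainment of the initial value. -/

section InitialTrace

variable {Ω : Set (E n)} {T s : ℝ} {ρ : E n → ℝ} {Φ : ℝ → ℝ} {v : E n × ℝ → ℝ}
  {v₀ : E n → ℝ} {aB : (E n × E n) × ℝ → ℝ} {aO : E n × ℝ → ℝ}

lemma IsEnergySolution.integrable_pairing_sub (hv : IsEnergySolution Ω T s ρ Φ v v₀ aB aO)
    (hΦ : Continuous Φ) {g : E n → ℝ} (hg : MemHs s g) :
    Integrable (fun t => pairing s aB aO t (fun x => Φ (v (x, t)) - g x))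
      (volume.restrict (Ioo 0 T)) := by
  have hΦm := hΦ.measurable
  have hm1 := hv.measurable
  obtain ⟨g1, g2⟩ := memHs_iff.1 hg
  have gB : MemLp (fun q : (E n × E n) × ℝ => dq s (fun x => Φ (v (x, q.2)) - g x) q.1) 2
      ((volume : Measure (E n × E n)).prod (volume.restrict (Ioo 0 T))) := by
    have := (MemLp.slab hv.memLp_dq (Ioo 0 T)).sub (g2.comp_fst (volume.restrict (Ioo 0 T)))
    refine this.ae_eq (ae_of_all _ fun q => ?_)
    simp only [dq, Pi.sub_apply]
    ring
  have gO : MemLp (fun q : E n × ℝ => Φ (v q) - g q.1) 2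
      ((volume : Measure (E n)).prod (volume.restrict (Ioo 0 T))) :=
    (MemLp.slab hv.memLp_Phi (Ioo 0 T)).sub (g1.comp_fst (volume.restrict (Ioo 0 T)))
  exact ((MemLp.slab hv.memLp_aB _).integrable_mul gB).integral_prod_right.add
    ((MemLp.slab hv.memLp_aO _).integrable_mul gO).integral_prod_right

lemma exists_setIntegral_Ioo_le {f : ℝ → ℝ} {T : ℝ} (hT : 0 < T) (hf : IntegrableOn f (Ioo 0 T))
    {ε : ℝ} (hε : 0 < ε) :
    ∃ r > 0, r ≤ T ∧ ∫ t in Ioo 0 r, f t ≤ ε := by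
  have hi : Integrable ((Ioo 0 T).indicator f) := hf.integrable_indicator measurableSet_Ioo
  have hc := intervalIntegral.continuous_primitive (fun a b => hi.intervalIntegrable (a := a)
    (b := b)) 0
  have h0 := hc.tendsto 0
  rw [intervalIntegral.integral_same] at h0
  obtain ⟨δ, hδ, h⟩ := Metric.eventually_nhds_iff.1 (h0.eventually (gt_mem_nhds hε))
  set r := min (δ / 2) T with hr
  have hr0 : 0 < r := lt_min (half_pos hδ) hT
  have hrδ : r < δ := (min_le_left _ _).trans_lt (half_lt_self hδ)
  refine ⟨r, hr0, min_le_right _ _, ?_⟩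
  have h1 := h (y := r) (by rw [dist_zero_right, Real.norm_eq_abs, abs_of_pos hr0]; exact hrδ)
  rw [intervalIntegral.integral_of_le hr0.le, integral_Ioc_eq_integral_Ioo] at h1
  rw [setIntegral_congr_fun (g := (Ioo 0 T).indicator f) measurableSet_Ioo fun t ht => ?_]
  · exact h1.le
  · have htT : t ∈ Ioo 0 T := ⟨ht.1, ht.2.trans_le (min_le_right _ _)⟩
    rw [indicator_of_mem htT]

/-- Energy solutions attain bounded initial values of `H̃^s` in `L¹`, in the mean. -/
lemma IsEnergySolution.initial_trace (hT : 0 < T) (hΩm : MeasurableSet Ω) (hΩ : volume Ω ≠ ∞)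
    (hv : IsEnergySolution Ω T s ρ Φ v v₀ aB aO) (hΦ : IsExpanding Φ) (hρm : Measurable ρ) {R : ℝ}
    (hρ : ∀ x, 0 ≤ ρ x ∧ ρ x ≤ R) {b : ℝ → ℝ} (hbm : Measurable b) (hb : ∀ t, Φ (b t) = t)
    {M : ℝ} (hM : ∀ x, |v₀ x| ≤ M) (h₀ : MemHsTilde Ω s v₀) {ε : ℝ} (hε : 0 < ε) :
    ∃ r₀ > 0, ∀ η : ℝ → ℝ, ContDiff ℝ (⊤ : ℕ∞) η → HasCompactSupport η → (∀ t, 0 ≤ η t) →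
      tsupport η ⊆ Ioo 0 r₀ → ∫ t, η t = 1 →
      ∫ t in Ioo 0 T, η t * ∫ x, ρ x * |v (x, t) - v₀ x| ≤ ε := by
  have hM0 : 0 ≤ M := (abs_nonneg _).trans (hM 0)
  have hR0 : 0 ≤ R := (hρ 0).1.trans (hρ 0).2
  set V := volume.real Ω with hV
  have hV0 : 0 ≤ V := measureReal_nonneg
  -- Budget for the final bound: the excess `2 R ε₁ |Ω|` costs at most `ε / 2`, the flux over `(0,
  -- r₀)` costs `ε / 4`, and the entropy of `v₀` relative to `k`, which enters twice, costs `ε / 8`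
  -- each time.
  set ε₁ := ε / (4 * (R * V + 1)) with hε₁
  have hε₁0 : 0 < ε₁ := by positivity
  obtain ⟨d, hd0, hd⟩ := hΦ.expanding ε₁ hε₁0
  obtain ⟨B, hB⟩ := (isCompact_Icc (a := -M) (b := M)).exists_bound_of_continuousOn
    hΦ.continuous.continuousOn
  have hB0 := (norm_nonneg _).trans (hB 0 ⟨by linarith, hM0⟩)
  -- A bound for `|v₀ - k|`: by the growth condition `|k| ≤ 1 + |Φ k|`, and `|Φ k| ≤ |Φ v₀| + 1 ≤ B
  -- + 1`, because `ε₂ ≤ 1`.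
  set D := M + (1 + (B + 1)) with hD
  have hD0 : 0 < D := by positivity
  set ε₂ := min 1 (ε * d / (8 * (R * D * V + 1))) with hε₂
  have hε₂0 : 0 < ε₂ := lt_min one_pos (by positivity)
  obtain ⟨Q, hQ, ⟨L, hQL⟩, hQ0, ⟨CQ, hCQ⟩, hQΦ⟩ := exists_smooth_approx hΦ.continuous hΦ.zero hM0 hε₂0
  have hQm := hQL.continuous.measurable
  have hvm₀ := hv.measurable₀
  -- The smooth surrogate `Q ∘ v₀` of `Φ ∘ v₀` lies in `H̃^s`. Therefore `k = b ∘ κ`, for which `Φ ∘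
  -- k = κ`, is an admissible frozen state with small entropy distance from `v₀`.
  set κ : E n → ℝ := fun x => Q (v₀ x) with hκ
  have hκt : MemHsTilde Ω s κ := h₀.comp_smooth hQ hQL hQ0
  have hκm : Measurable κ := by fun_prop
  set k : E n → ℝ := fun x => b (κ x) with hk
  have hkm : Measurable k := hbm.comp hκm
  have hΦk : ∀ x, Φ (k x) = κ x := fun x => hb _
  have hb0 : b 0 = 0 := hΦ.strictMono.injective (by rw [hb, hΦ.zero])
  have hk0 : ∀ x ∉ Ω, k x = 0 := fun x hx => by simp [hk, hκ, hv.eq_zero₀ x hx, hQ0, hb0]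
  have hk2 : MemLp k 2 volume := by
    refine MemLp.mono' (g := fun x => Ω.indicator (fun _ => 1 + CQ) x)
      (memLp_indicator_const 2 hΩm _ (Or.inr hΩ)) hkm.aestronglyMeasurable
      (ae_of_all _ fun x => ?_)
    by_cases hx : x ∈ Ω
    · rw [indicator_of_mem hx]
      refine (hΦ.growth _).trans ?_
      rw [hΦk]
      linarith [hCQ (v₀ x)]
    · rw [indicator_of_notMem hx, hk0 x hx, norm_zero]
  have hΦk' : (fun x => Φ (k x)) = κ := funext hΦk
  -- Absolute continuity of the integral. The choice of `r₀` serves every `η`, since the primitives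
  -- satisfy `0 ≤ θ ≤ 1` on `t ≥ 0` and vanish after `r₀`.
  obtain ⟨r₀, hr₀, hr₀T, hrF⟩ := exists_setIntegral_Ioo_le hT
    (hv.integrable_pairing_sub hΦ.continuous hκt.1).norm
    (show 0 < ε * d / 4 by positivity)
  refine ⟨r₀, hr₀, fun η hη hηc hη0 hηs hη1 => ?_⟩
  obtain ⟨θ, hθ, hθc, hθs, hθd, hθi, hθ0⟩ := exists_smooth_primitive hη hηc hr₀ hηs
  have hm := hΦ.strictMono.monotone
  have hηz : ∀ t ∉ Ioo 0 r₀, η t = 0 := fun t ht =>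
    image_eq_zero_of_notMem_tsupport fun h => ht (hηs h)
  have hηi : Integrable η := hη.continuous.integrable_of_hasCompactSupport hηc
  have hηzT : ∀ t ∉ Ioo 0 T, η t = 0 := fun t ht =>
    hηz t fun h => ht ⟨h.1, h.2.trans_le hr₀T⟩
  have hη1T : ∫ t in Ioo 0 T, η t = 1 := by
    rw [setIntegral_eq_integral_of_forall_compl_eq_zero hηzT, hη1]
  have hθle : ∀ t ≥ 0, θ t ≤ 1 := fun t ht => by
    rw [hθi t ht]
    rcases le_total t r₀ with h | h
    · rw [intervalIntegral.integral_of_le h, ← hη1]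
      exact setIntegral_le_integral hηi (ae_of_all _ hη0)
    · rw [intervalIntegral.integral_of_ge h]
      have : 0 ≤ ∫ τ in Ioc r₀ t, η τ := integral_nonneg hη0
      linarith
  have hθz : ∀ t, r₀ ≤ t → θ t = 0 := fun t ht =>
    image_eq_zero_of_notMem_tsupport fun h => (hθs h).not_ge ht
  have e0 : Integrable (fun x => ρ x * entropy Φ id (v₀ x) (k x)) :=
    Integrable.density_mul hρm hρ (integrable_entropy (μ := volume) hΦ LipschitzWith.id monotone_id
      rfl hvm₀ hkm hv.memLp₀ hk2 hv.memLp_Phi₀ (by rw [hΦk']; exact (memHs_iff.1 hκt.1).1))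
  have e1 : Integrable (fun q : E n × ℝ => ρ q.1 * entropy Φ id (v q) (k q.1))
      ((volume : Measure (E n)).prod (volume.restrict (Ioo 0 T))) :=
    Integrable.density_mul (hρm.comp measurable_fst) (fun q => hρ q.1)
      (integrable_entropy hΦ LipschitzWith.id monotone_id rfl hv.measurable
        (hkm.comp measurable_fst) (MemLp.slab hv.memLp _) (hk2.comp_fst _)
        (MemLp.slab hv.memLp_Phi _)
        (by simp only [hΦk]; exact (memHs_iff.1 hκt.1).1.comp_fst _))
  have e2 : Integrable (fun q : E n × ℝ => ρ q.1 * |v q - v₀ q.1|)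
      ((volume : Measure (E n)).prod (volume.restrict (Ioo 0 T))) :=
    Integrable.density_mul (hρm.comp measurable_fst) (fun q => hρ q.1)
      (((Integrable.slab (hv.integrable hΩ) _).sub ((hv.integrable₀ hΩ).comp_fst _)).abs)
  have hsmall : ∫ x, ρ x * entropy Φ id (v₀ x) (k x) ≤ R * D * ε₂ * V := by
    have h := abs_integral_sub_le (g := fun _ => 0) e0 (by simp) hΩ (c := R * D * ε₂)
      (fun x _ => ?_) (fun x hx => by simp [hv.eq_zero₀ x hx, hk0 x hx, entropy_self])
    · rw [integral_zero, sub_zero] at h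
      exact (le_abs_self _).trans h
    have h0 := entropy_nonneg hΦ.continuous hm continuous_id monotone_id rfl (v₀ x) (k x)
    have h1 := entropy_le hΦ.continuous hm LipschitzWith.id monotone_id rfl (v₀ x) (k x)
    have h2 : |Φ (v₀ x) - Φ (k x)| ≤ ε₂ := by
      rw [hΦk, abs_sub_comm]
      exact hQΦ _ (hM x)
    have h3 : |v₀ x - k x| ≤ D := by
      have c1 := hM x
      have c2 := hΦ.growth (k x)
      have c3 := hB (v₀ x) (abs_le.1 (hM x))
      have c4 : |Φ (k x)| ≤ |Φ (v₀ x)| + 1 := by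
        have := abs_sub_abs_le_abs_sub (Φ (k x)) (Φ (v₀ x))
        rw [abs_sub_comm] at this
        linarith [min_le_left 1 (ε * d / (8 * (R * D * V + 1)))]
      rw [Real.norm_eq_abs] at c3
      linarith [abs_sub (v₀ x) (k x)]
    rw [sub_zero, abs_of_nonneg (mul_nonneg (hρ x).1 h0), mul_assoc]
    refine mul_le_mul (hρ x).2 (h1.trans ?_) h0 hR0
    rw [NNReal.coe_one, one_mul]
    exact mul_le_mul h3 h2 (abs_nonneg _) hD0.le
  have hent := hv.entropy_inequality_initial hT hΦ hρm hρ contDiff_id LipschitzWith.id monotone_id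
    rfl hkm hk2 (by rw [hΦk']; exact (memHs_iff.1 hκt.1).1) (by rw [hΦk']; exact hκt) hθ hθc
    (hθs.trans (Iio_subset_Iio hr₀T)) (hθ0 hη0)
  set p : ℝ → ℝ := fun t => pairing s aB aO t (fun x => Φ (v (x, t)) - κ x) with hp
  set S₀ := ∫ x, ρ x * entropy Φ id (v₀ x) (k x) with hS₀
  set J : ℝ → ℝ := fun t => ∫ x, ρ x * entropy Φ id (v (x, t)) (k x) with hJ
  have hleft : ∫ t in Ioo 0 T, -deriv θ t * J t = ∫ t in Ioo 0 T, η t * J t :=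
    setIntegral_congr_fun measurableSet_Ioo fun t ht => by
      simp only [hθd t ht.1.le, neg_neg]
  have hflux : -∫ t in Ioo 0 T, θ t * p t ≤ ε * d / 4 := by
    rw [setIntegral_eq_of_subset_of_forall_sdiff_eq_zero (s := Ioo 0 r₀) measurableSet_Ioo
      (Ioo_subset_Ioo_right hr₀T) fun t ht => by
        rw [hθz t (not_lt.1 fun h => ht.2 ⟨ht.1.1, h⟩), zero_mul]]
    refine (neg_le_abs _).trans (le_trans ?_ hrF)
    rw [← Real.norm_eq_abs]
    refine norm_integral_le_of_norm_le (((hv.integrable_pairing_sub hΦ.continuous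
      hκt.1).norm).mono_measure (Measure.restrict_mono (Ioo_subset_Ioo_right hr₀T) le_rfl)) ?_
    filter_upwards [ae_restrict_mem measurableSet_Ioo] with t ht
    rw [norm_mul, Real.norm_eq_abs, abs_of_nonneg (hθ0 hη0 t)]
    exact mul_le_of_le_one_left (norm_nonneg _) (hθle t ht.1.le)
  have hent' : ∫ t in Ioo 0 T, η t * J t ≤ S₀ + ε * d / 4 := by
    have hS0 : 0 ≤ S₀ := integral_nonneg fun x => mul_nonneg (hρ x).1
      (entropy_nonneg hΦ.continuous hm continuous_id monotone_id rfl _ _)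
    have := mul_le_of_le_one_left hS0 (hθle 0 le_rfl)
    simp only [id, hΦk] at hent
    rw [← hleft]
    linarith
  obtain ⟨Cη, hCη⟩ := hηc.exists_bound_of_continuous hη.continuous
  have hηm : AEStronglyMeasurable η (volume.restrict (Ioo 0 T)) :=
    hη.continuous.aestronglyMeasurable
  set c := d⁻¹ * S₀ + 2 * (R * ε₁ * V) with hc
  have iJ : Integrable (fun t => η t * J t) (volume.restrict (Ioo 0 T)) :=
    e1.integral_prod_right.bdd_mul hηm (ae_of_all _ hCη)
  have hfin : ∫ t in Ioo 0 T, η t * ∫ x, ρ x * |v (x, t) - v₀ x|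
      ≤ ∫ t in Ioo 0 T, (d⁻¹ * (η t * J t) + η t * c) := by
    refine integral_mono_ae (e2.integral_prod_right.bdd_mul hηm (ae_of_all _ hCη))
      ((iJ.const_mul _).add (hηi.restrict.mul_const _)) ?_
    filter_upwards [e1.prod_left_ae, e2.prod_left_ae] with t t1 t2
    have hind : Integrable (Ω.indicator fun _ : E n => 2 * (R * ε₁)) volume :=
      (integrable_indicator_iff hΩm).2 (integrableOn_const hΩ)
    have i3 : Integrable fun x => d⁻¹ * (ρ x * entropy Φ id (v (x, t)) (k x))
        + d⁻¹ * (ρ x * entropy Φ id (v₀ x) (k x)) := (t1.const_mul _).add (e0.const_mul _)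
    -- The triangle inequality through `k`, with each distance bounded by `abs_sub_le_entropy`.
    have h1 : ∫ x, ρ x * |v (x, t) - v₀ x| ≤ ∫ x, ((d⁻¹ * (ρ x * entropy Φ id (v (x, t)) (k x))
        + d⁻¹ * (ρ x * entropy Φ id (v₀ x) (k x))) + Ω.indicator (fun _ => 2 * (R * ε₁)) x) := by
      refine integral_mono t2 (i3.add hind) fun x => ?_
      by_cases hx : x ∈ Ω
      · have c1 := abs_sub_le_entropy hΦ hd0 hd (v (x, t)) (k x)
        have c2 := abs_sub_le_entropy hΦ hd0 hd (v₀ x) (k x)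
        have c3 := abs_sub_le (v (x, t)) (k x) (v₀ x)
        rw [abs_sub_comm (k x)] at c3
        have c4 : |v (x, t) - v₀ x| ≤ d⁻¹ * entropy Φ id (v (x, t)) (k x)
          + d⁻¹ * entropy Φ id (v₀ x) (k x) + 2 * ε₁ := by linarith
        have c5 := mul_le_mul_of_nonneg_left c4 (hρ x).1
        have c6 := mul_le_mul_of_nonneg_right (hρ x).2 (show 0 ≤ 2 * ε₁ by positivity)
        simp only [indicator_of_mem hx]
        linarith
      · simp [indicator_of_notMem hx, hv.eq_zero x t (Or.inl hx), hv.eq_zero₀ x hx, hk0 x hx,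
          entropy_self]
    rw [integral_add i3 hind, integral_add (t1.const_mul _) (e0.const_mul _), integral_const_mul,
      integral_const_mul, integral_indicator hΩm, setIntegral_const, smul_eq_mul] at h1
    have h2 := mul_le_mul_of_nonneg_left h1 (hη0 t)
    refine h2.trans (le_of_eq ?_)
    simp only [hc, hJ, hV, hS₀]
    ring
  rw [integral_add (iJ.const_mul _) (hηi.restrict.mul_const _), integral_const_mul,
    integral_mul_const, hη1T, one_mul] at hfin
  refine hfin.trans ?_
  have hdS : d⁻¹ * S₀ ≤ ε / 8 := by
    rw [inv_mul_le_iff₀ hd0]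
    refine hsmall.trans ?_
    have h1 : ε₂ ≤ ε * d / (8 * (R * D * V + 1)) := min_le_right _ _
    rw [le_div_iff₀ (by positivity)] at h1
    nlinarith
  have hdE : d⁻¹ * ∫ t in Ioo 0 T, η t * J t ≤ d⁻¹ * S₀ + ε / 4 := by
    have h1 := mul_le_mul_of_nonneg_left hent' (inv_nonneg.2 hd0.le)
    have h2 : d⁻¹ * (ε * d / 4) = ε / 4 := by field_simp
    rw [mul_add, h2] at h1
    exact h1
  have hRV : R * ε₁ * V ≤ ε / 4 := by
    rw [hε₁, mul_div_assoc', div_mul_eq_mul_div, div_le_iff₀ (by positivity)]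
    nlinarith [mul_nonneg hR0 hV0]
  rw [hc]
  linarith

end InitialTrace

lemma exists_mollifier {r : ℝ} (hr : 0 < r) : ∃ η : ℝ → ℝ, ContDiff ℝ (⊤ : ℕ∞) η ∧
    HasCompactSupport η ∧ (∀ t, 0 ≤ η t) ∧ tsupport η ⊆ Ioo 0 r ∧ ∫ t, η t = 1 := by
  let χ : ContDiffBump (r / 2 : ℝ) := ⟨r / 8, r / 4, by linarith, by linarith⟩
  refine ⟨χ.normed volume, χ.contDiff_normed, χ.hasCompactSupport_normed, χ.nonneg_normed,
    ?_, χ.integral_normed⟩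
  rw [χ.tsupport_normed_eq, Real.closedBall_eq_Icc]
  exact Icc_subset_Ioo (by simp only [χ]; linarith) (by simp only [χ]; linarith)

/-! ### Integrated comparison on the diagonal. -/

section Comparison

variable {X Y : Type*} [NormedAddCommGroup X] [NormedSpace ℝ X] [FiniteDimensional ℝ X]
  [MeasureSpace X] [BorelSpace X] [(volume : Measure X).IsAddHaarMeasure]
  [NormedAddCommGroup Y] [NormedSpace ℝ Y] [FiniteDimensional ℝ Y]
  [MeasureSpace Y] [BorelSpace Y] [(volume : Measure Y).IsAddHaarMeasure]

variable {Ω : Set (E n)} {T s : ℝ} {ρ : E n → ℝ} {Φ : ℝ → ℝ} {v v₁ v₂ : E n × ℝ → ℝ}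
  {v₀ v₁₀ v₂₀ : E n → ℝ} {aB aB₁ aB₂ : (E n × E n) × ℝ → ℝ} {aO aO₁ aO₂ : E n × ℝ → ℝ}

/-- Integrated comparison of two energy solutions. -/
lemma IsEnergySolution.comparison (hT : 0 < T) (hΩm : MeasurableSet Ω) (hΩ : volume Ω ≠ ∞)
    (h₁ : IsEnergySolution Ω T s ρ Φ v₁ v₁₀ aB₁ aO₁)
    (h₂ : IsEnergySolution Ω T s ρ Φ v₂ v₂₀ aB₂ aO₂) (hΦ : IsExpanding Φ) (hρm : Measurable ρ)
    {R : ℝ} (hρ : ∀ x, 0 ≤ ρ x ∧ ρ x ≤ R) {b : ℝ → ℝ} (hbm : Measurable b) (hb : ∀ t, Φ (b t) = t)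
    {M : ℝ} (hM : ∀ x, |v₂₀ x| ≤ M) (h₀ : MemHsTilde Ω s v₂₀)
    {f₁ f₂ : X × ℝ → ℝ} (hf₁ : Integrable f₁) (hf₂ : Integrable f₂) (hf₂m : Measurable f₂)
    {g₁ g₂ : Y × ℝ → ℝ} (hg₁ : Integrable g₁) (hg₂ : Integrable g₂) (hg₂m : Measurable g₂)
    (hQ : ∀ P, IsHeavisideApprox P →
      ∀ᵐ q : ℝ × ℝ ∂((volume.restrict (Ioo 0 T)).prod (volume.restrict (Ioo 0 T))),
      pairing s aB₂ aO₂ q.2 (fun x => P (Φ (v₁ (x, q.1)) - Φ (v₂ (x, q.2))))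
        - pairing s aB₁ aO₁ q.1 (fun x => P (Φ (v₁ (x, q.1)) - Φ (v₂ (x, q.2))))
        ≤ posDiff f₁ f₂ q.1 q.2 + posDiff g₁ g₂ q.1 q.2)
    {θ : ℝ → ℝ} (hθ : ContDiff ℝ (⊤ : ℕ∞) θ) (hθc : HasCompactSupport θ) (hθ0 : ∀ t, 0 ≤ θ t)
    (hθs : tsupport θ ⊆ Iio T) :
    ∫ t in Ioo 0 T, -deriv θ t
        * posDiff (fun p => ρ p.1 * v₁ p) (fun p => ρ p.1 * v₂ p) t t
      ≤ θ 0 * (∫ x, ρ x * max (v₁₀ x - v₂₀ x) 0)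
        + ∫ t in Ioo 0 T, θ t * (posDiff f₁ f₂ t t + posDiff g₁ g₂ t t) := by
  set ν : Measure ℝ := volume.restrict (Ioo 0 T) with hν
  -- The weight dies strictly before `T`, which leaves room for the later time `t' < t + r`.
  obtain ⟨T₁, hT₁, hθT⟩ : ∃ T₁ < T, ∀ t, T₁ ≤ t → θ t = 0 ∧ deriv θ t = 0 := by
    rcases (tsupport θ).eq_empty_or_nonempty with h | h
    · refine ⟨0, hT, fun t _ => ?_⟩
      rw [tsupport_eq_empty_iff] at h
      subst h
      simp
    · obtain ⟨a, ha, hmax⟩ := hθc.exists_isMaxOn h continuousOn_id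
      have haT : a < T := hθs ha
      have hn : ∀ t, (a + T) / 2 ≤ t → t ∉ tsupport θ := fun t ht h' => by
        have : t ≤ a := hmax h'
        linarith
      refine ⟨(a + T) / 2, by linarith, fun t ht => ⟨image_eq_zero_of_notMem_tsupport (hn t ht),
        image_eq_zero_of_notMem_tsupport fun h' => hn t ht (tsupport_deriv_subset h')⟩⟩
  have hθd : Continuous (deriv θ) := hθ.continuous_deriv (by simp)
  obtain ⟨Cθ, hCθ⟩ := hθc.exists_bound_of_continuous hθ.continuous
  obtain ⟨Dθ, hDθ⟩ := hθc.deriv.exists_bound_of_continuous hθd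
  have i₁ : Integrable (fun p : E n × ℝ => ρ p.1 * v₁ p) :=
    Integrable.density_mul (hρm.comp measurable_fst) (fun q => hρ q.1) (h₁.integrable hΩ)
  have i₂ : Integrable (fun p : E n × ℝ => ρ p.1 * v₂ p) :=
    Integrable.density_mul (hρm.comp measurable_fst) (fun q => hρ q.1) (h₂.integrable hΩ)
  have iJ := integrable_posDiff i₁ i₂ T
  have iF := integrable_posDiff hf₁ hf₂ T
  have iG := integrable_posDiff hg₁ hg₂ T
  set S₀ := ∫ x, ρ x * max (v₁₀ x - v₂₀ x) 0 with hS₀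
  refine le_of_forall_pos_le_add fun e he => ?_
  -- Three mollification errors of size `ε` and one initial error of size `θ 0 * ε`.
  set ε := e / (4 + θ 0) with hε
  have hθ00 := hθ0 0
  have hε0 : 0 < ε := by positivity
  have hm₂ : Measurable fun p : E n × ℝ => ρ p.1 * v₂ p :=
    (hρm.comp measurable_fst).mul h₂.measurable
  obtain ⟨r₁, hr₁, k₁⟩ := exists_mollified_posDiff hm₂
    i₁ i₂ (w := fun t => -deriv θ t) hθd.neg (C := Dθ) (fun t => by rw [← Real.norm_eq_abs, norm_neg]; exact hDθ t) hT₁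
    (fun t ht => by rw [(hθT t ht).2, neg_zero]) hε0
  obtain ⟨r₂, hr₂, k₂⟩ := exists_mollified_posDiff hf₂m hf₁ hf₂ hθ.continuous hCθ hT₁
    (fun t ht => (hθT t ht).1) hε0
  obtain ⟨r₃, hr₃, k₃⟩ := exists_mollified_posDiff hg₂m hg₁ hg₂ hθ.continuous hCθ hT₁
    (fun t ht => (hθT t ht).1) hε0
  obtain ⟨r₄, hr₄, k₄⟩ := h₂.initial_trace hT hΩm hΩ hΦ hρm hρ hbm hb hM h₀ hε0
  set r := min (min (min r₁ r₂) (min r₃ r₄)) (min ((T - T₁) / 2) T) with hr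
  have hr0 : 0 < r := lt_min (lt_min (lt_min hr₁ hr₂) (lt_min hr₃ hr₄)) (lt_min (by linarith) hT)
  have l1 : r ≤ r₁ := (min_le_left _ _).trans ((min_le_left _ _).trans (min_le_left _ _))
  have l2 : r ≤ r₂ := (min_le_left _ _).trans ((min_le_left _ _).trans (min_le_right _ _))
  have l3 : r ≤ r₃ := (min_le_left _ _).trans ((min_le_right _ _).trans (min_le_left _ _))
  have l4 : r ≤ r₄ := (min_le_left _ _).trans ((min_le_right _ _).trans (min_le_right _ _))
  have l5 : r ≤ (T - T₁) / 2 := (min_le_right _ _).trans (min_le_left _ _)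
  have l6 : r ≤ T := (min_le_right _ _).trans (min_le_right _ _)
  obtain ⟨η, hη, hηc, hη0, hηs, hη1⟩ := exists_mollifier hr0
  have hηz : ∀ t ∉ Ioo 0 r, η t = 0 := fun t ht =>
    image_eq_zero_of_notMem_tsupport fun h => ht (hηs h)
  have hηn : ∀ {r'}, r ≤ r' → ∀ t, η t ≠ 0 → t ∈ Ioo 0 r' := fun h t ht =>
    Ioo_subset_Ioo_right h (by_contra fun hn => ht (hηz t hn))
  obtain ⟨Cη, hCη⟩ := hηc.exists_bound_of_continuous hη.continuous
  have hw : ∀ {f : ℝ → ℝ} {C : ℝ}, Continuous f → (∀ t, ‖f t‖ ≤ C) →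
      ∀ {F : ℝ × ℝ → ℝ}, Integrable F (ν.prod ν) →
      Integrable (fun q => f q.1 * η (q.2 - q.1) * F q) (ν.prod ν) := by
    intro f C hf hC F hF
    have hηC := hη.continuous
    refine hF.bdd_mul (c := C * Cη)
      (by fun_prop : Continuous fun q : ℝ × ℝ => f q.1 * η (q.2 - q.1)).aestronglyMeasurable
      (ae_of_all _ fun q => ?_)
    rw [norm_mul]
    exact mul_le_mul (hC _) (hCη _) (norm_nonneg _) ((norm_nonneg _).trans (hC 0))
  have key := doubling hT hΩ h₁ h₂ hΦ hρm hρ (Q := fun t t' => posDiff f₁ f₂ t t'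
    + posDiff g₁ g₂ t t') (iF.add iG) hQ hθ hθc hθ0 hη hηc hη0 (T₁ := T₁) (r := r) (by linarith)
    (fun t ht => (hθT t ht.le).1) hηz
  have wJ := hw (f := fun t => -deriv θ t) hθd.neg
    (fun t => by rw [norm_neg]; exact hDθ t) iJ
  have wF := hw hθ.continuous hCθ iF
  have wG := hw hθ.continuous hCθ iG
  have m₁ := abs_le.1 (k₁ η hη.continuous hη0 (hηn l1) hη1)
  have m₂ := abs_le.1 (k₂ η hη.continuous hη0 (hηn l2) hη1)
  have m₃ := abs_le.1 (k₃ η hη.continuous hη0 (hηn l3) hη1)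
  have m₄ := k₄ η hη hηc hη0 (hηs.trans (Ioo_subset_Ioo_right l4)) hη1
  rw [integral_prod _ wJ] at key
  simp only at key
  have split : ∫ q : ℝ × ℝ, θ q.1 * η (q.2 - q.1) * (posDiff f₁ f₂ q.1 q.2
      + posDiff g₁ g₂ q.1 q.2) ∂(ν.prod ν)
      = (∫ t in Ioo 0 T, ∫ t' in Ioo 0 T, θ t * η (t' - t) * posDiff f₁ f₂ t t')
        + ∫ t in Ioo 0 T, ∫ t' in Ioo 0 T, θ t * η (t' - t) * posDiff g₁ g₂ t t' := by
    rw [← integral_prod _ wF, ← integral_prod _ wG, ← integral_add wF wG]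
    refine integral_congr_ae (ae_of_all _ fun q => ?_)
    ring
  have dF : Integrable (fun t => θ t * posDiff f₁ f₂ t t) ν :=
    (integrable_posDiff_diag hf₁ hf₂).restrict.bdd_mul hθ.continuous.aestronglyMeasurable
      (ae_of_all _ hCθ)
  have dG : Integrable (fun t => θ t * posDiff g₁ g₂ t t) ν :=
    (integrable_posDiff_diag hg₁ hg₂).restrict.bdd_mul hθ.continuous.aestronglyMeasurable
      (ae_of_all _ hCθ)
  have split' : ∫ t in Ioo 0 T, θ t * (posDiff f₁ f₂ t t + posDiff g₁ g₂ t t)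
      = (∫ t in Ioo 0 T, θ t * posDiff f₁ f₂ t t) + ∫ t in Ioo 0 T, θ t * posDiff g₁ g₂ t t := by
    rw [← integral_add dF dG]
    refine integral_congr_ae (ae_of_all _ fun q => ?_)
    ring
  -- `(v₁₀ - v₂(t'))₊ ≤ (v₁₀ - v₂₀)₊ + |v₂(t') - v₂₀|`, and the last term is small in the `η`-mean
  -- by the initial trace of the second solution.
  have hinit : ∫ t' in Ioo 0 T, θ 0 * η t' * (∫ x, ρ x * max (v₁₀ x - v₂ (x, t')) 0)
      ≤ θ 0 * (S₀ + ε) := by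
    have iv := h₂.integrable hΩ
    have a1 : Integrable (fun q : E n × ℝ => ρ q.1 * max (v₁₀ q.1 - v₂ q) 0)
        ((volume : Measure (E n)).prod ν) :=
      Integrable.density_mul (hρm.comp measurable_fst) (fun q => hρ q.1)
        (((h₁.integrable₀ hΩ).comp_fst ν).sub (Integrable.slab iv _)).pos_part
    have a2 : Integrable (fun q : E n × ℝ => ρ q.1 * |v₂ q - v₂₀ q.1|)
        ((volume : Measure (E n)).prod ν) :=
      Integrable.density_mul (hρm.comp measurable_fst) (fun q => hρ q.1)
        (((Integrable.slab iv _).sub ((h₂.integrable₀ hΩ).comp_fst _)).abs)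
    have a0 : Integrable (fun x => ρ x * max (v₁₀ x - v₂₀ x) 0) :=
      Integrable.density_mul hρm hρ ((h₁.integrable₀ hΩ).sub (h₂.integrable₀ hΩ)).pos_part
    have hηm : AEStronglyMeasurable η ν := hη.continuous.aestronglyMeasurable
    have hηi : Integrable η ν := (hη.continuous.integrable_of_hasCompactSupport hηc).restrict
    have b1 := a1.integral_prod_right.bdd_mul hηm (ae_of_all _ hCη)
    have b2 := a2.integral_prod_right.bdd_mul hηm (ae_of_all _ hCη)
    have hη1T : ∫ t in Ioo 0 T, η t = 1 := by
      rw [setIntegral_eq_integral_of_forall_compl_eq_zero fun t ht => ?_, hη1]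
      exact hηz t fun h => ht ⟨h.1, h.2.trans_le l6⟩
    simp_rw [mul_assoc]
    rw [integral_const_mul]
    refine mul_le_mul_of_nonneg_left ?_ hθ00
    have b3 : ∫ t' in Ioo 0 T, η t' * (∫ x, ρ x * max (v₁₀ x - v₂ (x, t')) 0)
        ≤ ∫ t' in Ioo 0 T, (η t' * S₀ + η t' * ∫ x, ρ x * |v₂ (x, t') - v₂₀ x|) := by
      refine integral_mono_ae b1 ((hηi.mul_const _).add b2) ?_
      filter_upwards [a1.prod_left_ae, a2.prod_left_ae] with t c1 c2
      rw [← mul_add, hS₀, ← integral_add a0 c2]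
      refine mul_le_mul_of_nonneg_left (integral_mono c1 (a0.add c2) fun x => ?_) (hη0 t)
      rw [← mul_add]
      refine mul_le_mul_of_nonneg_left (max_le ?_ ?_) (hρ x).1
      · linarith [le_max_left (v₁₀ x - v₂₀ x) 0, neg_abs_le (v₂ (x, t) - v₂₀ x)]
      · linarith [le_max_right (v₁₀ x - v₂₀ x) 0, abs_nonneg (v₂ (x, t) - v₂₀ x)]
    rw [integral_add (hηi.mul_const _) b2, integral_mul_const, hη1T, one_mul] at b3
    linarith
  rw [split] at key
  rw [split']
  have hεe : ε * (4 + θ 0) = e := by rw [hε]; field_simp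
  clear_value ν
  subst hν
  linarith [m₁.1, m₂.2, m₃.2]

end Comparison

/-! ### The fluxes of the nonlocal equation -/

/-- The nonlocal flux of a solution with interior values `v` and exterior values `g`. -/
def nonlocalFlux (s : ℝ) (K : E n → E n → ℝ) (Φ : ℝ → ℝ) (v g : E n × ℝ → ℝ) :
    (E n × E n) × ℝ → ℝ :=
  fun q => K q.1.1 q.1.2 * dq s (fun x => Φ (v (x, q.2)) + g (x, q.2)) q.1

/-- The lower order terms. -/
def localFlux (q : E n → ℝ) (v f : E n × ℝ → ℝ) : E n × ℝ → ℝ := fun p => q p.1 * v p - f p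

/-- The interaction of exterior values with the domain. -/
def coupling (Ω : Set (E n)) (s c : ℝ) (g : E n × ℝ → ℝ) : (E n × E n) × ℝ → ℝ :=
  fun q => c * ((Ω.indicator (fun _ => g (q.1.1, q.2)) q.1.2
    + Ω.indicator (fun _ => g (q.1.2, q.2)) q.1.1) / ‖q.1.1 - q.1.2‖ ^ ((n : ℝ) + 2 * s))

lemma dq_mul_dq (s : ℝ) (f g : E n → ℝ) (z : E n × E n) :
    dq s f z * dq s g z
      = (f z.1 - f z.2) * (g z.1 - g z.2) / ‖z.1 - z.2‖ ^ ((n : ℝ) + 2 * s) := by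
  have h : ‖z.1 - z.2‖ ^ ((n : ℝ) + 2 * s) = ‖z.1 - z.2‖ ^ (((n : ℝ) + 2 * s) / 2)
      * ‖z.1 - z.2‖ ^ (((n : ℝ) + 2 * s) / 2) := by
    rw [← sq, ← Real.rpow_natCast, ← Real.rpow_mul (norm_nonneg _)]
    norm_num
  rw [h, dq, dq, div_mul_div_comm]

section Flux

variable {Ω : Set (E n)} {T s c : ℝ} {K : E n → E n → ℝ} {q ρ : E n → ℝ} {Φ : ℝ → ℝ}
  {v₁ v₂ f₁ f₂ g₁ g₂ : E n × ℝ → ℝ} {v₁₀ v₂₀ : E n → ℝ}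

/-- Here `z` is the difference of the interior values and `γ` that of the exterior values. Two
points of `Ω` give a favourable sign because `P` is monotone, and two points outside make the test
function vanish. In a mixed pair with interior value `a` and exterior value `b` the product is `(a -
b) P(a)`; here `a P(a) ≥ 0` and `0 ≤ P ≤ 1`, so at most `b₊` is lost. -/
lemma nonlocal_pointwise_le {P : ℝ → ℝ} (hP : IsHeavisideApprox P) {k c : ℝ} (hk : 0 ≤ k)
    (hkc : k ≤ c) {Ω : Set (E n)} {z γ : E n → ℝ} (hz : ∀ x ∉ Ω, z x = 0) (hγ : ∀ x ∈ Ω, γ x = 0)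
    (x y : E n) :
    -(k * (((z x + γ x) - (z y + γ y)) * (P (z x) - P (z y))))
      ≤ c * max (Ω.indicator (fun _ => γ x) y + Ω.indicator (fun _ => γ y) x) 0 := by
  have hP0 := hP.eq_zero 0 le_rfl
  have hc := hk.trans hkc
  have hone : ∀ a b, -(k * ((a - b) * P a)) ≤ c * max b 0 := fun a b => by
    have h1 : 0 ≤ a * P a := by
      rcases le_total a 0 with h | h
      · rw [hP.eq_zero a h, mul_zero]
      · exact mul_nonneg h (hP.nonneg a)
    have h2 : b * P a ≤ max b 0 := by
      refine (mul_le_mul_of_nonneg_right (le_max_left b 0) (hP.nonneg a)).trans ?_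
      exact mul_le_of_le_one_right (le_max_right _ _) (hP.le_one a)
    have h3 : k * (b * P a) ≤ c * max b 0 :=
      (mul_le_mul_of_nonneg_left h2 hk).trans
        (mul_le_mul_of_nonneg_right hkc (le_max_right _ _))
    nlinarith [mul_nonneg hk h1]
  by_cases hx : x ∈ Ω <;> by_cases hy : y ∈ Ω
  · have h : 0 ≤ (z x - z y) * (P (z x) - P (z y)) := by
      rcases le_total (z x) (z y) with h | h
      · exact mul_nonneg_of_nonpos_of_nonpos (sub_nonpos.2 h) (sub_nonpos.2 (hP.monotone h))
      · exact mul_nonneg (sub_nonneg.2 h) (sub_nonneg.2 (hP.monotone h))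
    simp only [hγ x hx, hγ y hy, add_zero]
    exact (neg_nonpos.2 (mul_nonneg hk h)).trans (mul_nonneg hc (le_max_right _ _))
  · simp only [hz y hy, hγ x hx, hP0, indicator_of_mem hx, indicator_of_notMem hy, add_zero,
      zero_add, sub_zero]
    exact hone _ _
  · simp only [hz x hx, hγ y hy, hP0, indicator_of_mem hy, indicator_of_notMem hx, add_zero,
      zero_add, zero_sub]
    convert hone (z y) (γ x) using 1
    ring
  · simp only [hz x hx, hz y hy, sub_self, mul_zero, neg_zero]
    exact mul_nonneg hc (le_max_right _ _)

/-- The sign analysis for fluxes at two different times. The nonlocal part is integrated from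
`nonlocal_pointwise_le`. The absorption term is nonpositive because the test function vanishes where
`v₁ ≤ v₂`, and the sources are bounded through `0 ≤ P ≤ 1`. -/
lemma pairing_sub_le
    (h₁ : IsEnergySolution Ω T s ρ Φ v₁ v₁₀ (nonlocalFlux s K Φ v₁ g₁) (localFlux q v₁ f₁))
    (h₂ : IsEnergySolution Ω T s ρ Φ v₂ v₂₀ (nonlocalFlux s K Φ v₂ g₂) (localFlux q v₂ f₂))
    (hΦ : IsExpanding Φ) (hK : ∀ x y, 0 ≤ K x y ∧ K x y ≤ c) (hq : ∀ x, 0 ≤ q x)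
    (hf₁ : Integrable f₁) (hf₂ : Integrable f₂)
    (hg₁ : Integrable (coupling Ω s c g₁)) (hg₂ : Integrable (coupling Ω s c g₂))
    (hg₁0 : ∀ x ∈ Ω, ∀ t, g₁ (x, t) = 0) (hg₂0 : ∀ x ∈ Ω, ∀ t, g₂ (x, t) = 0)
    {P : ℝ → ℝ} (hP : IsHeavisideApprox P) :
    ∀ᵐ r : ℝ × ℝ ∂((volume.restrict (Ioo 0 T)).prod (volume.restrict (Ioo 0 T))),
      pairing s (nonlocalFlux s K Φ v₂ g₂) (localFlux q v₂ f₂) r.2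
          (fun x => P (Φ (v₁ (x, r.1)) - Φ (v₂ (x, r.2))))
        - pairing s (nonlocalFlux s K Φ v₁ g₁) (localFlux q v₁ f₁) r.1
          (fun x => P (Φ (v₁ (x, r.1)) - Φ (v₂ (x, r.2))))
        ≤ posDiff f₁ f₂ r.1 r.2
          + posDiff (coupling Ω s c g₁) (coupling Ω s c g₂) r.1 r.2 := by
  obtain ⟨L, hPL⟩ := hP.lipschitz
  have hP0 := hP.eq_zero 0 le_rfl
  have hm := hΦ.strictMono.monotone
  obtain ⟨a1, a2⟩ := integrable_flux_two_times h₁ h₁ h₂ hΦ.continuous hPL hP0 (Or.inl rfl)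
  obtain ⟨a3, a4⟩ := integrable_flux_two_times h₂ h₁ h₂ hΦ.continuous hPL hP0 (Or.inr rfl)
  have a5 := ((Integrable.time_fst (Integrable.slab hf₁ (Ioo 0 T))).sub
    (Integrable.time_snd (Integrable.slab hf₂ (Ioo 0 T)))).pos_part
  have a6 := ((Integrable.time_fst (Integrable.slab hg₁ (Ioo 0 T))).sub
    (Integrable.time_snd (Integrable.slab hg₂ (Ioo 0 T)))).pos_part
  filter_upwards [a1.prod_left_ae, a2.prod_left_ae, a3.prod_left_ae, a4.prod_left_ae,
    a5.prod_left_ae, a6.prod_left_ae] with r b1 b2 b3 b4 b5 b6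
  set ζ : E n → ℝ := fun x => P (Φ (v₁ (x, r.1)) - Φ (v₂ (x, r.2))) with hζ
  have hB : (∫ z, nonlocalFlux s K Φ v₂ g₂ (z, r.2) * dq s ζ z)
      - ∫ z, nonlocalFlux s K Φ v₁ g₁ (z, r.1) * dq s ζ z
      ≤ posDiff (coupling Ω s c g₁) (coupling Ω s c g₂) r.1 r.2 := by
    rw [← integral_sub b3 b1]
    refine integral_mono (b3.sub b1) b6 fun z => ?_
    have hn : 0 ≤ ‖z.1 - z.2‖ ^ ((n : ℝ) + 2 * s) := Real.rpow_nonneg (norm_nonneg _) _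
    have hp := nonlocal_pointwise_le hP (hK z.1 z.2).1 (hK z.1 z.2).2 (Ω := Ω)
      (z := fun x => Φ (v₁ (x, r.1)) - Φ (v₂ (x, r.2)))
      (γ := fun x => g₁ (x, r.1) - g₂ (x, r.2))
      (fun x hx => by simp [h₁.eq_zero x r.1 (Or.inl hx), h₂.eq_zero x r.2 (Or.inl hx)])
      (fun x hx => by simp [hg₁0 x hx, hg₂0 x hx]) z.1 z.2
    have hdiv := div_le_div_of_nonneg_right hp hn
    have hind : ∀ x y, Ω.indicator (fun _ => g₁ (x, r.1) - g₂ (x, r.2)) y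
        = Ω.indicator (fun _ => g₁ (x, r.1)) y - Ω.indicator (fun _ => g₂ (x, r.2)) y :=
      fun x y => by by_cases hy : y ∈ Ω <;> simp [hy]
    have hc : 0 ≤ c := (hK z.1 z.2).1.trans (hK z.1 z.2).2
    have e1 : coupling Ω s c g₁ (z, r.1) - coupling Ω s c g₂ (z, r.2)
        = c * (Ω.indicator (fun _ => g₁ (z.1, r.1) - g₂ (z.1, r.2)) z.2
          + Ω.indicator (fun _ => g₁ (z.2, r.1) - g₂ (z.2, r.2)) z.1)
          / ‖z.1 - z.2‖ ^ ((n : ℝ) + 2 * s) := by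
      simp only [coupling, hind]
      ring
    have e2 : max (coupling Ω s c g₁ (z, r.1) - coupling Ω s c g₂ (z, r.2)) 0
        = c * max (Ω.indicator (fun _ => g₁ (z.1, r.1) - g₂ (z.1, r.2)) z.2
          + Ω.indicator (fun _ => g₁ (z.2, r.1) - g₂ (z.2, r.2)) z.1) 0
          / ‖z.1 - z.2‖ ^ ((n : ℝ) + 2 * s) := by
      have h := max_div_div_right hn (c * (Ω.indicator (fun _ => g₁ (z.1, r.1) - g₂ (z.1, r.2)) z.2
        + Ω.indicator (fun _ => g₁ (z.2, r.1) - g₂ (z.2, r.2)) z.1)) 0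
      rw [zero_div] at h
      rw [e1, h, mul_max_of_nonneg _ _ hc, mul_zero]
    have e3 : nonlocalFlux s K Φ v₂ g₂ (z, r.2) * dq s ζ z
        - nonlocalFlux s K Φ v₁ g₁ (z, r.1) * dq s ζ z
        = -(K z.1 z.2 * (dq s (fun x => (Φ (v₁ (x, r.1)) - Φ (v₂ (x, r.2)))
          + (g₁ (x, r.1) - g₂ (x, r.2))) z * dq s ζ z)) := by
      simp only [nonlocalFlux, dq]
      ring
    change _ ≤ max (coupling Ω s c g₁ (z, r.1) - coupling Ω s c g₂ (z, r.2)) 0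
    rw [e2]
    change nonlocalFlux s K Φ v₂ g₂ (z, r.2) * dq s ζ z
        - nonlocalFlux s K Φ v₁ g₁ (z, r.1) * dq s ζ z ≤ _
    rw [e3, dq_mul_dq]
    refine le_trans (le_of_eq ?_) hdiv
    simp only [hζ]
    ring
  have hO : (∫ x, localFlux q v₂ f₂ (x, r.2) * ζ x) - ∫ x, localFlux q v₁ f₁ (x, r.1) * ζ x
      ≤ posDiff f₁ f₂ r.1 r.2 := by
    rw [← integral_sub b4 b2]
    refine integral_mono (b4.sub b2) b5 fun x => ?_
    change localFlux q v₂ f₂ (x, r.2) * ζ x - localFlux q v₁ f₁ (x, r.1) * ζ x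
      ≤ max (f₁ (x, r.1) - f₂ (x, r.2)) 0
    have hζ0 : 0 ≤ ζ x := hP.nonneg _
    have c1 : q x * ((v₂ (x, r.2) - v₁ (x, r.1)) * ζ x) ≤ 0 := by
      refine mul_nonpos_of_nonneg_of_nonpos (hq x) ?_
      rcases le_total (v₁ (x, r.1)) (v₂ (x, r.2)) with h | h
      · simp only [hζ]
        rw [hP.eq_zero _ (sub_nonpos.2 (hm h)), mul_zero]
      · exact mul_nonpos_of_nonpos_of_nonneg (sub_nonpos.2 h) hζ0
    have c2 : (f₁ (x, r.1) - f₂ (x, r.2)) * ζ x ≤ max (f₁ (x, r.1) - f₂ (x, r.2)) 0 :=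
      (mul_le_mul_of_nonneg_right (le_max_left _ 0) hζ0).trans
        (mul_le_of_le_one_right (le_max_right _ _) (hP.le_one _))
    have e : localFlux q v₂ f₂ (x, r.2) * ζ x - localFlux q v₁ f₁ (x, r.1) * ζ x
        = q x * ((v₂ (x, r.2) - v₁ (x, r.1)) * ζ x) + (f₁ (x, r.1) - f₂ (x, r.2)) * ζ x := by
      simp only [localFlux]
      ring
    rw [e]
    linarith
  simp only [pairing]
  linarith

end Flux

/-! ### From weak solutions to energy solutions -/

/-- An integrated form of a first order equation in time holds pointwise almost everywhere. -/
lemma ae_eq_neg_integral_of_weak {T : ℝ} (hT : 0 < T) {y p : ℝ → ℝ} {c : ℝ}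
    (hy : IntegrableOn y (Ioo 0 T)) (hp : IntegrableOn p (Ioo 0 T))
    (h : ∀ θ : ℝ → ℝ, ContDiff ℝ (⊤ : ℕ∞) θ → HasCompactSupport θ → tsupport θ ⊆ Iio T →
      -(∫ t in Ioo 0 T, deriv θ t * y t) + ∫ t in Ioo 0 T, θ t * p t = θ 0 * c) :
    ∀ᵐ t, t ∈ Ioo 0 T → y t - c = -∫ τ in 0..t, p τ := by
  have hcp : ContinuousOn (fun t => ∫ τ in 0..t, p τ) (Icc 0 T) := by
    have := intervalIntegral.continuousOn_primitive_interval (a := 0) (b := T) (f := p)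
      (μ := volume) (by rwa [uIcc_of_le hT.le, integrableOn_Icc_iff_integrableOn_Ioo])
    rwa [uIcc_of_le hT.le] at this
  have hi : IntegrableOn (fun t => y t - c + ∫ τ in 0..t, p τ) (Ioo 0 T) :=
    (hy.sub (integrableOn_const (by simp))).add
      ((hcp.integrableOn_compact isCompact_Icc).mono_set Ioo_subset_Icc_self)
  have hz := isOpen_Ioo.ae_eq_zero_of_integral_contDiff_smul_eq_zero hi.locallyIntegrableOn
    fun g hg hgc hgs => ?_
  · filter_upwards [hz] with t ht hti
    linarith [ht hti]
  set ν : Measure ℝ := volume.restrict (Ioo 0 T) with hν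
  -- To show that the continuous-in-time identity holds almost everywhere, its defect is integrated
  -- against an arbitrary smooth `g`; the primitive of `g` is the test function for the weak form.
  obtain ⟨θ, hθ, hθc, hθs, hθd, hθi, -⟩ := exists_smooth_primitive hg hgc hT hgs
  have hw := h θ hθ hθc hθs
  obtain ⟨C, hC⟩ := hgc.exists_bound_of_continuous hg.continuous
  have hgm : AEStronglyMeasurable g ν := hg.continuous.aestronglyMeasurable
  have hgi : Integrable g := hg.continuous.integrable_of_hasCompactSupport hgc
  have i1 : Integrable (fun t => g t * y t) ν := Integrable.bdd_mul hy hgm (ae_of_all _ hC)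
  have e1 : ∫ t in Ioo 0 T, deriv θ t * y t = -∫ t in Ioo 0 T, g t * y t := by
    rw [← integral_neg]
    exact setIntegral_congr_fun measurableSet_Ioo fun t ht => by
      simp only [hθd t ht.1.le, neg_mul]
  have e2 : θ 0 = ∫ t in Ioo 0 T, g t := by
    rw [hθi 0 le_rfl, intervalIntegral.integral_of_le hT.le, integral_Ioc_eq_integral_Ioo]
  have hsw : Integrable (fun r : ℝ × ℝ => {r : ℝ × ℝ | r.1 < r.2}.indicator
      (fun r => p r.1 * g r.2) r) (ν.prod ν) :=
    (Integrable.mul_prod hp hgi.restrict).indicator (measurableSet_lt measurable_fst measurable_snd)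
  -- Both sides are the integral of `p t * g τ` over the triangle `t < τ`.
  have e3 : ∫ t in Ioo 0 T, θ t * p t = ∫ t in Ioo 0 T, g t * ∫ τ in 0..t, p τ := by
    have c1 : ∫ t in Ioo 0 T, θ t * p t = ∫ t in Ioo 0 T, ∫ τ in Ioo 0 T,
        {r : ℝ × ℝ | r.1 < r.2}.indicator (fun r => p r.1 * g r.2) (t, τ) := by
      refine setIntegral_congr_fun measurableSet_Ioo fun t ht => ?_
      have hs : ∀ τ, {r : ℝ × ℝ | r.1 < r.2}.indicator (fun r => p r.1 * g r.2) (t, τ)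
          = (Ioi t).indicator (fun τ => p t * g τ) τ := fun τ => by
        by_cases h : t < τ <;> simp [h]
      simp only [hs]
      rw [setIntegral_indicator measurableSet_Ioi, integral_const_mul, hθi t ht.1.le,
        intervalIntegral.integral_of_le ht.2.le, integral_Ioc_eq_integral_Ioo, mul_comm]
      congr 3
      ext τ
      simp only [mem_inter_iff, mem_Ioo, mem_Ioi]
      exact ⟨fun h => ⟨⟨ht.1.trans h.1, h.2⟩, h.1⟩, fun h => ⟨h.2, h.1.2⟩⟩
    have c2 : ∫ t in Ioo 0 T, g t * ∫ τ in 0..t, p τ = ∫ τ in Ioo 0 T, ∫ t in Ioo 0 T,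
        {r : ℝ × ℝ | r.1 < r.2}.indicator (fun r => p r.1 * g r.2) (t, τ) := by
      refine setIntegral_congr_fun measurableSet_Ioo fun τ ht => ?_
      have hs : ∀ t, {r : ℝ × ℝ | r.1 < r.2}.indicator (fun r => p r.1 * g r.2) (t, τ)
          = (Iio τ).indicator (fun t => p t * g τ) t := fun t => by
        by_cases h : t < τ <;> simp [h]
      simp only [hs]
      rw [setIntegral_indicator measurableSet_Iio, integral_mul_const,
        intervalIntegral.integral_of_le ht.1.le, integral_Ioc_eq_integral_Ioo, mul_comm]
      congr 3
      ext t
      simp only [mem_inter_iff, mem_Ioo, mem_Iio]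
      exact ⟨fun h => ⟨⟨h.1, h.2.trans ht.2⟩, h.2⟩, fun h => ⟨h.1.1, h.2⟩⟩
    rw [c1, c2]
    exact integral_integral_swap hsw
  have i2 : Integrable (fun t => g t * c) ν := hgi.restrict.mul_const c
  have i3 : Integrable (fun t => g t * ∫ τ in 0..t, p τ) ν :=
    Integrable.bdd_mul ((hcp.integrableOn_compact isCompact_Icc).mono_set Ioo_subset_Icc_self)
      hgm (ae_of_all _ hC)
  have hz : ∀ t ∉ Ioo 0 T, g t • (y t - c + ∫ τ in 0..t, p τ) = 0 := fun t ht => by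
    rw [image_eq_zero_of_notMem_tsupport fun h => ht (hgs h), zero_smul]
  rw [← setIntegral_eq_integral_of_forall_compl_eq_zero hz]
  have e4 : ∫ t in Ioo 0 T, g t • (y t - c + ∫ τ in 0..t, p τ)
      = (∫ t in Ioo 0 T, g t * y t) - (∫ t in Ioo 0 T, g t * c)
        + ∫ t in Ioo 0 T, g t * ∫ τ in 0..t, p τ := by
    have i4 : Integrable (fun t => g t * y t - g t * c) ν := i1.sub i2
    rw [← integral_sub i1 i2, ← integral_add i4 i3]
    refine integral_congr_ae (ae_of_all _ fun t => ?_)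
    simp only [smul_eq_mul]
    ring
  rw [e4, integral_mul_const, ← e2]
  rw [e1, e3] at hw
  linarith

/-! ### Extension from a dense family of test functions. -/

section Dense

variable {Ω : Set (E n)} {T s : ℝ} {aB : (E n × E n) × ℝ → ℝ} {aO : E n × ℝ → ℝ}

lemma eLpNorm_comp_fst {X Y : Type*} [MeasurableSpace X] [MeasurableSpace Y] {μ : Measure X}
    {ν : Measure Y} [SigmaFinite μ] [SigmaFinite ν] {f : X → ℝ} (hf : AEStronglyMeasurable f μ) :
    eLpNorm (fun q : X × Y => f q.1) 2 (μ.prod ν) ^ 2 = ν univ * eLpNorm f 2 μ ^ 2 := by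
  rw [eLpNorm_two_sq, eLpNorm_two_sq, lintegral_prod]
  · simp only [lintegral_const]
    rw [lintegral_mul_const'' _ (hf.enorm.pow_const 2), mul_comm]
  · exact (hf.comp_quasiMeasurePreserving Measure.quasiMeasurePreserving_fst).enorm.pow_const 2

/-- Time integrals of the pairing are bounded by the `L²` norms. -/
lemma enorm_integral_integral_le {X : Type*} [MeasureSpace X] [SigmaFinite (volume : Measure X)]
    {a : X × ℝ → ℝ} (ha : MemLp a 2 volume) {g : X → ℝ} (hg : MemLp g 2 volume) {t : ℝ}
    (ht : 0 ≤ t) :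
    ‖∫ τ in 0..t, ∫ x, a (x, τ) * g x‖ₑ
      ≤ eLpNorm a 2 volume * (ENNReal.ofReal (1 + t) * eLpNorm g 2 volume) := by
  have hgp : MemLp (fun q : X × ℝ => g q.1) 2
    ((volume : Measure X).prod (volume.restrict (Ioo 0 t))) := hg.comp_fst _
  rw [intervalIntegral.integral_of_le ht, integral_Ioc_eq_integral_Ioo,
    ← integral_prod_symm _ (integrable_slab_mul ha hg 0 t)]
  refine (enorm_integral_mul_le (MemLp.slab ha _).1 hgp.1).trans ?_
  refine mul_le_mul' ?_ ?_
  · rw [prod_restrict_eq]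
    exact eLpNorm_restrict_le _ _ _ _
  -- The natural factor is `√t`; it is replaced by `1 + t`, and the comparison reduces to `t ≤ (1 +
  -- t)²` after squaring.
  · rw [← ENNReal.pow_le_pow_left_iff (n := 2) (by norm_num), eLpNorm_comp_fst hg.1, mul_pow]
    refine mul_le_mul' ?_ le_rfl
    rw [Measure.restrict_apply_univ, Real.volume_Ioo, sub_zero,
      ← ENNReal.ofReal_pow (by positivity)]
    exact ENNReal.ofReal_le_ofReal (by nlinarith)

/-- Both sides are continuous in `ζ` for the `H^s` norm, with the constant `B` below, so it suffices
to know the identity on a dense set. A countable one lets a single null set of times serve all test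
functions. -/
lemma eq_of_dense (haB : MemLp aB 2 volume) (haO : MemLp aO 2 volume)
    (haBT : ∀ z t, t ∉ Ioo 0 T → aB (z, t) = 0) (haOT : ∀ x t, t ∉ Ioo 0 T → aO (x, t) = 0)
    {h : E n → ℝ} (hh : MemLp h 2 volume) {t : ℝ} (ht : 0 ≤ t) {D : Set (E n → ℝ)}
    (hD : ∀ ζ ∈ D, MemHs s ζ)
    (hdense : ∀ f, MemHsTilde Ω s f → ∀ ε : ℝ≥0∞, 0 < ε → ∃ ζ ∈ D,
      eLpNorm (fun x => f x - ζ x) 2 volume ≤ ε ∧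
      eLpNorm (fun z => dq s f z - dq s ζ z) 2 volume ≤ ε)
    (heq : ∀ ζ ∈ D, ∫ x, h x * ζ x = -∫ τ in 0..t, pairing s aB aO τ ζ)
    {f : E n → ℝ} (hf : MemHsTilde Ω s f) :
    ∫ x, h x * f x = -∫ τ in 0..t, pairing s aB aO τ f := by
  have split : ∀ g, MemHs s g → ∫ τ in 0..t, pairing s aB aO τ g
      = (∫ τ in 0..t, ∫ z, aB (z, τ) * dq s g z) + ∫ τ in 0..t, ∫ x, aO (x, τ) * g x :=
    fun g hg => intervalIntegral.integral_add
      (integrable_pairing_aux haB (memHs_iff.1 hg).2 haBT).intervalIntegrable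
      (integrable_pairing_aux haO (memHs_iff.1 hg).1 haOT).intervalIntegrable
  have lin : ∀ {X : Type _} [MeasureSpace X] [SigmaFinite (volume : Measure X)] {a : X × ℝ → ℝ}
      {g g' : X → ℝ}, MemLp a 2 volume → (∀ x t, t ∉ Ioo 0 T → a (x, t) = 0) →
      MemLp g 2 volume → MemLp g' 2 volume →
      ∫ τ in 0..t, ∫ x, a (x, τ) * (g x - g' x)
        = (∫ τ in 0..t, ∫ x, a (x, τ) * g x) - ∫ τ in 0..t, ∫ x, a (x, τ) * g' x := by
    intro X _ _ a g g' ha haT hg hg'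
    rw [intervalIntegral.integral_of_le ht, intervalIntegral.integral_of_le ht,
      intervalIntegral.integral_of_le ht, integral_Ioc_eq_integral_Ioo,
      integral_Ioc_eq_integral_Ioo, integral_Ioc_eq_integral_Ioo,
      ← integral_prod_symm _ (integrable_slab_mul (g := fun x => g x - g' x) ha (hg.sub hg') 0 t),
      ← integral_prod_symm _ (integrable_slab_mul ha hg 0 t),
      ← integral_prod_symm _ (integrable_slab_mul ha hg' 0 t),
      ← integral_sub (integrable_slab_mul ha hg 0 t) (integrable_slab_mul ha hg' 0 t)]
    refine integral_congr_ae (ae_of_all _ fun q => ?_)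
    simp only
    ring
  obtain ⟨f1, f2⟩ := memHs_iff.1 hf.1
  rw [eq_neg_iff_add_eq_zero, ← enorm_eq_zero]
  set c := ENNReal.ofReal (1 + t)
  set B := eLpNorm h 2 volume + eLpNorm aB 2 volume * c + eLpNorm aO 2 volume * c with hB
  have hBt : B ≠ ∞ := by
    refine ENNReal.add_ne_top.2 ⟨ENNReal.add_ne_top.2 ⟨hh.2.ne, ?_⟩, ?_⟩
    · exact ENNReal.mul_ne_top haB.2.ne ENNReal.ofReal_ne_top
    · exact ENNReal.mul_ne_top haO.2.ne ENNReal.ofReal_ne_top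
  have key : ∀ ε : ℝ≥0∞, 0 < ε →
      ‖(∫ x, h x * f x) + ∫ τ in 0..t, pairing s aB aO τ f‖ₑ ≤ B * ε := fun ε hε => by
    obtain ⟨ζ, hζ, k1, k2⟩ := hdense f hf ε hε
    obtain ⟨z1, z2⟩ := memHs_iff.1 (hD ζ hζ)
    have e0 := heq ζ hζ
    rw [split ζ (hD ζ hζ)] at e0
    have e1 : ∫ x, h x * (f x - ζ x) = (∫ x, h x * f x) - ∫ x, h x * ζ x := by
      simp_rw [mul_sub]
      exact integral_sub (hh.integrable_mul f1) (hh.integrable_mul z1)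
    have e : (∫ x, h x * f x) + ∫ τ in 0..t, pairing s aB aO τ f
        = (∫ x, h x * (f x - ζ x)) + (∫ τ in 0..t, ∫ z, aB (z, τ) * (dq s f z - dq s ζ z))
          + ∫ τ in 0..t, ∫ x, aO (x, τ) * (f x - ζ x) := by
      rw [split f hf.1, e1, lin haB haBT f2 z2, lin haO haOT f1 z1, e0]
      ring
    rw [e, hB, add_mul, add_mul, mul_assoc, mul_assoc]
    refine (enorm_add_le _ _).trans (add_le_add ((enorm_add_le _ _).trans (add_le_add ?_ ?_)) ?_)
    · exact (enorm_integral_mul_le hh.1 (f1.sub z1).1).trans (mul_le_mul' le_rfl k1)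
    · exact (enorm_integral_integral_le haB (f2.sub z2) ht).trans
        (mul_le_mul' le_rfl (mul_le_mul' le_rfl k2))
    · exact (enorm_integral_integral_le haO (f1.sub z1) ht).trans
        (mul_le_mul' le_rfl (mul_le_mul' le_rfl k1))
  have hlim : Tendsto (fun ε : ℝ≥0∞ => B * ε) (𝓝[>] 0) (𝓝 (B * 0)) :=
    (ENNReal.Tendsto.const_mul tendsto_id (Or.inr hBt)).mono_left nhdsWithin_le_nhds
  rw [mul_zero] at hlim
  exact le_antisymm (ge_of_tendsto hlim (eventually_mem_nhdsWithin.mono fun ε hε => key ε hε))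
    zero_le

end Dense

/-! ### Measurable representatives on space-time. -/

section Representatives

variable {Ω : Set (E n)} {T s : ℝ} {Φ : ℝ → ℝ}

/-- The exterior values `Φ(φ)`, set to zero outside of `(0,T)`. -/
def exteriorValue (T : ℝ) (Φ : ℝ → ℝ) (φ : E n × ℝ → ℝ) : E n × ℝ → ℝ :=
  (univ ×ˢ Ioo 0 T).indicator fun p => Φ (φ p)

lemma exteriorValue_of_notMem (φ : E n × ℝ → ℝ) (x : E n) {t : ℝ} (ht : t ∉ Ioo 0 T) :
    exteriorValue T Φ φ (x, t) = 0 :=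
  indicator_of_notMem (fun h => ht h.2) _

lemma exteriorValue_of_mem (φ : E n × ℝ → ℝ) (x : E n) {t : ℝ} (ht : t ∈ Ioo 0 T) :
    exteriorValue T Φ φ (x, t) = Φ (φ (x, t)) := by
  rw [exteriorValue, indicator_of_mem]
  exact ⟨mem_univ _, ht⟩

lemma notMem_exterior {x : E n} (hx : x ∈ Ω) : x ∉ exterior Ω := fun h => h (subset_closure hx)

lemma MemCc.eq_zero {φ : E n × ℝ → ℝ} (hφ : MemCc Ω T φ) {x : E n} (hx : x ∉ exterior Ω) {t : ℝ}
    (ht : t ∈ Ioo 0 T) : φ (x, t) = 0 := by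
  obtain ⟨-, S, -, hS, h⟩ := hφ
  exact h _ ⟨mem_univ _, Ioo_subset_Icc_self ht⟩ fun hm => hx (hS hm).1

lemma measurable_exteriorValue {φ : E n × ℝ → ℝ} (hφ : MemCc Ω T φ) (hΦ : Continuous Φ) :
    Measurable (exteriorValue T Φ φ) := by
  have hm : MeasurableSet ((univ : Set (E n)) ×ˢ Ioo (0 : ℝ) T) :=
    MeasurableSet.univ.prod measurableSet_Ioo
  classical
  rw [exteriorValue, ← piecewise_eq_indicator]
  exact ContinuousOn.measurable_piecewise
    (hΦ.comp_continuousOn (hφ.1.mono (prod_mono_right Ioo_subset_Icc_self)))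
    continuousOn_const hm

lemma exteriorValue_eq_zero {φ : E n × ℝ → ℝ} (hφ : MemCc Ω T φ) (hΦ0 : Φ 0 = 0) (x : E n)
    (hx : x ∉ exterior Ω) (t : ℝ) : exteriorValue T Φ φ (x, t) = 0 := by
  by_cases ht : t ∈ Ioo 0 T
  · rw [exteriorValue_of_mem φ x ht, hφ.eq_zero hx ht, hΦ0]
  · exact exteriorValue_of_notMem φ x ht

lemma ae_slice_of_ae {X : Type*} [MeasureSpace X] [SigmaFinite (volume : Measure X)] {S : Set ℝ}
    {p : X × ℝ → Prop} (h : ∀ᵐ q ∂((volume : Measure (X × ℝ)).restrict (univ ×ˢ S)), p q) :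
    ∀ᵐ t ∂(volume.restrict S), ∀ᵐ x, p (x, t) := by
  rw [← prod_restrict_eq] at h
  exact Measure.ae_ae_of_ae_prod
    ((Measure.measurePreserving_swap (μ := volume.restrict S)
      (ν := (volume : Measure X))).quasiMeasurePreserving.ae h)

/-- Tonelli turns the time integral of slice norms into space-time `L²` norms of the function and
its difference quotient. The joint measurability needed for this is carried by `w`, which agrees
with `w'` only slice by slice. -/
lemma memLp_of_lintegral_hsNormSq {w w' : E n × ℝ → ℝ} (hw : Measurable w)
    (h0 : ∀ x t, t ∉ Ioo 0 T → w (x, t) = 0)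
    (hae : ∀ᵐ t ∂(volume.restrict (Ioo 0 T)), (fun x => w (x, t)) =ᵐ[volume] fun x => w' (x, t))
    (hfin : ∫⁻ t in Ioo 0 T, hsNormSq s (fun x => w' (x, t)) < ∞) :
    MemLp w 2 volume ∧
      MemLp (fun q : (E n × E n) × ℝ => dq s (fun x => w (x, q.2)) q.1) 2 volume := by
  have hdm : Measurable fun q : (E n × E n) × ℝ => dq s (fun x => w (x, q.2)) q.1 := by
    unfold dq
    fun_prop
  have hnorm : ∀ᵐ t ∂(volume.restrict (Ioo 0 T)), hsNormSq s (fun x => w' (x, t))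
      = eLpNorm (fun x => w (x, t)) 2 volume ^ 2
        + eLpNorm (dq s fun x => w (x, t)) 2 volume ^ 2 := by
    filter_upwards [hae] with t ht
    have hm : AEStronglyMeasurable (fun x => w' (x, t)) volume :=
      (hw.comp measurable_prodMk_right).aestronglyMeasurable.congr ht
    rw [hsNormSq_eq s hm, eLpNorm_congr_ae ht, eLpNorm_congr_ae (dq_congr_ae ht)]
  have key : ∀ {X : Type _} [MeasureSpace X] [SigmaFinite (volume : Measure X)] {a : X × ℝ → ℝ},
      Measurable a → (∀ x t, t ∉ Ioo 0 T → a (x, t) = 0) →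
      (∀ᵐ t ∂(volume.restrict (Ioo 0 T)), eLpNorm (fun x => a (x, t)) 2 volume ^ 2
        ≤ hsNormSq s (fun x => w' (x, t))) → MemLp a 2 volume := by
    intro X _ _ a ha ha0 hle
    refine ⟨ha.aestronglyMeasurable, ?_⟩
    have h1 : eLpNorm a 2 volume ^ 2 < ∞ := by
      rw [eLpNorm_two_sq, Measure.volume_eq_prod,
        lintegral_prod_symm _ (ha.enorm.pow_const 2).aemeasurable]
      have h2 : ∫⁻ t, ∫⁻ x, ‖a (x, t)‖ₑ ^ 2
          = ∫⁻ t in Ioo 0 T, ∫⁻ x, ‖a (x, t)‖ₑ ^ 2 := by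
        rw [← lintegral_indicator measurableSet_Ioo]
        refine lintegral_congr fun t => ?_
        by_cases ht : t ∈ Ioo 0 T
        · rw [indicator_of_mem ht]
        · rw [indicator_of_notMem ht]
          simp [ha0 _ t ht]
      rw [h2]
      refine (lintegral_mono_ae ?_).trans_lt hfin
      filter_upwards [hle] with t ht
      rwa [eLpNorm_two_sq] at ht
    simpa using h1
  constructor
  · refine key hw h0 ?_
    filter_upwards [hnorm] with t ht
    rw [ht]
    exact le_self_add
  · refine key hdm (fun z t ht => by simp [dq, h0 _ t ht]) ?_
    filter_upwards [hnorm] with t ht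
    rw [ht]
    exact le_add_self

/-- Space-time integrals against tensor products. -/
lemma setIntegral_cyl_mul {a a' : E n × ℝ → ℝ} (ha : MemLp a 2 volume)
    (ha0 : ∀ x ∉ Ω, ∀ t, a (x, t) = 0) (haa : a =ᵐ[volume.restrict (cyl Ω T)] a') {ζ : E n → ℝ}
    (hζ : MemLp ζ 2 volume) {w : ℝ → ℝ} (hw : Continuous w) {C : ℝ} (hC : ∀ t, ‖w t‖ ≤ C) :
    ∫ p in cyl Ω T, a' p * (ζ p.1 * w p.2) = ∫ t in Ioo 0 T, w t * ∫ x, a (x, t) * ζ x := by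
  have h1 : ∫ p in cyl Ω T, a' p * (ζ p.1 * w p.2) = ∫ p in cyl Ω T, w p.2 * (a p * ζ p.1) := by
    refine integral_congr_ae ?_
    filter_upwards [haa] with p hp
    rw [hp]
    ring
  have h2 : ∫ p in cyl Ω T, w p.2 * (a p * ζ p.1)
      = ∫ p in univ ×ˢ Ioo 0 T, w p.2 * (a p * ζ p.1) := by
    refine (setIntegral_eq_of_subset_of_forall_sdiff_eq_zero
      (MeasurableSet.univ.prod measurableSet_Ioo) (prod_mono_left (subset_univ _))
      fun p hp => ?_).symm
    rw [← Prod.mk.eta (p := p), ha0 p.1 (fun h => hp.2 ⟨h, hp.1.2⟩)]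
    simp
  have hi : Integrable (fun p : E n × ℝ => w p.2 * (a p * ζ p.1))
      ((volume : Measure (E n)).prod (volume.restrict (Ioo 0 T))) :=
    (integrable_slab_mul ha hζ 0 T).bdd_mul (c := C)
      (hw.comp continuous_snd).aestronglyMeasurable (ae_of_all _ fun p => hC _)
  rw [h1, h2, ← prod_restrict_eq, integral_prod_symm _ hi]
  simp only [integral_const_mul]

end Representatives

section WeakToEnergy

variable {Ω : Set (E n)} {T s c R : ℝ} {K : E n → E n → ℝ} {ρ q : E n → ℝ} {Φ b : ℝ → ℝ}
  {F φ u v f : E n × ℝ → ℝ} {u₀ v₀ : E n → ℝ}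

/-- Bounded representatives of the initial values. -/
lemma IsInitialDatum.exists_representative (hΩ : MeasurableSet Ω) (h : IsInitialDatum Ω s u₀) :
    ∃ v₀ : E n → ℝ, Measurable v₀ ∧ v₀ =ᵐ[volume] u₀ ∧ (∃ M, ∀ x, |v₀ x| ≤ M) ∧
      (∀ x ∉ Ω, v₀ x = 0) ∧ MemHsTilde Ω s v₀ := by
  obtain ⟨hb, ht⟩ := h
  set M := (eLpNorm u₀ ⊤ (volume.restrict Ω)).toReal with hM
  have hM0 : 0 ≤ M := ENNReal.toReal_nonneg
  set w := hb.1.mk u₀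
  have hwm : Measurable w := hb.1.stronglyMeasurable_mk.measurable
  have hle : ∀ᵐ x ∂volume.restrict Ω, |u₀ x| ≤ M := by
    filter_upwards [ae_le_eLpNormEssSup (f := u₀) (μ := volume.restrict Ω)] with x hx
    rw [← eLpNorm_exponent_top] at hx
    have := ENNReal.toReal_mono hb.2.ne hx
    simpa [hM] using this
  have hae : Ω.indicator (fun x => max (-M) (min M (w x))) =ᵐ[volume] u₀ := by
    have h1 := (ae_restrict_iff' hΩ).1 hle
    have h2 := (ae_restrict_iff' hΩ).1 hb.1.ae_eq_mk
    filter_upwards [h1, h2, ht.ae_eq_zero hΩ] with x k1 k2 k3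
    by_cases hx : x ∈ Ω
    · have k4 := abs_le.1 (k1 hx)
      have k5 : w x = u₀ x := (k2 hx).symm
      rw [indicator_of_mem hx, k5, min_eq_right k4.2, max_eq_right k4.1]
    · rw [indicator_of_notMem hx, k3 hx]
  refine ⟨Ω.indicator fun x => max (-M) (min M (w x)),
    (measurable_const.max (measurable_const.min hwm)).indicator hΩ, hae, ⟨M, fun x => ?_⟩,
    fun x hx => indicator_of_notMem hx _, ht.congr_ae hae.symm⟩
  by_cases hx : x ∈ Ω
  · rw [indicator_of_mem hx]
    exact abs_le.2 ⟨le_max_left _ _, max_le (by linarith) (min_le_left _ _)⟩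
  · rw [indicator_of_notMem hx, abs_zero]
    exact hM0

/-- Representatives of weak solutions, in terms of which the exterior condition holds pointwise. -/
lemma IsWeakSolution.exists_representative (hΩ : MeasurableSet Ω) (hΦ : IsExpanding Φ)
    (hbm : Measurable b) (hb : ∀ t, Φ (b t) = t) (hφ : MemCc Ω T φ)
    (hu : IsWeakSolution Ω T s K ρ q Φ F φ u₀ u) :
    ∃ v : E n × ℝ → ℝ, Measurable v ∧ (∀ x t, (x ∉ Ω ∨ t ∉ Ioo 0 T) → v (x, t) = 0) ∧
      v =ᵐ[volume.restrict (cyl Ω T)] u ∧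
      (∀ᵐ t ∂volume.restrict (Ioo 0 T),
        (fun x => Φ (v (x, t))) =ᵐ[volume] fun x => Φ (u (x, t) - φ (x, t))) ∧
      ∀ᵐ t ∂volume.restrict (Ioo 0 T),
        (fun x => Φ (v (x, t)) + exteriorValue T Φ φ (x, t)) =ᵐ[volume] fun x => Φ (u (x, t)) := by
  have hbΦ : ∀ t, b (Φ t) = t := fun t => hΦ.strictMono.injective (hb _)
  obtain ⟨⟨hm, -⟩, ⟨-, ht⟩, -⟩ := hu
  set W := hm.mk _ with hW
  have hWm : Measurable W := hm.stronglyMeasurable_mk.measurable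
  have hWu : (fun p => Φ (u p)) =ᵐ[volume.restrict (cyl univ T)] W := hm.ae_eq_mk
  have hΩT : MeasurableSet (cyl Ω T) := hΩ.prod measurableSet_Ioo
  -- Applying the measurable inverse `b` to a measurable version `W` of `Φ(u)` recovers `u` almost
  -- everywhere on the cylinder.
  set v : E n × ℝ → ℝ := (cyl Ω T).indicator fun p => b (W p) with hv
  have hv0 : ∀ x t, (x ∉ Ω ∨ t ∉ Ioo 0 T) → v (x, t) = 0 := fun x t h =>
    indicator_of_notMem (fun hc => h.elim (fun h => h hc.1) fun h => h hc.2) _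
  have hv1 : ∀ x ∈ Ω, ∀ t ∈ Ioo 0 T, v (x, t) = b (W (x, t)) := fun x hx t ht => by
    rw [hv, indicator_of_mem]
    exact ⟨hx, ht⟩
  have slice : ∀ᵐ t ∂volume.restrict (Ioo 0 T), ∀ᵐ x, Φ (u (x, t)) = W (x, t) := ae_slice_of_ae hWu
  have both : ∀ᵐ t ∂volume.restrict (Ioo 0 T), ∀ᵐ x, Φ (v (x, t)) = Φ (u (x, t) - φ (x, t)) ∧
      Φ (v (x, t)) + exteriorValue T Φ φ (x, t) = Φ (u (x, t)) := by
    filter_upwards [slice, ht, ae_restrict_mem measurableSet_Ioo] with t h1 h2 h3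
    filter_upwards [h1, h2.ae_eq_zero hΩ] with x k1 k2
    by_cases hx : x ∈ Ω
    · rw [hv1 x hx t h3, hb, ← k1, exteriorValue_eq_zero hφ hΦ.zero x (notMem_exterior hx),
        hφ.eq_zero (notMem_exterior hx) h3, sub_zero,
        add_zero]
      exact ⟨rfl, rfl⟩
    · have k3 := k2 hx
      rw [k3, hv0 x t (Or.inl hx), hΦ.zero, exteriorValue_of_mem φ x h3, zero_add]
      -- Off `Ω`, membership in `H̃^s` forces `Φ(u - φ) = 0`, hence `u = φ` since `Φ` is injective.
      have k4 : u (x, t) - φ (x, t) = 0 := hΦ.strictMono.injective (k3.trans hΦ.zero.symm)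
      rw [sub_eq_zero.1 k4]
      exact ⟨rfl, rfl⟩
  refine ⟨v, (hbm.comp hWm).indicator hΩT, hv0, ?_, both.mono fun t h => h.mono fun x hx => hx.1,
    both.mono fun t h => h.mono fun x hx => hx.2⟩
  have h1 := ae_restrict_of_ae_restrict_of_subset (prod_mono_left (subset_univ Ω)) hWu
  filter_upwards [h1, ae_restrict_mem hΩT] with p k1 k2
  rw [hv, indicator_of_mem k2, ← k1, hbΦ]

/-- The weak equation tested with tensor products. -/
lemma IsWeakSolution.tensor_eq (hρm : Measurable ρ)
    (hρ : ∀ x, |ρ x| ≤ R) (hu : IsWeakSolution Ω T s K ρ q Φ F φ u₀ u)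
    (hF : MemL2Cyl Ω T F) {g : E n × ℝ → ℝ} (hvm : Measurable v) (hv2 : MemLp v 2 volume)
    (hO : MemLp (localFlux q v f) 2 volume)
    (hv0 : ∀ x t, (x ∉ Ω ∨ t ∉ Ioo 0 T) → v (x, t) = 0)
    (hf0 : ∀ x t, (x ∉ Ω ∨ t ∉ Ioo 0 T) → f (x, t) = 0)
    (hvu : v =ᵐ[volume.restrict (cyl Ω T)] u) (hfF : f =ᵐ[volume.restrict (cyl Ω T)] F)
    (hvg : ∀ᵐ t ∂volume.restrict (Ioo 0 T),
        (fun x => Φ (v (x, t)) + g (x, t)) =ᵐ[volume] fun x => Φ (u (x, t)))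
    (hB : MemLp (nonlocalFlux s K Φ v g) 2 volume)
    (hv₀ : v₀ =ᵐ[volume] u₀) (hv₀0 : ∀ x ∉ Ω, v₀ x = 0) {ζ : E n → ℝ} (hζ : IsTest Ω ζ)
    (hζs : MemHs s ζ) {θ : ℝ → ℝ} (hθ : ContDiff ℝ (⊤ : ℕ∞) θ) (hθc : HasCompactSupport θ)
    (hθs : tsupport θ ⊆ Iio T) :
    -(∫ t in Ioo 0 T, deriv θ t * ∫ x, ρ x * v (x, t) * ζ x)
        + ∫ t in Ioo 0 T, θ t * pairing s (nonlocalFlux s K Φ v g) (localFlux q v f) t ζ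
      = θ 0 * ∫ x, ρ x * v₀ x * ζ x := by
  obtain ⟨z1, z2⟩ := memHs_iff.1 hζs
  obtain ⟨ζd, ζc, ζs⟩ := hζ
  have hθd : Continuous (deriv θ) := hθ.continuous_deriv (by simp)
  obtain ⟨Cθ, hCθ⟩ := hθc.exists_bound_of_continuous hθ.continuous
  obtain ⟨Dθ, hDθ⟩ := hθc.deriv.exists_bound_of_continuous hθd
  have ψd : ContDiff ℝ (⊤ : ℕ∞) fun p : E n × ℝ => ζ p.1 * θ p.2 :=
    (ζd.comp contDiff_fst).mul (hθ.comp contDiff_snd)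
  have hsub : tsupport (fun p : E n × ℝ => ζ p.1 * θ p.2) ⊆ tsupport ζ ×ˢ tsupport θ := by
    refine closure_minimal (fun p hp => ?_) ((isClosed_tsupport _).prod (isClosed_tsupport _))
    exact ⟨subset_tsupport _ (left_ne_zero_of_mul hp), subset_tsupport _ (right_ne_zero_of_mul hp)⟩
  have ψc : HasCompactSupport fun p : E n × ℝ => ζ p.1 * θ p.2 :=
    (ζc.prod hθc).of_isClosed_subset (isClosed_tsupport _) hsub
  have hw := hu.weak_eq _ ψd ψc (hsub.trans (prod_mono ζs hθs))
  have ψ2 : MemLp (fun p : E n × ℝ => ζ p.1 * θ p.2) 2 (volume.restrict (cyl Ω T)) :=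
    (ψd.continuous.memLp_of_hasCompactSupport ψc).restrict _
  have hdt : ∀ p : E n × ℝ, dt (fun p : E n × ℝ => ζ p.1 * θ p.2) p = ζ p.1 * deriv θ p.2 :=
    fun p => by
      simp only [dt]
      exact deriv_const_mul _ ((hθ.differentiable (by simp)) _)
  have hρv : MemLp (fun p : E n × ℝ => ρ p.1 * v p) 2 volume := by
    refine (hv2.const_mul R).mono ((hρm.comp measurable_fst).mul hvm).aestronglyMeasurable
      (ae_of_all _ fun p => ?_)
    rw [norm_mul, norm_mul]
    exact mul_le_mul_of_nonneg_right ((hρ p.1).trans (le_abs_self R)) (norm_nonneg _)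
  have t1 : ∫ p in cyl Ω T, ρ p.1 * u p * dt (fun p : E n × ℝ => ζ p.1 * θ p.2) p
      = ∫ t in Ioo 0 T, deriv θ t * ∫ x, ρ x * v (x, t) * ζ x := by
    simp only [hdt]
    refine setIntegral_cyl_mul (a := fun p => ρ p.1 * v p) (a' := fun p => ρ p.1 * u p) hρv
      (fun x hx t => by rw [hv0 x t (Or.inl hx), mul_zero]) ?_ z1 hθd hDθ
    filter_upwards [hvu] with p hp
    rw [hp]
  have t2 : (∫ p in cyl Ω T, q p.1 * u p * (ζ p.1 * θ p.2)) - ∫ p in cyl Ω T, F p * (ζ p.1 * θ p.2)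
      = ∫ t in Ioo 0 T, θ t * ∫ x, localFlux q v f (x, t) * ζ x := by
    have i1 : Integrable (fun p : E n × ℝ => F p * (ζ p.1 * θ p.2)) (volume.restrict (cyl Ω T)) :=
      hF.integrable_mul ψ2
    have i2 : Integrable (fun p : E n × ℝ => localFlux q v f p * (ζ p.1 * θ p.2))
      (volume.restrict (cyl Ω T)) := (hO.restrict _).integrable_mul ψ2
    rw [← setIntegral_cyl_mul (a' := localFlux q v f) hO
      (fun x hx t => by simp [localFlux, hv0 x t (Or.inl hx), hf0 x t (Or.inl hx)])
      (EventuallyEq.refl _ _) z1 hθ.continuous hCθ, sub_eq_iff_eq_add, ← integral_add i2 i1]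
    refine integral_congr_ae ?_
    filter_upwards [hvu, hfF] with p h1 h2
    simp only [localFlux, h1, h2]
    ring
  have t3 : ∫ t in Ioo 0 T, bilin K s (fun x => Φ (u (x, t))) (fun x => ζ x * θ t)
      = ∫ t in Ioo 0 T, θ t * ∫ z, nonlocalFlux s K Φ v g (z, t) * dq s ζ z := by
    refine integral_congr_ae ?_
    filter_upwards [hvg] with t ht
    rw [bilin, ← integral_const_mul]
    refine integral_congr_ae ?_
    filter_upwards [dq_congr_ae (s := s) ht] with z hz
    have e : dq s (fun x => Φ (u (x, t))) z * dq s (fun x => ζ x * θ t) z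
        = θ t * (dq s (fun x => Φ (u (x, t))) z * dq s ζ z) := by
      simp only [dq]
      ring
    have e2 : nonlocalFlux s K Φ v g (z, t) = K z.1 z.2 * dq s (fun x => Φ (u (x, t))) z := by
      rw [← hz]
      rfl
    rw [mul_div_assoc, ← dq_mul_dq s (fun x => Φ (u (x, t))) (fun x => ζ x * θ t) z, e, e2]
    ring
  have t4 : ∫ x in Ω, ρ x * u₀ x * (ζ x * θ 0) = θ 0 * ∫ x, ρ x * v₀ x * ζ x := by
    rw [← integral_const_mul, ← setIntegral_eq_integral_of_forall_compl_eq_zero (s := Ω)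
      (f := fun x => θ 0 * (ρ x * v₀ x * ζ x)) fun x hx => by rw [hv₀0 x hx]; ring]
    refine integral_congr_ae (ae_restrict_of_ae ?_)
    filter_upwards [hv₀] with x hx
    rw [hx]
    ring
  have i3 : Integrable (fun t => θ t * ∫ z, nonlocalFlux s K Φ v g (z, t) * dq s ζ z)
      (volume.restrict (Ioo 0 T)) :=
    (integrable_slab_mul hB z2 0 T).integral_prod_right.bdd_mul
      hθ.continuous.aestronglyMeasurable (ae_of_all _ hCθ)
  have i4 : Integrable (fun t => θ t * ∫ x, localFlux q v f (x, t) * ζ x)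
      (volume.restrict (Ioo 0 T)) :=
    (integrable_slab_mul hO z1 0 T).integral_prod_right.bdd_mul
      hθ.continuous.aestronglyMeasurable (ae_of_all _ hCθ)
  have t5 : ∫ t in Ioo 0 T, θ t * pairing s (nonlocalFlux s K Φ v g) (localFlux q v f) t ζ
      = (∫ t in Ioo 0 T, θ t * ∫ z, nonlocalFlux s K Φ v g (z, t) * dq s ζ z)
        + ∫ t in Ioo 0 T, θ t * ∫ x, localFlux q v f (x, t) * ζ x := by
    rw [← integral_add i3 i4]
    simp only [pairing, mul_add]
  simp only at hw
  rw [t5, ← t1, ← t2, ← t3, ← t4]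
  linarith

end WeakToEnergy

section WeakToEnergy

variable {Ω : Set (E n)} {T s c R Cq : ℝ} {K : E n → E n → ℝ} {ρ q : E n → ℝ} {Φ b : ℝ → ℝ}
  {F φ u : E n × ℝ → ℝ} {u₀ : E n → ℝ}

lemma MemLp.bounded_mul {X : Type*} [MeasurableSpace X] {μ : Measure X} {a w : X → ℝ} {C : ℝ}
    (hw : MemLp w 2 μ) (ham : Measurable a) (ha : ∀ x, |a x| ≤ C) :
    MemLp (fun x => a x * w x) 2 μ := by
  refine (hw.const_mul C).mono (ham.aestronglyMeasurable.mul hw.1) (ae_of_all _ fun x => ?_)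
  rw [norm_mul, norm_mul]
  exact mul_le_mul_of_nonneg_right ((ha x).trans (le_abs_self C)) (norm_nonneg _)

lemma memLp_two_of_bounded {X : Type*} [MeasurableSpace X] {μ : Measure X} {S : Set X}
    (hS : MeasurableSet S) (hSv : μ S ≠ ∞) {w : X → ℝ} (hw : Measurable w)
    (hw0 : ∀ x ∉ S, w x = 0) {C : ℝ} (hC : ∀ x, |w x| ≤ C) : MemLp w 2 μ := by
  have : IsFiniteMeasure (μ.restrict S) := ⟨by simpa using hSv.lt_top⟩
  rw [← indicator_eq_self.2 (show Function.support w ⊆ S from fun x hx => by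
    by_contra h
    exact hx (hw0 x h)), memLp_indicator_iff_restrict hS]
  exact MemLp.of_bound hw.aestronglyMeasurable C (ae_of_all _ hC)

lemma memLp_two_of_growth {X : Type*} [MeasurableSpace X] {μ : Measure X} (hΦ : IsExpanding Φ)
    {v : X → ℝ} (hv : Measurable v) {S : Set X} (hS : MeasurableSet S) (hSv : μ S ≠ ∞)
    (hΦv : MemLp (fun p => Φ (v p)) 2 μ) (hv0 : ∀ p ∉ S, v p = 0) : MemLp v 2 μ := by
  have h1 : MemLp (S.indicator fun _ => (1 : ℝ)) 2 μ := memLp_indicator_const 2 hS _ (Or.inr hSv)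
  refine (h1.add hΦv.norm).mono' hv.aestronglyMeasurable (ae_of_all _ fun p => ?_)
  rw [Pi.add_apply]
  by_cases hp : p ∈ S
  · rw [indicator_of_mem hp]
    exact hΦ.growth _
  · rw [hv0 p hp, norm_zero, indicator_of_notMem hp, zero_add]
    exact abs_nonneg _

/-- Weak solutions have representatives that are energy solutions. -/
lemma IsWeakSolution.exists_isEnergySolution (hT : 0 < T) (hΩ : MeasurableSet Ω)
    (hΩv : volume Ω ≠ ∞) (hΦ : IsExpanding Φ) (hbm : Measurable b) (hb : ∀ t, Φ (b t) = t)
    (hKm : Measurable (Function.uncurry K)) (hK : ∀ x y, |K x y| ≤ c) (hρm : Measurable ρ)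
    (hρ : ∀ x, |ρ x| ≤ R) (hqm : Measurable q) (hq : ∀ x, |q x| ≤ Cq) (hF : MemL2Cyl Ω T F)
    (hφ : MemCc Ω T φ) (hu₀ : IsInitialDatum Ω s u₀)
    (hu : IsWeakSolution Ω T s K ρ q Φ F φ u₀ u) :
    ∃ (v f : E n × ℝ → ℝ) (v₀ : E n → ℝ),
      IsEnergySolution Ω T s ρ Φ v v₀ (nonlocalFlux s K Φ v (exteriorValue T Φ φ))
        (localFlux q v f) ∧
      Measurable f ∧ MemLp f 2 volume ∧ (∀ x t, (x ∉ Ω ∨ t ∉ Ioo 0 T) → f (x, t) = 0) ∧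
      f =ᵐ[volume.restrict (cyl Ω T)] F ∧ v =ᵐ[volume.restrict (cyl Ω T)] u ∧
      v₀ =ᵐ[volume] u₀ ∧ (∃ M, ∀ x, |v₀ x| ≤ M) ∧ MemHsTilde Ω s v₀ := by
  have hΩT : MeasurableSet (cyl Ω T) := hΩ.prod measurableSet_Ioo
  have hΩTv : volume (cyl Ω T) ≠ ∞ := by
    rw [cyl, Measure.volume_eq_prod, Measure.prod_prod]
    exact ENNReal.mul_ne_top hΩv (by simp)
  obtain ⟨v₀, hv₀m, hv₀u, ⟨M, hM⟩, hv₀0, hv₀t⟩ := hu₀.exists_representative hΩ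
  obtain ⟨v, hvm, hv0, hvu, hvt, hvg⟩ := hu.exists_representative hΩ hΦ hbm hb hφ
  set f : E n × ℝ → ℝ := (cyl Ω T).indicator (hF.1.mk F) with hf
  have hfm : Measurable f := hF.1.stronglyMeasurable_mk.measurable.indicator hΩT
  have hf2 : MemLp f 2 volume := (memLp_indicator_iff_restrict hΩT).2 (hF.ae_eq hF.1.ae_eq_mk)
  have hf0 : ∀ x t, (x ∉ Ω ∨ t ∉ Ioo 0 T) → f (x, t) = 0 := fun x t h =>
    indicator_of_notMem (fun hc => h.elim (fun h => h hc.1) fun h => h hc.2) _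
  have hfF : f =ᵐ[volume.restrict (cyl Ω T)] F := by
    filter_upwards [hF.1.ae_eq_mk, ae_restrict_mem hΩT] with p h1 h2
    rw [hf, indicator_of_mem h2, ← h1]
  set g := exteriorValue T Φ φ with hg
  have hgm : Measurable g := measurable_exteriorValue hφ hΦ.continuous
  have hΦm := hΦ.continuous.measurable
  obtain ⟨a1, a2⟩ := memLp_of_lintegral_hsNormSq (s := s) (w := fun p => Φ (v p))
    (w' := fun p => Φ (u p - φ p)) (by fun_prop)
    (fun x t ht => by rw [hv0 x t (Or.inr ht), hΦ.zero]) hvt hu.memL2HsTilde.1.2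
  obtain ⟨-, a4⟩ := memLp_of_lintegral_hsNormSq (s := s) (w := fun p => Φ (v p) + g p)
    (w' := fun p => Φ (u p))
    (by fun_prop) (fun x t ht => by
      rw [hv0 x t (Or.inr ht), hΦ.zero, hg, exteriorValue_of_notMem φ x ht, add_zero])
    hvg hu.memL2Hs.2
  have hv2 : MemLp v 2 volume := memLp_two_of_growth hΦ hvm hΩT hΩTv a1 fun p hp =>
    hv0 p.1 p.2 (by
      by_contra! h
      exact hp h)
  have hBm : Measurable (nonlocalFlux s K Φ v g) := by
    have hK' : Measurable fun r : (E n × E n) × ℝ => K r.1.1 r.1.2 := hKm.comp measurable_fst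
    unfold nonlocalFlux dq
    fun_prop
  have hB : MemLp (nonlocalFlux s K Φ v g) 2 volume := by
    exact MemLp.bounded_mul a4 (hKm.comp measurable_fst) fun r => hK _ _
  have hOm : Measurable (localFlux q v f) := by
    unfold localFlux
    fun_prop
  have hO : MemLp (localFlux q v f) 2 volume := by
    exact (MemLp.bounded_mul hv2 (hqm.comp measurable_fst) fun p => hq p.1).sub hf2
  have hBT : ∀ z t, t ∉ Ioo 0 T → nonlocalFlux s K Φ v g (z, t) = 0 := fun z t ht => by
    simp [nonlocalFlux, dq, hv0 _ t (Or.inr ht), hg, exteriorValue_of_notMem φ _ ht]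
  have hOT : ∀ x t, t ∉ Ioo 0 T → localFlux q v f (x, t) = 0 := fun x t ht => by
    simp [localFlux, hv0 x t (Or.inr ht), hf0 x t (Or.inr ht)]
  have hv₀2 : MemLp v₀ 2 volume := memLp_two_of_bounded hΩ hΩv hv₀m hv₀0 hM
  have hΦv₀2 : MemLp (fun x => Φ (v₀ x)) 2 volume := by
    obtain ⟨C, hC⟩ := (isCompact_Icc (a := -M) (b := M)).exists_bound_of_continuousOn
      hΦ.continuous.continuousOn
    exact memLp_two_of_bounded hΩ hΩv (hΦm.comp hv₀m) (fun x hx => by rw [hv₀0 x hx, hΦ.zero])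
      fun x => hC _ (abs_le.1 (hM x))
  have hΦt : ∀ᵐ t, t ∈ Ioo 0 T → MemHsTilde Ω s (fun x => Φ (v (x, t))) := by
    rw [← ae_restrict_iff' measurableSet_Ioo]
    filter_upwards [hvt, hu.memL2HsTilde.2] with t h1 h2
    exact h2.congr_ae h1.symm
  -- Each test function has its own exceptional set of times. Countability of `D` makes their union
  -- null, and `eq_of_dense` then reaches all of `H̃^s`.
  obtain ⟨D, hDc, hD, hdense⟩ := exists_countable_isTest_dense Ω s
  have hρv : MemLp (fun p : E n × ℝ => ρ p.1 * v p) 2 volume :=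
    MemLp.bounded_mul hv2 (hρm.comp measurable_fst) fun p => hρ p.1
  have hDeq : ∀ ζ ∈ D, ∀ᵐ t, t ∈ Ioo 0 T → (∫ x, ρ x * v (x, t) * ζ x) - ∫ x, ρ x * v₀ x * ζ x
      = -∫ τ in 0..t, pairing s (nonlocalFlux s K Φ v g) (localFlux q v f) τ ζ := fun ζ hζ => by
    obtain ⟨z1, z2⟩ := memHs_iff.1 (hD ζ hζ).2
    refine ae_eq_neg_integral_of_weak hT (integrable_slab_mul hρv z1 0 T).integral_prod_right
      ?_ fun θ hθ hθc hθs => hu.tensor_eq hρm hρ hF hvm hv2 hO hv0 hf0 hvu hfF hvg hB hv₀u hv₀0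
        (hD ζ hζ).1 (hD ζ hζ).2 hθ hθc hθs
    exact ((integrable_pairing_aux hB z2 hBT).add
      (integrable_pairing_aux hO z1 hOT)).integrableOn
  have hρL : ∀ w : E n → ℝ, MemLp w 2 volume → MemLp (fun x => ρ x * w x) 2 volume :=
    fun w hw => MemLp.bounded_mul hw hρm hρ
  refine ⟨v, f, v₀, ⟨hvm, hv₀m, hBm, hOm, hv2, a1, a2, hv₀2, hΦv₀2, hB, hO, hv0, hv₀0, hBT, hOT,
    hΦt, ?_⟩, hfm, hf2, hf0, hfF, hvu, hv₀u, ⟨M, hM⟩, hv₀t⟩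
  filter_upwards [(ae_ball_iff hDc).2 hDeq, MemLp.slice hv2 hvm] with t h1 h2 ht ζ hζ
  refine eq_of_dense (h := fun x => ρ x * (v (x, t) - v₀ x)) hB hO hBT hOT (hρL _ (h2.sub hv₀2))
    ht.1.le (fun ζ hζ => (hD ζ hζ).2) hdense (fun ζ hζ => ?_) hζ
  have z1 := (memHs_iff.1 (hD ζ hζ).2).1
  have i1 : Integrable fun x => ρ x * v (x, t) * ζ x := (hρL _ h2).integrable_mul z1
  have i2 : Integrable fun x => ρ x * v₀ x * ζ x := (hρL _ hv₀2).integrable_mul z1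
  rw [← h1 ζ hζ ht, ← integral_sub i1 i2]
  refine integral_congr_ae (ae_of_all _ fun x => ?_)
  simp only
  ring

end WeakToEnergy

/-! ### The comparison estimate -/

section Coupling

variable {Ω : Set (E n)} {T s c : ℝ} {Φ : ℝ → ℝ} {φ φ₁ φ₂ : E n × ℝ → ℝ}

lemma measurable_coupling (hΩ : MeasurableSet Ω) {g : E n × ℝ → ℝ} (hg : Measurable g) :
    Measurable (coupling Ω s c g) := by
  have h1 : Measurable fun r : (E n × E n) × ℝ => Ω.indicator (fun _ => g (r.1.1, r.2)) r.1.2 :=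
    (hg.comp ((measurable_fst.comp measurable_fst).prodMk measurable_snd)).indicator
      ((measurable_snd.comp measurable_fst) hΩ)
  have h2 : Measurable fun r : (E n × E n) × ℝ => Ω.indicator (fun _ => g (r.1.2, r.2)) r.1.1 :=
    (hg.comp ((measurable_snd.comp measurable_fst).prodMk measurable_snd)).indicator
      ((measurable_fst.comp measurable_fst) hΩ)
  unfold coupling
  fun_prop

lemma exteriorValue_bounds (hφ : MemCc Ω T φ) (hΦ : Continuous Φ) (hΦ0 : Φ 0 = 0) :
    ∃ (S : Set (E n)) (C : ℝ), IsCompact S ∧ S ⊆ exterior Ω ∧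
      (∀ p, |exteriorValue T Φ φ p| ≤ C) ∧ ∀ x t, x ∉ S → exteriorValue T Φ φ (x, t) = 0 := by
  obtain ⟨hc, S, hS, hSs, hS0⟩ := hφ
  obtain ⟨C, hC⟩ := hS.exists_bound_of_continuousOn
    (hΦ.comp_continuousOn (hc.mono fun p hp => ⟨mem_univ _, (hSs hp).2⟩))
  have h0 : ∀ p, p ∉ S → exteriorValue T Φ φ p = 0 := fun p hp => by
    by_cases ht : p.2 ∈ Ioo 0 T
    · rw [← Prod.mk.eta (p := p), exteriorValue_of_mem φ p.1 ht,
        hS0 p ⟨mem_univ _, Ioo_subset_Icc_self ht⟩ hp, hΦ0]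
    · exact exteriorValue_of_notMem φ p.1 ht
  refine ⟨Prod.fst '' S, max C 0, hS.image continuous_fst, ?_, fun p => ?_, fun x t hx => ?_⟩
  · rintro _ ⟨p, hp, rfl⟩
    exact (hSs hp).1
  · by_cases hp : p ∈ S
    · by_cases ht : p.2 ∈ Ioo 0 T
      · rw [← Prod.mk.eta (p := p), exteriorValue_of_mem φ p.1 ht]
        exact (hC p hp).trans (le_max_left _ _)
      · rw [← Prod.mk.eta (p := p), exteriorValue_of_notMem φ p.1 ht, abs_zero]
        exact le_max_right _ _
    · rw [h0 p hp, abs_zero]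
      exact le_max_right _ _
  · exact h0 _ fun h => hx ⟨_, h, rfl⟩

/-- The exterior values are supported in a compact subset of `Ω_e`, at distance at least some `δ >
0` from `Ω`, so the singularity of the kernel is never met. The coupling is therefore bounded with
bounded support. -/
lemma integrable_coupling (hΩ : MeasurableSet Ω) (hΩb : Bornology.IsBounded Ω) (hs : 0 < s)
    (hφ : MemCc Ω T φ) (hΦ : Continuous Φ) (hΦ0 : Φ 0 = 0) (c : ℝ) :
    Integrable (coupling Ω s c (exteriorValue T Φ φ)) := by
  obtain ⟨S, C, hS, hSΩ, hC, h0⟩ := exteriorValue_bounds hφ hΦ hΦ0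
  have hC0 : 0 ≤ C := (abs_nonneg _).trans (hC 0)
  obtain ⟨δ, hδ, hdist⟩ := Metric.exists_pos_forall_lt_edist hS isClosed_closure
    (disjoint_left.2 fun x hx hx' => hSΩ hx hx')
  obtain ⟨r, hr⟩ := (hS.isBounded.union hΩb).subset_closedBall 0
  have hp : 0 ≤ (n : ℝ) + 2 * s := by positivity
  set g := exteriorValue T Φ φ with hg
  set A : Set ((E n × E n) × ℝ) :=
    (Metric.closedBall 0 r ×ˢ Metric.closedBall 0 r) ×ˢ Ioo 0 T with hA
  have hfar : ∀ x ∈ S, ∀ y ∈ Ω, (δ : ℝ) ≤ ‖x - y‖ := fun x hx y hy => by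
    have h := hdist x hx y (subset_closure hy)
    rw [edist_nndist, ENNReal.coe_lt_coe] at h
    rw [← dist_eq_norm, ← coe_nndist]
    exact h.le
  have hterm : ∀ x y t, |Ω.indicator (fun _ => g (x, t)) y / ‖x - y‖ ^ ((n : ℝ) + 2 * s)|
      ≤ C / (δ : ℝ) ^ ((n : ℝ) + 2 * s) := fun x y t => by
    have hδp : 0 < (δ : ℝ) ^ ((n : ℝ) + 2 * s) := Real.rpow_pos_of_pos hδ _
    by_cases hy : y ∈ Ω
    · by_cases hx : x ∈ S
      · rw [indicator_of_mem hy, abs_div, abs_of_nonneg (Real.rpow_nonneg (norm_nonneg _) _)]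
        exact div_le_div₀ hC0 (hC _) hδp (Real.rpow_le_rpow hδ.le (hfar x hx y hy) hp)
      · rw [indicator_of_mem hy, h0 x t hx, zero_div, abs_zero]
        positivity
    · rw [indicator_of_notMem hy, zero_div, abs_zero]
      positivity
  have hzero : ∀ x y t, ¬(x ∈ Metric.closedBall 0 r ∧ y ∈ Metric.closedBall 0 r ∧ t ∈ Ioo 0 T) →
      Ω.indicator (fun _ => g (x, t)) y = 0 := fun x y t h => by
    by_contra hne
    have hy : y ∈ Ω := mem_of_indicator_ne_zero hne
    rw [indicator_of_mem hy] at hne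
    refine h ⟨hr (Or.inl (by_contra fun hx => hne (h0 x t hx))), hr (Or.inr hy),
      by_contra fun ht => hne (exteriorValue_of_notMem φ x ht)⟩
  rw [← integrableOn_iff_integrable_of_support_subset (s := A) fun q hq => ?_]
  · refine Measure.integrableOn_of_bounded (M := |c| * (2 * (C / (δ : ℝ) ^ ((n : ℝ) + 2 * s)))) ?_
      (measurable_coupling hΩ (measurable_exteriorValue hφ hΦ)).aestronglyMeasurable
      (ae_of_all _ fun q => ?_)
    · rw [hA, Measure.volume_eq_prod, Measure.prod_prod, Measure.volume_eq_prod, Measure.prod_prod]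
      exact ENNReal.mul_ne_top (ENNReal.mul_ne_top measure_closedBall_lt_top.ne
        measure_closedBall_lt_top.ne) (by simp)
    · have h1 := hterm q.1.1 q.1.2 q.2
      have h2 := hterm q.1.2 q.1.1 q.2
      rw [norm_sub_rev] at h2
      rw [coupling, norm_mul, Real.norm_eq_abs, Real.norm_eq_abs, add_div]
      exact mul_le_mul_of_nonneg_left ((abs_add_le _ _).trans (by linarith)) (abs_nonneg _)
  · by_contra hqA
    refine hq ?_
    rw [coupling, hzero _ _ _ fun h => hqA ⟨⟨h.1, h.2.1⟩, h.2.2⟩,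
      hzero _ _ _ fun h => hqA ⟨⟨h.2.1, h.1⟩, h.2.2⟩]
    simp

lemma ofReal_integral_posDiff {X : Type*} [NormedAddCommGroup X] [NormedSpace ℝ X]
    [FiniteDimensional ℝ X] [MeasureSpace X] [BorelSpace X] [(volume : Measure X).IsAddHaarMeasure]
    {f g : X × ℝ → ℝ} (hf : Integrable f) (hg : Integrable g) (T : ℝ) :
    ENNReal.ofReal (∫ t in Ioo 0 T, posDiff f g t t)
      = ∫⁻ p, ENNReal.ofReal (max (f p - g p) 0)
        ∂((volume : Measure X).prod (volume.restrict (Ioo 0 T))) := by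
  have hi : Integrable (fun p => max (f p - g p) 0)
      ((volume : Measure X).prod (volume.restrict (Ioo 0 T))) :=
    ((Integrable.slab hf _).sub (Integrable.slab hg _)).pos_part
  rw [← ofReal_integral_eq_lintegral_ofReal hi (ae_of_all _ fun _ => le_max_right _ _),
    integral_prod_symm _ hi]
  rfl

/-- The coupling is symmetric in the two space points, so it sees each exterior-interior pair in
both orders; this is the origin of the factor `2`. -/
lemma lintegral_coupling_le (hΩ : MeasurableSet Ω) (hφ₁ : MemCc Ω T φ₁) (hφ₂ : MemCc Ω T φ₂)
    (hΦ : Continuous Φ) (hΦ0 : Φ 0 = 0) (hc : 0 ≤ c) :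
    ∫⁻ p, ENNReal.ofReal (max (coupling Ω s c (exteriorValue T Φ φ₁) p
        - coupling Ω s c (exteriorValue T Φ φ₂) p) 0)
        ∂((volume : Measure (E n × E n)).prod (volume.restrict (Ioo 0 T)))
      ≤ ENNReal.ofReal (2 * c) * exteriorTerm Ω T s Φ φ₁ φ₂ := by
  have hm₁ := measurable_exteriorValue hφ₁ hΦ
  have hm₂ := measurable_exteriorValue hφ₂ hΦ
  set g₁ := exteriorValue T Φ φ₁ with hg₁
  set g₂ := exteriorValue T Φ φ₂ with hg₂
  have hcm₁ := measurable_coupling (s := s) (c := c) hΩ hm₁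
  have hcm₂ := measurable_coupling (s := s) (c := c) hΩ hm₂
  rw [lintegral_prod_symm' _ (by fun_prop), exteriorTerm, ← lintegral_const_mul' _ _
    ENNReal.ofReal_ne_top]
  refine setLIntegral_mono' measurableSet_Ioo fun t ht => ?_
  set k : E n → E n → ℝ≥0∞ := fun x y =>
    ENNReal.ofReal (max (g₁ (x, t) - g₂ (x, t)) 0 / ‖x - y‖ ^ ((n : ℝ) + 2 * s)) with hk
  set A : E n × E n → ℝ≥0∞ := fun z => Ω.indicator (fun _ => k z.1 z.2) z.2 with hA
  have hkm : Measurable fun z : E n × E n => k z.1 z.2 := by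
    simp only [hk]
    fun_prop
  have hAm : Measurable A := hkm.indicator (measurable_snd hΩ)
  have hle : ∀ z : E n × E n, ENNReal.ofReal (max (coupling Ω s c g₁ (z, t)
      - coupling Ω s c g₂ (z, t)) 0) ≤ ENNReal.ofReal c * (A z + A z.swap) := fun z => by
    have hn : 0 ≤ ‖z.1 - z.2‖ ^ ((n : ℝ) + 2 * s) := Real.rpow_nonneg (norm_nonneg _) _
    have hA' : ∀ x y, A (x, y) = ENNReal.ofReal (Ω.indicator (fun _ =>
        max (g₁ (x, t) - g₂ (x, t)) 0) y / ‖x - y‖ ^ ((n : ℝ) + 2 * s)) := fun x y => by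
      by_cases hy : y ∈ Ω <;> simp [hA, hk, hy]
    have hi : ∀ x y, 0 ≤ Ω.indicator (fun _ => max (g₁ (x, t) - g₂ (x, t)) 0) y := fun x y =>
      indicator_nonneg (fun _ _ => le_max_right _ _) _
    have hi' : ∀ x y, Ω.indicator (fun _ => g₁ (x, t)) y - Ω.indicator (fun _ => g₂ (x, t)) y
        ≤ Ω.indicator (fun _ => max (g₁ (x, t) - g₂ (x, t)) 0) y := fun x y => by
      by_cases hy : y ∈ Ω <;> simp [hy]
    rw [← Prod.mk.eta (p := z), Prod.swap_prod_mk, hA', hA', norm_sub_rev z.2 z.1,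
      ← ENNReal.ofReal_add (div_nonneg (hi _ _) hn) (div_nonneg (hi _ _) hn),
      ← ENNReal.ofReal_mul hc]
    refine ENNReal.ofReal_le_ofReal (max_le ?_ (mul_nonneg hc (add_nonneg
      (div_nonneg (hi _ _) hn) (div_nonneg (hi _ _) hn))))
    rw [coupling, coupling, ← mul_sub, ← sub_div, ← add_div]
    refine mul_le_mul_of_nonneg_left (div_le_div_of_nonneg_right ?_ hn) hc
    have h1 := hi' z.1 z.2
    have h2 := hi' z.2 z.1
    simp only
    linarith
  have hext : MeasurableSet (exterior Ω) := isClosed_closure.isOpen_compl.measurableSet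
  have hsum : ∫⁻ z, A z = ∫⁻ y in Ω, ∫⁻ x in exterior Ω,
      ENNReal.ofReal (max (Φ (φ₁ (x, t)) - Φ (φ₂ (x, t))) 0 / ‖x - y‖ ^ ((n : ℝ) + 2 * s)) := by
    rw [Measure.volume_eq_prod, lintegral_prod_symm' _ hAm, ← lintegral_indicator hΩ]
    refine lintegral_congr fun y => ?_
    by_cases hy : y ∈ Ω
    · rw [indicator_of_mem hy, ← lintegral_indicator hext]
      refine lintegral_congr fun x => ?_
      simp only [hA, indicator_of_mem hy, hk]
      by_cases hx : x ∈ exterior Ω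
      · rw [indicator_of_mem hx, hg₁, hg₂, exteriorValue_of_mem φ₁ x ht,
          exteriorValue_of_mem φ₂ x ht]
      · rw [indicator_of_notMem hx, hg₁, hg₂, exteriorValue_eq_zero hφ₁ hΦ0 x hx,
          exteriorValue_eq_zero hφ₂ hΦ0 x hx]
        simp
    · simp [hA, hy]
  calc ∫⁻ z, ENNReal.ofReal (max (coupling Ω s c g₁ (z, t) - coupling Ω s c g₂ (z, t)) 0)
      ≤ ∫⁻ z, ENNReal.ofReal c * (A z + A z.swap) := lintegral_mono hle
    _ = ENNReal.ofReal c * ((∫⁻ z, A z) + ∫⁻ z, A z) := by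
      rw [lintegral_const_mul' _ _ ENNReal.ofReal_ne_top, lintegral_add_left hAm]
      congr 2
      rw [Measure.volume_eq_prod]
      exact lintegral_prod_swap A
    _ = _ := by
      rw [hsum, ← two_mul, ← mul_assoc, ENNReal.ofReal_mul zero_le_two, ENNReal.ofReal_ofNat,
        mul_comm (ENNReal.ofReal c)]

end Coupling

/-! ### From averaged to pointwise bounds in time. -/

section Localization

/-- A function whose smooth averages are bounded is bounded almost everywhere. -/
lemma ae_le_of_smooth_average_le {T c : ℝ} {J : ℝ → ℝ} (hJ : Integrable J)
    (h : ∀ g : ℝ → ℝ, ContDiff ℝ (⊤ : ℕ∞) g → HasCompactSupport g → (∀ t, 0 ≤ g t) →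
      tsupport g ⊆ Ioo 0 T → ∫ t, g t = 1 → ∫ t, g t * J t ≤ c) :
    ∀ᵐ t, t ∈ Ioo 0 T → J t ≤ c := by
  -- Bumps with a fixed ratio of radii shrink regularly, so their averages of `J` converge to `J t`
  -- for almost every `t`. For `t` in `(0,T)` they are eventually supported there.
  let χ : ℕ → ContDiffBump (0 : ℝ) := fun k =>
    ⟨(1 / ((k : ℝ) + 1)) / 2, 1 / ((k : ℝ) + 1), half_pos Nat.one_div_pos_of_nat,
      half_lt_self Nat.one_div_pos_of_nat⟩
  have hχ : Tendsto (fun k => (χ k).rOut) atTop (𝓝 0) := tendsto_one_div_add_atTop_nhds_zero_nat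
  have hlim := ContDiffBump.ae_convolution_tendsto_right_of_locallyIntegrable (μ := volume)
    (K := 2) hχ (Eventually.of_forall fun k => by simp only [χ]; linarith) hJ.locallyIntegrable
  filter_upwards [hlim] with t ht htT
  have hd : ∀ᶠ k in atTop, (χ k).rOut < min t (T - t) :=
    hχ.eventually (gt_mem_nhds (lt_min htT.1 (sub_pos.2 htT.2)))
  refine le_of_tendsto ht (hd.mono fun k hk => ?_)
  set g : ℝ → ℝ := fun τ => (χ k).normed volume (t - τ) with hg
  have hgd : ContDiff ℝ (⊤ : ℕ∞) g := (χ k).contDiff_normed.comp (contDiff_const.sub contDiff_id)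
  have hsub : tsupport g ⊆ Metric.closedBall t (χ k).rOut := by
    refine closure_minimal (fun τ hτ => ?_) Metric.isClosed_closedBall
    have h1 := subset_tsupport _ (show t - τ ∈ Function.support ((χ k).normed volume) from hτ)
    rw [(χ k).tsupport_normed_eq, mem_closedBall_zero_iff] at h1
    rwa [Metric.mem_closedBall, dist_comm, dist_eq_norm]
  have hgc : HasCompactSupport g :=
    (isCompact_closedBall t _).of_isClosed_subset (isClosed_tsupport _) hsub
  have hgT : tsupport g ⊆ Ioo 0 T := by
    refine hsub.trans ?_
    rw [Real.closedBall_eq_Icc]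
    have h1 := lt_min_iff.1 hk
    exact Icc_subset_Ioo (by linarith) (by linarith)
  have h1 : ∫ τ, g τ = 1 := by
    simp only [hg]
    rw [integral_sub_left_eq_self ((χ k).normed volume) volume t]
    exact (χ k).integral_normed
  have h2 := h g hgd hgc (fun τ => (χ k).nonneg_normed _) hgT h1
  rw [MeasureTheory.convolution_eq_swap]
  exact h2

end Localization

/-! ### The comparison principle for weak solutions. -/

section Final

variable {Ω : Set (E n)} {T s c R Λ : ℝ} {K : E n → E n → ℝ} {ρ q : E n → ℝ} {Φ b : ℝ → ℝ}
  {F₁ F₂ φ₁ φ₂ u₁ u₂ : E n × ℝ → ℝ} {u₁₀ u₂₀ : E n → ℝ}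

/-- The `L¹` comparison principle for weak solutions. -/
theorem IsWeakSolution.comparison (hT : 0 < T) (hs : 0 < s) (hΩo : IsOpen Ω)
    (hΩb : Bornology.IsBounded Ω) (hΦ : IsExpanding Φ) (hbm : Measurable b)
    (hb : ∀ t, Φ (b t) = t) (hKm : Measurable (Function.uncurry K))
    (hK : ∀ x y, 0 ≤ K x y ∧ K x y ≤ Λ) (hρm : Measurable ρ) (hc : 0 < c)
    (hρ : ∀ x, c ≤ ρ x ∧ ρ x ≤ R) (hqm : Measurable q) {Cq : ℝ} (hq : ∀ x, 0 ≤ q x ∧ q x ≤ Cq)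
    (hF₁ : MemL2Cyl Ω T F₁) (hF₂ : MemL2Cyl Ω T F₂) (hφ₁ : MemCc Ω T φ₁) (hφ₂ : MemCc Ω T φ₂)
    (hu₁₀ : IsInitialDatum Ω s u₁₀) (hu₂₀ : IsInitialDatum Ω s u₂₀)
    (hu₁ : IsWeakSolution Ω T s K ρ q Φ F₁ φ₁ u₁₀ u₁)
    (hu₂ : IsWeakSolution Ω T s K ρ q Φ F₂ φ₂ u₂₀ u₂) :
    ∀ᵐ t ∂volume.restrict (Ioo 0 T),
      ENNReal.ofReal c * spaceTerm Ω (fun x => u₁ (x, t)) (fun x => u₂ (x, t))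
        ≤ ENNReal.ofReal R * spaceTerm Ω u₁₀ u₂₀ + (sourceTerm Ω T F₁ F₂
          + ENNReal.ofReal (2 * Λ) * exteriorTerm Ω T s Φ φ₁ φ₂) := by
  have hΩm := hΩo.measurableSet
  have hΩv : volume Ω ≠ ∞ := hΩb.measure_lt_top.ne
  have hΩT : MeasurableSet (cyl Ω T) := hΩm.prod measurableSet_Ioo
  have hΛ : 0 ≤ Λ := (hK 0 0).1.trans (hK 0 0).2
  have hρ0 : ∀ x, 0 ≤ ρ x ∧ ρ x ≤ R := fun x => ⟨hc.le.trans (hρ x).1, (hρ x).2⟩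
  have hR : 0 ≤ R := (hρ0 0).1.trans (hρ0 0).2
  have habs : ∀ {a C : ℝ}, 0 ≤ a ∧ a ≤ C → |a| ≤ C := fun h => by
    rw [abs_of_nonneg h.1]
    exact h.2
  obtain ⟨v₁, f₁, w₁, e₁, -, f₁2, f₁0, f₁F, v₁u, w₁u, -, -⟩ :=
    hu₁.exists_isEnergySolution hT hΩm hΩv hΦ hbm hb hKm (fun x y => habs (hK x y)) hρm
      (fun x => habs (hρ0 x)) hqm (fun x => habs (hq x)) hF₁ hφ₁ hu₁₀
  obtain ⟨v₂, f₂, w₂, e₂, f₂m, f₂2, f₂0, f₂F, v₂u, w₂u, ⟨M, hM⟩, w₂t⟩ :=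
    hu₂.exists_isEnergySolution hT hΩm hΩv hΦ hbm hb hKm (fun x y => habs (hK x y)) hρm
      (fun x => habs (hρ0 x)) hqm (fun x => habs (hq x)) hF₂ hφ₂ hu₂₀
  have fint : ∀ {f : E n × ℝ → ℝ}, MemLp f 2 volume →
      (∀ x t, (x ∉ Ω ∨ t ∉ Ioo 0 T) → f (x, t) = 0) → Integrable f := fun hf hf0 => by
    refine integrable_of_memLp_of_support hf (S := cyl Ω T) ?_ fun p hp => hf0 p.1 p.2 ?_
    · rw [cyl, Measure.volume_eq_prod, Measure.prod_prod]
      exact ENNReal.mul_ne_top hΩv (by simp)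
    · by_contra! h
      exact hp h
  have if₁ := fint f₁2 f₁0
  have if₂ := fint f₂2 f₂0
  have ig₁ := integrable_coupling hΩm hΩb hs hφ₁ hΦ.continuous hΦ.zero Λ
  have ig₂ := integrable_coupling hΩm hΩb hs hφ₂ hΦ.continuous hΦ.zero Λ
  have hgm₂ := measurable_coupling (s := s) (c := Λ) hΩm (measurable_exteriorValue hφ₂ hΦ.continuous)
  have i₁ : Integrable (fun p : E n × ℝ => ρ p.1 * v₁ p) :=
    Integrable.density_mul (hρm.comp measurable_fst) (fun q => hρ0 q.1) (e₁.integrable hΩv)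
  have i₂ : Integrable (fun p : E n × ℝ => ρ p.1 * v₂ p) :=
    Integrable.density_mul (hρm.comp measurable_fst) (fun q => hρ0 q.1) (e₂.integrable hΩv)
  set J : ℝ → ℝ := fun t => posDiff (fun p => ρ p.1 * v₁ p) (fun p => ρ p.1 * v₂ p) t t with hJ
  set H : ℝ → ℝ := fun t => posDiff f₁ f₂ t t + posDiff (coupling Ω s Λ (exteriorValue T Φ φ₁))
    (coupling Ω s Λ (exteriorValue T Φ φ₂)) t t with hH
  have hdF := integrable_posDiff_diag if₁ if₂
  have hdG := integrable_posDiff_diag ig₁ ig₂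
  have hHi : Integrable H := hdF.add hdG
  have hH0 : ∀ t, 0 ≤ H t := fun t => add_nonneg (posDiff_nonneg _ _ _ _) (posDiff_nonneg _ _ _ _)
  set S₀ := ∫ x, ρ x * max (w₁ x - w₂ x) 0 with hS₀
  have hS₀0 : 0 ≤ S₀ := integral_nonneg fun x => mul_nonneg (hρ0 x).1 (le_max_right _ _)
  -- The time test function is the primitive of a probability density `g`. Thus `-θ' = g` produces
  -- the average of `J`, while `0 ≤ θ ≤ 1` removes the weight from the nonnegative right side.
  have hbound : ∀ᵐ t, t ∈ Ioo 0 T → J t ≤ S₀ + ∫ t in Ioo 0 T, H t := by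
    refine ae_le_of_smooth_average_le (integrable_posDiff_diag i₁ i₂) fun g hg hgc hg0 hgs hg1 => ?_
    obtain ⟨θ, hθ, hθc, hθs, hθd, hθi, hθ0⟩ := exists_smooth_primitive hg hgc hT hgs
    have hgi : Integrable g := hg.continuous.integrable_of_hasCompactSupport hgc
    have hgz : ∀ t ∉ Ioo 0 T, g t = 0 := fun t ht =>
      image_eq_zero_of_notMem_tsupport fun h => ht (hgs h)
    have hθle : ∀ t ∈ Icc 0 T, θ t ≤ 1 := fun t ht => by
      rw [hθi t ht.1, intervalIntegral.integral_of_le ht.2, ← hg1]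
      exact setIntegral_le_integral hgi (ae_of_all _ hg0)
    have key := e₁.comparison hT hΩm hΩv e₂ hΦ hρm hρ0 hbm hb hM w₂t if₁ if₂ f₂m ig₁ ig₂ hgm₂
      (fun P hP => pairing_sub_le e₁ e₂ hΦ hK (fun x => (hq x).1) if₁ if₂ ig₁ ig₂
        (fun x hx t => exteriorValue_eq_zero hφ₁ hΦ.zero x (notMem_exterior hx) t)
        (fun x hx t => exteriorValue_eq_zero hφ₂ hΦ.zero x (notMem_exterior hx) t) hP)
      hθ hθc (hθ0 hg0) hθs
    have hl : ∫ t, g t * J t = ∫ t in Ioo 0 T, -deriv θ t * J t := by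
      rw [← setIntegral_eq_integral_of_forall_compl_eq_zero (s := Ioo 0 T)
        fun t ht => by rw [hgz t ht, zero_mul]]
      exact setIntegral_congr_fun measurableSet_Ioo fun t ht => by
        simp only [hθd t ht.1.le, neg_neg]
    rw [hl]
    refine key.trans (add_le_add (mul_le_of_le_one_left hS₀0 (hθle 0 ⟨le_rfl, hT.le⟩)) ?_)
    obtain ⟨Cθ, hCθ⟩ := hθc.exists_bound_of_continuous hθ.continuous
    refine setIntegral_mono_on (hHi.restrict.bdd_mul hθ.continuous.aestronglyMeasurable
      (ae_of_all _ hCθ)) hHi.restrict measurableSet_Ioo fun t ht => ?_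
    exact mul_le_of_le_one_left (hH0 t) (hθle t ⟨ht.1.le, ht.2.le⟩)
  have hHF : ENNReal.ofReal (∫ t in Ioo 0 T, H t) ≤ sourceTerm Ω T F₁ F₂
      + ENNReal.ofReal (2 * Λ) * exteriorTerm Ω T s Φ φ₁ φ₂ := by
    rw [hH, integral_add hdF.restrict hdG.restrict, ENNReal.ofReal_add
      (integral_nonneg fun t => posDiff_nonneg _ _ _ _)
      (integral_nonneg fun t => posDiff_nonneg _ _ _ _), ofReal_integral_posDiff if₁ if₂,
      ofReal_integral_posDiff ig₁ ig₂]
    refine add_le_add ?_ (lintegral_coupling_le hΩm hφ₁ hφ₂ hΦ.continuous hΦ.zero hΛ)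
    rw [prod_restrict_eq]
    refine (setLIntegral_le_lintegral _ _).trans ?_
    rw [sourceTerm, ← lintegral_congr_ae (show (fun p => ENNReal.ofReal (max (f₁ p - f₂ p) 0))
      =ᵐ[volume.restrict (cyl Ω T)] fun p => ENNReal.ofReal (max (F₁ p - F₂ p) 0) from by
        filter_upwards [f₁F, f₂F] with p h1 h2
        rw [h1, h2]), ← lintegral_indicator hΩT]
    refine lintegral_mono fun p => ?_
    by_cases hp : p ∈ cyl Ω T
    · rw [indicator_of_mem hp]
    · have hp' : p.1 ∉ Ω ∨ p.2 ∉ Ioo 0 T := by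
        by_contra! h
        exact hp h
      rw [indicator_of_notMem hp, ← Prod.mk.eta (p := p), f₁0 _ _ hp', f₂0 _ _ hp']
      simp
  have hS : ENNReal.ofReal S₀ ≤ ENNReal.ofReal R * spaceTerm Ω u₁₀ u₂₀ := by
    have hi : Integrable fun x => ρ x * max (w₁ x - w₂ x) 0 :=
      Integrable.density_mul hρm hρ0 ((e₁.integrable₀ hΩv).sub (e₂.integrable₀ hΩv)).pos_part
    rw [hS₀, ofReal_integral_eq_lintegral_ofReal hi (ae_of_all _ fun x =>
      mul_nonneg (hρ0 x).1 (le_max_right _ _)), spaceTerm, ← lintegral_const_mul' _ _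
      ENNReal.ofReal_ne_top, ← lintegral_indicator hΩm]
    refine lintegral_mono_ae ?_
    filter_upwards [w₁u, w₂u] with x h1 h2
    by_cases hx : x ∈ Ω
    · rw [indicator_of_mem hx, ← h1, ← h2, ← ENNReal.ofReal_mul hR]
      exact ENNReal.ofReal_le_ofReal (mul_le_mul_of_nonneg_right (hρ x).2 (le_max_right _ _))
    · rw [e₁.eq_zero₀ x hx, e₂.eq_zero₀ x hx]
      simp
  have hslice : ∀ᵐ t ∂volume.restrict (Ioo 0 T), ∀ᵐ x ∂volume.restrict Ω,
      v₁ (x, t) = u₁ (x, t) ∧ v₂ (x, t) = u₂ (x, t) := by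
    have h := v₁u.and v₂u
    rw [cyl, Measure.volume_eq_prod, ← Measure.prod_restrict] at h
    exact Measure.ae_ae_of_ae_prod
      ((Measure.measurePreserving_swap (μ := volume.restrict (Ioo 0 T))
        (ν := (volume : Measure (E n)).restrict Ω)).quasiMeasurePreserving.ae h)
  have hsl : ∀ᵐ t ∂volume.restrict (Ioo 0 T),
      Integrable fun x => max (ρ x * v₁ (x, t) - ρ x * v₂ (x, t)) 0 :=
    (((Integrable.slab i₁ (Ioo 0 T)).sub (Integrable.slab i₂ (Ioo 0 T))).pos_part).prod_left_ae
  filter_upwards [hslice, hsl, (ae_restrict_iff' measurableSet_Ioo).2 hbound] with t h1 h2 h3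
  -- The lower bound `c ≤ ρ` strips the density from the left side.
  have h4 : ENNReal.ofReal c * spaceTerm Ω (fun x => u₁ (x, t)) (fun x => u₂ (x, t))
      ≤ ENNReal.ofReal (J t) := by
    have e : J t = ∫ x, max (ρ x * v₁ (x, t) - ρ x * v₂ (x, t)) 0 := rfl
    rw [e, ofReal_integral_eq_lintegral_ofReal h2 (ae_of_all _ fun x => le_max_right _ _),
      spaceTerm, ← lintegral_const_mul' _ _ ENNReal.ofReal_ne_top]
    refine (lintegral_mono_ae ?_).trans (setLIntegral_le_lintegral Ω _)
    filter_upwards [h1] with x hx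
    rw [← hx.1, ← hx.2, ← ENNReal.ofReal_mul hc.le, ← mul_sub]
    refine ENNReal.ofReal_le_ofReal ?_
    have hmax := mul_max_of_nonneg (v₁ (x, t) - v₂ (x, t)) 0 (hρ0 x).1
    rw [mul_zero] at hmax
    rw [← hmax]
    exact mul_le_mul_of_nonneg_right (hρ x).1 (le_max_right _ _)
  refine h4.trans ((ENNReal.ofReal_le_ofReal h3).trans ?_)
  rw [ENNReal.ofReal_add hS₀0 (integral_nonneg hH0)]
  exact add_le_add hS hHF

end Final

end NPME

end

theorem mainTheorem4 {n : ℕ} (hn : 0 < n) (Ω : Set (NPME.E n))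
    (hΩ : NPME.IsBoundedLipschitzDomain Ω) (T : ℝ) (hT : 0 < T)
    (s : ℝ) (α : ℝ≥0) (hs : 0 < s) (hsα : s < α) (hα : α ≤ 1) (m : ℝ) (hm : 1 < m)
    (K : NPME.E n → NPME.E n → ℝ) (hK : NPME.IsKernelL0 K)
    (ρ q : NPME.E n → ℝ) (hρ : NPME.MemC1HolderNonneg α ρ) (hq : NPME.MemC1HolderNonneg α q)
    (hρell : NPME.UniformlyElliptic ρ) :
    ∃ C : ℝ, 0 < C ∧
      -- the data, the two solutions, and the approximating objects (`j = 0, 1`)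
      ∀ (F φ u : Fin 2 → NPME.E n × ℝ → ℝ) (u₀ : Fin 2 → NPME.E n → ℝ)
        (Φε : ℝ → ℝ → ℝ) (Fε φε uε : Fin 2 → ℝ → NPME.E n × ℝ → ℝ)
        (u₀ε : Fin 2 → ℝ → NPME.E n → ℝ),
        (∀ j, NPME.MemL2Cyl Ω T (F j)) →
        (∀ j, NPME.IsExteriorDatum Ω T s (NPME.Phi m) (φ j)) →
        (∀ j, NPME.IsInitialDatum Ω s (u₀ j)) →
        (∀ j, NPME.IsWeakSolution Ω T s K ρ q (NPME.Phi m) (F j) (φ j) (u₀ j) (u j)) →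
        NPME.IsRegularization m Φε →
        (∀ j, ∀ᶠ ε in 𝓝[>] (0 : ℝ), NPME.MemL2Cyl Ω T (Fε j ε)) →
        (∀ j, ∀ᶠ ε in 𝓝[>] (0 : ℝ), NPME.IsExteriorDatum Ω T s (Φε ε) (φε j ε)) →
        (∀ j, ∀ᶠ ε in 𝓝[>] (0 : ℝ), NPME.IsInitialDatum Ω s (u₀ε j ε)) →
        (∀ j, ∀ᶠ ε in 𝓝[>] (0 : ℝ),
          NPME.MemH1L2 Ω T (uε j ε) ∧ NPME.MemL2Hs T s (uε j ε)) →
        liminf (fun ε => NPME.sourceTerm Ω T (Fε 0 ε) (Fε 1 ε)) (𝓝[>] (0 : ℝ))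
          ≤ NPME.sourceTerm Ω T (F 0) (F 1) →
        liminf (fun ε => NPME.exteriorTerm Ω T s (Φε ε) (φε 0 ε) (φε 1 ε)) (𝓝[>] (0 : ℝ))
          ≤ NPME.exteriorTerm Ω T s (NPME.Phi m) (φ 0) (φ 1) →
        (∀ j, Tendsto (fun ε => eLpNorm (fun x => u₀ε j ε x - u₀ j x) 1 (volume.restrict Ω))
          (𝓝[>] (0 : ℝ)) (𝓝 0)) →
        (∀ j, NPME.WeakTendstoL1 (volume.restrict (NPME.cyl Ω T)) (uε j) (u j)) →
        (∀ j, ∀ᶠ ε in 𝓝[>] (0 : ℝ),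
          NPME.IsWeakSolution Ω T s K ρ q (Φε ε) (Fε j ε) (φε j ε) (u₀ε j ε) (uε j ε)) →
        ∀ᵐ t₀ ∂(volume.restrict (Ioo 0 T)),
          NPME.spaceTerm Ω (fun x => u 0 (x, t₀)) (fun x => u 1 (x, t₀))
            ≤ ENNReal.ofReal C *
              (NPME.sourceTerm Ω T (F 0) (F 1) + NPME.spaceTerm Ω (u₀ 0) (u₀ 1)
                + NPME.exteriorTerm Ω T s (NPME.Phi m) (φ 0) (φ 1)) := by
  obtain ⟨hKm, -, l, Λ, hl, -, hKb⟩ := hK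
  obtain ⟨c, R, hc, hρb⟩ := hρell
  obtain ⟨Cq, hCq⟩ := hq.2.1
  have hΛ : 0 < Λ := hl.trans_le ((hKb 0 0).1.trans (hKb 0 0).2)
  -- `R` comes from the initial data, `1` from the sources, `2 * Λ` from the exterior interaction;
  -- the prefactor `c⁻¹` undoes the lower bound of `ρ`.
  set M : ℝ := max R (max 1 (2 * Λ)) with hM
  have hM0 : 0 < M := one_pos.trans_le ((le_max_left _ _).trans (le_max_right _ _))
  refine ⟨c⁻¹ * M, mul_pos (inv_pos.2 hc) hM0, ?_⟩
  intro F φ u u₀ Φε Fε φε uε u₀ε hF hφ hu₀ hu _ _ _ _ _ _ _ _ _ _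
  have hb : ∀ t, NPME.Phi m (NPME.Phi m⁻¹ t) = t := fun t => by
    have h := NPME.Phi_inv (inv_pos.2 (zero_lt_one.trans hm)) t
    rwa [inv_inv] at h
  filter_upwards [(hu 0).comparison hT hs hΩ.1 hΩ.2.1 (NPME.isExpanding_Phi hm)
    (NPME.measurable_Phi m⁻¹) hb hKm (fun x y => ⟨hl.le.trans (hKb x y).1, (hKb x y).2⟩)
    hρ.1.continuous.measurable hc hρb hq.1.continuous.measurable
    (fun x => ⟨hq.2.2.2.2 x, (le_abs_self _).trans (hCq x)⟩) (hF 0) (hF 1) (hφ 0).1 (hφ 1).1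
    (hu₀ 0) (hu₀ 1) (hu 1)] with t ht
  have h1 : ENNReal.ofReal R ≤ ENNReal.ofReal M := ENNReal.ofReal_le_ofReal (le_max_left _ _)
  have h2 : 1 ≤ ENNReal.ofReal M := by
    rw [← ENNReal.ofReal_one]
    exact ENNReal.ofReal_le_ofReal ((le_max_left _ _).trans (le_max_right _ _))
  have h3 : ENNReal.ofReal (2 * Λ) ≤ ENNReal.ofReal M :=
    ENNReal.ofReal_le_ofReal ((le_max_right _ _).trans (le_max_right _ _))
  have h4 := ht.trans (add_le_add (mul_le_mul' h1 le_rfl)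
    (add_le_add (le_mul_of_one_le_left zero_le h2) (mul_le_mul' h3 le_rfl)))
  have h5 := mul_le_mul' (le_refl (ENNReal.ofReal c⁻¹)) h4
  rw [← mul_assoc, ← ENNReal.ofReal_mul (inv_nonneg.2 hc.le), inv_mul_cancel₀ hc.ne',
    ENNReal.ofReal_one, one_mul] at h5
  refine h5.trans (le_of_eq ?_)
  rw [ENNReal.ofReal_mul (inv_nonneg.2 hc.le)]
  ring
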